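/- **Theorem 1.1.** Let $d,n$ be non-negative integers, let $m\ge 0$, and let $\alpha_0,\alpha_1,\dots,\alpha_d$ be Hermitian $n\times n$ complex matrices with $\alpha_i\alpha_j+\alpha_j\alpha_i=2\delta_{ij}I_n$ for $0\le i,j\le d$. Put $$\mathcal D_m=2\pi m\,\alpha_0-i\sum_{j=1}^d\alpha_j\partial_j ,$$ acting on $\mathcal S'(\mathbb R^d,\mathbb C^n)$, and consider the Cauchy problem $$i\partial_t\psi=\mathcal D_m\psi,\qquad \psi(0)=\psi_0, \qquad (t\in\mathbb R),\tag{1}$$ where a solution is a map $\psi:\mathbb R\to\mathcal S'(\mathbb R^d,\mathbb C^n)$ such that, for every $\varphi\in\mathcal S(\mathbb R^d)$, the function $t\mapsto\psi(t)(\varphi)$ is differentiable with $i\frac{d}{dt}\psi(t)(\varphi)=(\mathcal D_m\psi(t))(\varphi)$ for all $t$. For a non-zero window $g\in\mathcal S(\mathbb R^d)$ and $f\in\mathcal S'(\mathbb R^d,\mathbb C^n)$ let $V_gf(x,\xi)=\langle f,M_\xi T_xg\rangle$, where $M_\xi T_xg(y)=e^{2\pi i y\cdot\xi}g(y-x)$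 and $\langle\cdot,\cdot\rangle$ is conjugate-linear in the second argument; let $\langle x\rangle=(1+|x|^2)^{1/2}$. For $1\le p,q\le\infty$ and $r,s\in\mathbb R$ put $$\|f\|_{M^{p,q}_{r,s}}=\Big\|\,\langle\xi\rangle^{s}\,\big\|\langle x\rangle^{r}V_gf(x,\xi)\big\|_{L^p_x}\Big\|_{L^q_\xi},\qquad \|f\|_{W^{p,q}_{r,s}}=\Big\|\,\langle x\rangle^{s}\,\big\|\langle \xi\rangle^{r}V_gf(x,\xi)\big\|_{L^p_\xi}\Big\|_{L^q_x},$$ and let $M^{p,q}_{r,s}(\mathbb R^d,\mathbb C^n)$, $W^{p,q}_{r,s}(\mathbb R^d,\mathbb C^n)$ be the spaces of those $f\in\mathcal S'(\mathbb R^d,\mathbb C^n)$ for which the respective norm is finite for some non-zero window $g$. For every $\psi_0\in\mathcal S'(\mathbb R^d,\mathbb C^n)$ the problem (1) has a unique solution $\psi$ (that is, $\psi(t)=e^{-it\mathcal D_m}\psi_0$). Let $1\le p,q\le\infty$, $r,s\in\mathbb R$, let $X$ be $M^{p,q}_{r,s}(\mathbb R^d,\mathbb C^n)$ or $W^{p,q}_{r,s}(\mathbb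 R^d,\mathbb C^n)$, and let $\|\cdot\|_X$ be its norm for an arbitrary fixed non-zero window. Then for every $t\in\mathbb R$ there is a constant $C_X(t)>0$ such that, for every $\psi_0\in X$, the solution of (1) satisfies $\psi(t)\in X$ and $$\|\psi(t)\|_X\le C_X(t)\,\|\psi_0\|_X .$$ If moreover $X=M^{p,q}_{0,s}(\mathbb R^d,\mathbb C^n)$, the constants $C_X(t)$ can be chosen so that, for some constant $C'>0$ independent of $t$, $$C_X(t)\le C'(1+|t|)^{d\,|1/2-1/p|}\qquad\text{for all } t\in\mathbb R .$$ -/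

import Mathlib

open MeasureTheory SchwartzMap
open scoped ENNReal SchwartzMap LineDeriv InnerProductSpace

noncomputable section

namespace Dirac

/-- Euclidean space `ℝ^d`. -/
abbrev Rd (d : ℕ) : Type := EuclideanSpace ℝ (Fin d)

/-- The space `ℂ^n` with its Hermitian norm. -/
abbrev Cn (n : ℕ) : Type := EuclideanSpace ℂ (Fin n)

/-! ### The short-time Fourier transform -/

/-- The character `y ↦ exp (2 π i y · ξ)`. -/
def character {d : ℕ} (ξ y : Rd d) : ℂ :=
  Complex.exp (2 * Real.pi * Complex.I * (⟪y, ξ⟫_ℝ : ℝ))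

theorem character_hasTemperateGrowth {d : ℕ} (ξ : Rd d) :
    (character ξ).HasTemperateGrowth := by
  have h1 : (fun t : ℝ => Complex.exp (2 * Real.pi * Complex.I * (t : ℝ))).HasTemperateGrowth := by
    refine ⟨(contDiff_const.mul Complex.ofRealCLM.contDiff).cexp, fun k => ⟨0, (2 * Real.pi) ^ k, fun t => ?_⟩⟩
    have hk : ∀ k : ℕ, iteratedDeriv k
        (fun t : ℝ => Complex.exp (2 * Real.pi * Complex.I * (t : ℝ))) =
        fun t : ℝ => (2 * Real.pi * Complex.I) ^ k *
          Complex.exp (2 * Real.pi * Complex.I * (t : ℝ)) := by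
      intro k
      induction k with
      | zero => simp
      | succ k ih =>
        rw [iteratedDeriv_succ, ih]
        funext t
        have h := (((hasDerivAt_id (t : ℂ)).const_mul
          (2 * Real.pi * Complex.I)).cexp.comp_ofReal).const_mul
            ((2 * Real.pi * Complex.I) ^ k)
        simp only [id] at h
        rw [h.deriv]
        ring
    rw [norm_iteratedFDeriv_eq_norm_iteratedDeriv, hk]
    have hre : (2 * (Real.pi : ℂ) * Complex.I * (t : ℂ)).re = 0 := by simp
    simp [Complex.norm_exp, hre, abs_of_pos Real.pi_pos]
  exact h1.comp (Function.hasTemperateGrowth_inner_left ξ)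

/-- The translation `T_x g (y) = g (y - x)`. -/
def translation {d : ℕ} (x : Rd d) (g : 𝓢(Rd d, ℂ)) : 𝓢(Rd d, ℂ) :=
  SchwartzMap.compSubConstCLM ℂ x g

/-- The modulation `M_ξ g (y) = exp (2 π i y · ξ) g (y)`. -/
def modulation {d : ℕ} (ξ : Rd d) (g : 𝓢(Rd d, ℂ)) : 𝓢(Rd d, ℂ) :=
  SchwartzMap.smulLeftCLM ℂ (character ξ) g

/-- Pointwise complex conjugation of a Schwartz function. -/
def conjugate {d : ℕ} (g : 𝓢(Rd d, ℂ)) : 𝓢(Rd d, ℂ) :=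
  SchwartzMap.postcompCLM (𝕜 := ℝ) (Complex.conjCLE : ℂ →L[ℝ] ℂ) g

theorem conjugate_modulation_translation_apply {d : ℕ} (x ξ y : Rd d) (g : 𝓢(Rd d, ℂ)) :
    conjugate (modulation ξ (translation x g)) y =
      star (Complex.exp (2 * Real.pi * Complex.I * (⟪y, ξ⟫_ℝ : ℝ)) * g (y - x)) := by
  simp [conjugate, modulation, translation,
    SchwartzMap.smulLeftCLM_apply_apply (character_hasTemperateGrowth ξ), character]

/-- The short-time Fourier transform `V_g f (x, ξ) = ⟨f, M_ξ T_x g⟩` of a vector-valued temperate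
distribution, where `⟨f, φ⟩` is conjugate-linear in `φ`. Elements of `𝓢'` act linearly on test
functions here, so `⟨f, φ⟩` is the value of `f` at the complex conjugate of `φ`. -/
def stft {d n : ℕ} (g : 𝓢(Rd d, ℂ)) (f : 𝓢'(Rd d, Cn n)) (x ξ : Rd d) : Cn n :=
  f (conjugate (modulation ξ (translation x g)))

/-! ### Weighted modulation and Wiener amalgam spaces -/

/-- The weight `⟨x⟩^r = (1 + |x|^2)^(r/2)`. -/
def weight {d : ℕ} (r : ℝ) (x : Rd d) : ℝ := (1 + ‖x‖ ^ 2) ^ (r / 2)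

/-- The (extended) norm of `M^{p,q}_{r,s}(ℝ^d, ℂ^n)` computed with the window `g`: the
`L^q_s(dξ)` norm of the `L^p_r(dx)` norm of `V_g f (x, ξ)`. It is `∞` off the space. -/
def modulationNorm {d n : ℕ} (g : 𝓢(Rd d, ℂ)) (p q : ℝ≥0∞) (r s : ℝ)
    (f : 𝓢'(Rd d, Cn n)) : ℝ≥0∞ :=
  eLpNorm (fun ξ : Rd d => ENNReal.ofReal (weight s ξ) *
    eLpNorm (fun x : Rd d => weight r x • stft g f x ξ) p volume) q volume

/-- The (extended) norm of `W^{p,q}_{r,s}(ℝ^d, ℂ^n)` computed with the window `g`: the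
`L^q_s(dx)` norm of the `L^p_r(dξ)` norm of `V_g f (x, ξ)`. It is `∞` off the space. -/
def amalgamNorm {d n : ℕ} (g : 𝓢(Rd d, ℂ)) (p q : ℝ≥0∞) (r s : ℝ)
    (f : 𝓢'(Rd d, Cn n)) : ℝ≥0∞ :=
  eLpNorm (fun x : Rd d => ENNReal.ofReal (weight s x) *
    eLpNorm (fun ξ : Rd d => weight r ξ • stft g f x ξ) p volume) q volume

/-- The modulation space `M^{p,q}_{r,s}(ℝ^d, ℂ^n)`. -/
def modulationSpace (d n : ℕ) (p q : ℝ≥0∞) (r s : ℝ) : Set 𝓢'(Rd d, Cn n) :=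
  {f | ∃ g : 𝓢(Rd d, ℂ), g ≠ 0 ∧ modulationNorm g p q r s f < ∞}

/-- The Wiener amalgam space `W^{p,q}_{r,s}(ℝ^d, ℂ^n)`. -/
def amalgamSpace (d n : ℕ) (p q : ℝ≥0∞) (r s : ℝ) : Set 𝓢'(Rd d, Cn n) :=
  {f | ∃ g : 𝓢(Rd d, ℂ), g ≠ 0 ∧ amalgamNorm g p q r s f < ∞}

/-! ### The free Dirac equation -/

/-- `α 0, …, α d` is a set of Dirac matrices. -/
structure IsDiracMatrices {d n : ℕ} (α : Fin (d + 1) → Matrix (Fin n) (Fin n) ℂ) : Prop where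
  isHermitian : ∀ i, (α i).IsHermitian
  anticomm : ∀ i j, α i * α j + α j * α i = if i = j then 2 else 0

/-- The action of a constant matrix on a vector-valued temperate distribution. -/
def matrixAct {d n : ℕ} (A : Matrix (Fin n) (Fin n) ℂ) (f : 𝓢'(Rd d, Cn n)) : 𝓢'(Rd d, Cn n) :=
  PointwiseConvergenceCLM.postcomp 𝓢(Rd d, ℂ) (Matrix.toEuclideanCLM (n := Fin n) (𝕜 := ℂ) A) f

/-- The Dirac operator `D_m = 2 π m α_0 - i ∑_{j=1}^d α_j ∂_j` on `ℂ^n`-valued temperate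
distributions, the derivatives being distributional ones. -/
def diracOp {d n : ℕ} (m : ℝ) (α : Fin (d + 1) → Matrix (Fin n) (Fin n) ℂ)
    (f : 𝓢'(Rd d, Cn n)) : 𝓢'(Rd d, Cn n) :=
  ((2 * Real.pi * m : ℝ) : ℂ) • matrixAct (α 0) f -
    Complex.I • ∑ j : Fin d,
      matrixAct (α j.succ) (∂_{(EuclideanSpace.single j (1 : ℝ) : Rd d)} f)

/-- `ψ` solves the Cauchy problem `i ∂_t ψ = D_m ψ`, `ψ(0) = ψ₀`, in the sense of temperate
distributions: for each test function `φ` the map `t ↦ ψ(t)(φ)` is differentiable on `ℝ` and its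
derivative, multiplied by `i`, is `(D_m ψ(t))(φ)`. -/
structure IsDiracSolution {d n : ℕ} (m : ℝ) (α : Fin (d + 1) → Matrix (Fin n) (Fin n) ℂ)
    (ψ₀ : 𝓢'(Rd d, Cn n)) (ψ : ℝ → 𝓢'(Rd d, Cn n)) : Prop where
  initial : ψ 0 = ψ₀
  differentiable : ∀ φ : 𝓢(Rd d, ℂ), Differentiable ℝ (fun t : ℝ => ψ t φ)
  equation : ∀ (t : ℝ) (φ : 𝓢(Rd d, ℂ)),
    Complex.I • deriv (fun τ : ℝ => ψ τ φ) t = diracOp m α (ψ t) φ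

end Dirac

end

noncomputable section

namespace Dirac

/-! ### Minkowski's integral inequality -/

section Minkowski

variable {α β : Type*} [MeasurableSpace α] [MeasurableSpace β] {μ : Measure α} {ν : Measure β}

/-! The evolution. On the Fourier side `D_m` is multiplication by a Hermitian matrix that is affine
in ξ. When the matrices are moved, transposed, onto ℂ^n-valued test functions, a distribution
becomes a scalar functional F_t, and the equation reads d/dt F_t(Φ) = F_t(LΦ) with L(ξ) = c + Λξ
skew-Hermitian. The only candidate is F_t(Φ) = F_0(e^{tL}Φ). The exponential is entire and satisfies
‖exp X‖ ≤ e^K when the Hermitian part of X is at most K, so Cauchy's estimate bounds its l-th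
derivative at a skew operator by e^l. The chain rule then bounds the l-th ξ-derivative of e^{tL(ξ)}
by (e|t|‖Λ‖)^l, uniformly in ξ (`norm_iteratedFDeriv_propag_le`). The second-order remainder is
treated in the same way, so e^{tL} is differentiable in t on the Schwartz space
(`tendsto_inv_smul_expRem`). Uniqueness follows because s ↦ F_s(e^{(t-s)L}Φ) has derivative zero;
computing this derivative takes Banach–Steinhaus on the complete Schwartz space
(`eq_apply_opMul_propag`).

Boundedness. The entries of e^{tL} are scalar symbols u with j-th derivatives at most R^j, where R
is a multiple of 1 + |t|. Testing ψ(t) on a shifted window means testing ψ₀ on images of that window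
under the multipliers u. Inserting the inversion formula `stft_inversion` expresses V_gψ(t) through
V_gψ₀ by the Gabor matrix of u. For fixed frequencies ξ, ξ' this matrix is, up to a unimodular
factor in x', a convolution kernel in x - x' (`shiftCoeff_fourierMul`). The symbol of the kernel is
u(· + ξ) times the conjugate of ĝ times the translate of ĝ by ξ' - ξ. It follows that the matrix
decays faster than any power of x - x' and of ξ - ξ'; Peetre's inequality for the weights and
Minkowski's inequality give boundedness on all M and W spaces, with a constant depending on R.

Growth in time. Without a weight in x, the convolution operators are estimated on L^p_x for each
pair (ξ, ξ'). On L² the norm is the supremum of the symbol, which carries no power of R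
(`exists_norm_gaborSymb_le`). On L¹ and L^∞ it is at most the L¹ norm of the kernel, and weighted
Plancherel at scale R bounds this by R^{d/2} (`exists_integral_norm_fourierInv_le`). Marcinkiewicz
interpolation (`exists_eLpNorm_convOp_le`) gives R^{d|1/2-1/p|} with rapid decay in ξ - ξ', and
Minkowski in ξ' completes the estimate (`exists_modulationNorm_zero_le`). -/

theorem eLpNorm_ennreal_eq {p : ℝ≥0∞} (h0 : p ≠ 0) (ht : p ≠ ∞) (F : α → ℝ≥0∞) :
    eLpNorm F p μ = (∫⁻ x, F x ^ p.toReal ∂μ) ^ (1 / p.toReal) := by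
  simp [eLpNorm_eq_lintegral_rpow_enorm_toReal h0 ht]

theorem eLpNorm_mono_ennreal {F G : α → ℝ≥0∞} (p : ℝ≥0∞) (h : ∀ x, F x ≤ G x) :
    eLpNorm F p μ ≤ eLpNorm G p μ :=
  eLpNorm_mono_enorm (by simpa using h)

theorem eLpNorm_const_mul_ennreal {F : α → ℝ≥0∞} {p : ℝ≥0∞} (hp : 1 ≤ p) (hF : Measurable F)
    (c : ℝ≥0∞) : eLpNorm (fun x => c * F x) p μ = c * eLpNorm F p μ := by
  rcases eq_or_ne p ∞ with rfl | ht
  · simp only [eLpNorm_exponent_top, eLpNormEssSup, enorm_eq_self]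
    exact ENNReal.essSup_const_mul
  · have h0 : p ≠ 0 := (zero_lt_one.trans_le hp).ne'
    have hp0 : 0 < p.toReal := ENNReal.toReal_pos h0 ht
    rw [eLpNorm_ennreal_eq h0 ht, eLpNorm_ennreal_eq h0 ht]
    simp_rw [ENNReal.mul_rpow_of_nonneg _ _ hp0.le]
    rw [lintegral_const_mul _ (hF.pow_const _), ENNReal.mul_rpow_of_nonneg _ _ (by positivity),
      ← ENNReal.rpow_mul, mul_one_div_cancel hp0.ne', ENNReal.rpow_one]

/-- At `p = ∞` one argues by superlevel sets: the essential supremum exceeds c exactly when {x | c <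
F x z} has positive measure, and that measure is measurable in z. -/
theorem measurable_eLpNorm_left [SFinite μ] {F : α → β → ℝ≥0∞}
    (hF : Measurable (Function.uncurry F)) (p : ℝ≥0∞) :
    Measurable fun z => eLpNorm (fun x => F x z) p μ := by
  rcases eq_or_ne p 0 with rfl | h0
  · simp
  rcases eq_or_ne p ∞ with rfl | ht
  · refine measurable_of_Ioi fun c => ?_
    have h : (fun z => eLpNorm (fun x => F x z) ∞ μ) ⁻¹' Set.Ioi c =
        {z | 0 < μ {x | c < F x z}} := by
      ext z
      simp only [eLpNorm_exponent_top, eLpNormEssSup, enorm_eq_self, Set.mem_preimage, Set.mem_Ioi,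
        Set.mem_ofPred_eq, pos_iff_ne_zero, ne_eq]
      rw [← not_le, not_iff_not]
      constructor
      · intro h
        have := (ENNReal.ae_le_essSup (μ := μ) fun x => F x z).mono fun x hx => hx.trans h
        simpa [ae_iff] using this
      · intro h
        exact essSup_le_of_ae_le c (by simpa [Filter.EventuallyLE, ae_iff] using h)
    rw [h]
    have hs : MeasurableSet {q : α × β | c < F q.1 q.2} := measurableSet_lt measurable_const hF
    exact measurableSet_lt measurable_const (measurable_measure_prodMk_right hs)
  · simp_rw [eLpNorm_ennreal_eq h0 ht]
    exact (Measurable.lintegral_prod_left' (f := fun q : α × β => F q.1 q.2 ^ p.toReal)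
      (hF.pow_const _)).pow_const _

/-- Write φ^p = φ^{p-1}·φ, bound the last factor by the integral of F, swap the integrals and apply
Hölder in x. With I = ∫ φ^p this gives I ≤ I^{1/q} times the right side. Dividing requires I finite,
so φ is only assumed to be a minorant of ∫ F; it will be a truncation. -/
theorem rpow_lintegral_le_of_le_lintegral [SFinite μ] [SFinite ν] {F : α → β → ℝ≥0∞}
    (hF : Measurable (Function.uncurry F)) {p : ℝ} (hp : 1 < p) {φ : α → ℝ≥0∞} (hφ : Measurable φ)
    (hφF : ∀ x, φ x ≤ ∫⁻ z, F x z ∂ν) (hfin : ∫⁻ x, φ x ^ p ∂μ ≠ ∞) :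
    (∫⁻ x, φ x ^ p ∂μ) ^ (1 / p) ≤ ∫⁻ z, (∫⁻ x, F x z ^ p ∂μ) ^ (1 / p) ∂ν := by
  set I := ∫⁻ x, φ x ^ p ∂μ with hI
  have hpq : (p.conjExponent).HolderConjugate p := (Real.HolderConjugate.conjExponent hp).symm
  set q := p.conjExponent with hq
  have hp0 : 0 < p := by linarith
  rcases eq_or_ne I 0 with h0 | h0
  · rw [h0, ENNReal.zero_rpow_of_pos (by positivity)]
    exact zero_le
  have hexp : (p - 1) * q = p := by
    rw [hq, Real.conjExponent, mul_div_cancel₀]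
    linarith
  have h1 : I ≤ I ^ (1 / q) * ∫⁻ z, (∫⁻ x, F x z ^ p ∂μ) ^ (1 / p) ∂ν := by
    calc I ≤ ∫⁻ x, φ x ^ (p - 1) * ∫⁻ z, F x z ∂ν ∂μ := by
          refine lintegral_mono fun x => ?_
          calc φ x ^ p = φ x ^ (p - 1) * φ x := by
                conv_lhs => rw [show p = (p - 1) + 1 by ring]
                rw [ENNReal.rpow_add_of_nonneg _ _ (by linarith) (by norm_num), ENNReal.rpow_one]
            _ ≤ _ := by gcongr; exact hφF x
      _ = ∫⁻ x, ∫⁻ z, φ x ^ (p - 1) * F x z ∂ν ∂μ := by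
          refine lintegral_congr fun x => ?_
          rw [lintegral_const_mul _ (hF.of_uncurry_left)]
      _ = ∫⁻ z, ∫⁻ x, φ x ^ (p - 1) * F x z ∂μ ∂ν := by
          refine lintegral_lintegral_swap (Measurable.aemeasurable ?_)
          exact ((hφ.pow_const _).comp measurable_fst).mul hF
      _ ≤ ∫⁻ z, I ^ (1 / q) * (∫⁻ x, F x z ^ p ∂μ) ^ (1 / p) ∂ν := by
          refine lintegral_mono fun z => ?_
          refine (ENNReal.lintegral_mul_le_Lp_mul_Lq μ hpq (hφ.pow_const (p - 1)).aemeasurable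
            (hF.of_uncurry_right).aemeasurable).trans_eq ?_
          simp_rw [← ENNReal.rpow_mul, hexp, hI]
      _ = _ := by
          refine lintegral_const_mul _ (Measurable.pow_const ?_ _)
          exact Measurable.lintegral_prod_left' (f := fun q : α × β => F q.1 q.2 ^ p)
            (hF.pow_const _)
  have hsum : 1 / q + 1 / p = 1 := by simpa using hpq.inv_add_inv_eq_one
  have h2 : I = I ^ (1 / q) * I ^ (1 / p) := by
    rw [← ENNReal.rpow_add _ _ h0 hfin, hsum, ENNReal.rpow_one]
  have hqpos : 0 < q := hpq.pos
  have h3 : I ^ (1 / q) ≠ 0 := by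
    simp [ENNReal.rpow_eq_zero_iff, h0, hfin]
  have h4 : I ^ (1 / q) ≠ ∞ := ENNReal.rpow_ne_top_of_nonneg (by positivity) hfin
  exact (ENNReal.mul_le_mul_iff_right h3 h4).1 (h2 ▸ h1)

theorem eLpNorm_lintegral_le [SigmaFinite μ] [SFinite ν] {F : α → β → ℝ≥0∞}
    (hF : Measurable (Function.uncurry F)) {p : ℝ≥0∞} (hp : 1 ≤ p) :
    eLpNorm (fun x => ∫⁻ z, F x z ∂ν) p μ ≤ ∫⁻ z, eLpNorm (fun x => F x z) p μ ∂ν := by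
  have hG : Measurable fun x => ∫⁻ z, F x z ∂ν := hF.lintegral_prod_right'
  rcases eq_or_ne p ∞ with rfl | ht
  · have hN := measurable_eLpNorm_left (μ := μ) hF ∞
    simp only [eLpNorm_exponent_top, eLpNormEssSup, enorm_eq_self] at hN ⊢
    refine essSup_le_of_ae_le _ ?_
    have hs : MeasurableSet {q : α × β | F q.1 q.2 ≤ essSup (fun x => F x q.2) μ} :=
      measurableSet_le hF (hN.comp measurable_snd)
    have h1 : ∀ᵐ z ∂ν, ∀ᵐ x ∂μ, F x z ≤ essSup (fun x => F x z) μ :=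
      Filter.Eventually.of_forall fun z => ENNReal.ae_le_essSup fun x => F x z
    -- The exceptional null set of x depends on z; Fubini for null sets interchanges the two
    -- quantifiers.
    have h2 : ∀ᵐ x ∂μ, ∀ᵐ z ∂ν, F x z ≤ essSup (fun x => F x z) μ :=
      (Measure.ae_ae_comm hs).2 h1
    filter_upwards [h2] with x hx
    exact lintegral_mono_ae hx
  have h0 : p ≠ 0 := (zero_lt_one.trans_le hp).ne'
  rcases eq_or_ne p 1 with rfl | h1
  · simp only [eLpNorm_one_eq_lintegral_enorm, enorm_eq_self]
    rw [lintegral_lintegral_swap hF.aemeasurable]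
  have hp1 : 1 < p.toReal := by
    rw [← ENNReal.toReal_one]
    exact (ENNReal.toReal_lt_toReal ENNReal.one_ne_top ht).2 (lt_of_le_of_ne hp (Ne.symm h1))
  have hp0 : 0 < p.toReal := by linarith
  simp_rw [eLpNorm_ennreal_eq h0 ht]
  set G := fun x => ∫⁻ z, F x z ∂ν with hGdef
  -- Truncation in height and to a set of finite measure makes the p-th power integrable; monotone
  -- convergence removes it at the end.
  let φ : ℕ → α → ℝ≥0∞ := fun k => (spanningSets μ k).indicator fun x => min (G x) k
  have hφm : ∀ k, Measurable (φ k) := fun k =>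
    (hG.min measurable_const).indicator (measurableSet_spanningSets μ k)
  have hφG : ∀ k x, φ k x ≤ G x := fun k x =>
    (Set.indicator_le_self _ _ x).trans (min_le_left _ _)
  have hfin : ∀ k, ∫⁻ x, φ k x ^ p.toReal ∂μ ≠ ∞ := by
    intro k
    refine ne_of_lt ?_
    calc ∫⁻ x, φ k x ^ p.toReal ∂μ
        ≤ ∫⁻ x, (spanningSets μ k).indicator (fun _ => (k : ℝ≥0∞) ^ p.toReal) x ∂μ := by
          refine lintegral_mono fun x => ?_
          by_cases hx : x ∈ spanningSets μ k
          · simp only [φ, Set.indicator_of_mem hx]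
            gcongr
            exact min_le_right _ _
          · simp [φ, Set.indicator_of_notMem hx, hp0]
      _ = (k : ℝ≥0∞) ^ p.toReal * μ (spanningSets μ k) :=
          lintegral_indicator_const (measurableSet_spanningSets μ k) _
      _ < ∞ := ENNReal.mul_lt_top
          (ENNReal.rpow_lt_top_of_nonneg hp0.le (ENNReal.natCast_ne_top k))
          (measure_spanningSets_lt_top μ k)
  have hlim : Filter.Tendsto (fun k => ∫⁻ x, φ k x ^ p.toReal ∂μ) Filter.atTop
      (nhds (∫⁻ x, G x ^ p.toReal ∂μ)) := by
    refine lintegral_tendsto_of_tendsto_of_monotone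
      (fun k => ((hφm k).pow_const _).aemeasurable) ?_ ?_
    · refine Filter.Eventually.of_forall fun x i j hij => ?_
      refine ENNReal.rpow_le_rpow ?_ hp0.le
      simp only [φ]
      by_cases hx : x ∈ spanningSets μ i
      · rw [Set.indicator_of_mem hx, Set.indicator_of_mem (monotone_spanningSets μ hij hx)]
        gcongr
      · rw [Set.indicator_of_notMem hx]
        exact zero_le
    · refine Filter.Eventually.of_forall fun x => ?_
      refine (ENNReal.continuous_rpow_const.tendsto _).comp ?_
      have h1 : Filter.Tendsto (fun k : ℕ => min (G x) (k : ℝ≥0∞)) Filter.atTop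
          (nhds (min (G x) ∞)) := tendsto_const_nhds.min ENNReal.tendsto_nat_nhds_top
      rw [min_eq_left le_top] at h1
      refine h1.congr' ?_
      obtain ⟨i, hi⟩ : ∃ i, x ∈ spanningSets μ i := by
        exact Set.mem_iUnion.1 (by rw [iUnion_spanningSets]; trivial)
      filter_upwards [Filter.eventually_ge_atTop i] with k hk
      simp only [φ]
      rw [Set.indicator_of_mem (monotone_spanningSets μ hk hi)]
  refine le_of_tendsto' ((ENNReal.continuous_rpow_const (y := 1 / p.toReal)).tendsto _ |>.comp hlim)
    fun k => ?_
  exact rpow_lintegral_le_of_le_lintegral hF hp1 (hφm k) (hφG k) (hfin k)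

end Minkowski

/-! ### Weighted convolution inequalities -/

section Convolution

variable {d : ℕ}

theorem weight_pos (r : ℝ) (x : Rd d) : 0 < weight r x := by
  unfold weight
  positivity

theorem continuous_weight (r : ℝ) : Continuous (weight r : Rd d → ℝ) := by
  unfold weight
  refine Continuous.rpow_const (by fun_prop) fun x => Or.inl ?_
  positivity

theorem one_add_norm_sq_le (x y : Rd d) :
    1 + ‖x‖ ^ 2 ≤ 2 * ((1 + ‖y‖ ^ 2) * (1 + ‖x - y‖ ^ 2)) := by
  have h : ‖x‖ ≤ ‖y‖ + ‖x - y‖ := by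
    calc ‖x‖ = ‖y + (x - y)‖ := by congr 1; abel
      _ ≤ _ := norm_add_le _ _
  have h2 : ‖x‖ ^ 2 ≤ (‖y‖ + ‖x - y‖) ^ 2 := by gcongr
  nlinarith [sq_nonneg (‖y‖ - ‖x - y‖), sq_nonneg (‖y‖ * ‖x - y‖), norm_nonneg y,
    norm_nonneg (x - y)]

/-- Peetre's inequality. For negative s it is the positive case with x and y exchanged, after taking
inverses. -/
theorem weight_le_mul (s : ℝ) (x y : Rd d) :
    weight s x ≤ 2 ^ (|s| / 2) * (weight |s| (x - y) * weight s y) := by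
  unfold weight
  have hx : (0 : ℝ) < 1 + ‖x‖ ^ 2 := by positivity
  have hy : (0 : ℝ) < 1 + ‖y‖ ^ 2 := by positivity
  have hxy : (0 : ℝ) < 1 + ‖x - y‖ ^ 2 := by positivity
  rcases le_total 0 s with hs | hs
  · rw [abs_of_nonneg hs, ← Real.mul_rpow hxy.le hy.le, ← Real.mul_rpow (by norm_num) (by positivity)]
    refine Real.rpow_le_rpow hx.le ?_ (by positivity)
    rw [mul_comm (1 + ‖x - y‖ ^ 2)]
    exact one_add_norm_sq_le x y
  · rw [abs_of_nonpos hs]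
    have h : (1 + ‖y‖ ^ 2) ^ (-s / 2) ≤ 2 ^ (-s / 2) *
        ((1 + ‖x - y‖ ^ 2) ^ (-s / 2) * (1 + ‖x‖ ^ 2) ^ (-s / 2)) := by
      rw [← Real.mul_rpow hxy.le hx.le, ← Real.mul_rpow (by norm_num) (by positivity)]
      refine Real.rpow_le_rpow hy.le ?_ (by linarith)
      rw [mul_comm (1 + ‖x - y‖ ^ 2), norm_sub_rev]
      exact one_add_norm_sq_le y x
    have e : ∀ a : ℝ, 0 < a → a ^ (s / 2) = (a ^ (-s / 2))⁻¹ := by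
      intro a ha
      rw [← Real.rpow_neg ha.le]
      congr 1
      ring
    rw [e _ hx, e _ hy]
    have h1 := Real.rpow_pos_of_pos hx (-s / 2)
    have h2 := Real.rpow_pos_of_pos hy (-s / 2)
    rw [inv_le_iff_one_le_mul₀ h1]
    calc (1 : ℝ) = (1 + ‖y‖ ^ 2) ^ (-s / 2) * ((1 + ‖y‖ ^ 2) ^ (-s / 2))⁻¹ :=
          (mul_inv_cancel₀ h2.ne').symm
      _ ≤ (2 ^ (-s / 2) * ((1 + ‖x - y‖ ^ 2) ^ (-s / 2) * (1 + ‖x‖ ^ 2) ^ (-s / 2))) *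
          ((1 + ‖y‖ ^ 2) ^ (-s / 2))⁻¹ := by gcongr
      _ = _ := by ring

/-- The weight as an extended nonnegative real. -/
def eweight (r : ℝ) (x : Rd d) : ℝ≥0∞ := ENNReal.ofReal (weight r x)

theorem measurable_eweight (r : ℝ) : Measurable (eweight r : Rd d → ℝ≥0∞) :=
  (continuous_weight r).measurable.ennreal_ofReal

theorem eweight_le_mul (s : ℝ) (x y : Rd d) :
    eweight s x ≤ ENNReal.ofReal (2 ^ (|s| / 2)) * (eweight |s| (x - y) * eweight s y) := by
  unfold eweight
  rw [← ENNReal.ofReal_mul (weight_pos _ _).le, ← ENNReal.ofReal_mul (by positivity)]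
  exact ENNReal.ofReal_le_ofReal (weight_le_mul s x y)

theorem eLpNorm_comp_sub_right {F : Rd d → ℝ≥0∞} (hF : Measurable F) (y : Rd d) (p : ℝ≥0∞) :
    eLpNorm (fun x => F (x - y)) p volume = eLpNorm F p volume :=
  eLpNorm_comp_measurePreserving (g := F) hF.aestronglyMeasurable
    (measurePreserving_sub_right volume y)

/-- Young's inequality L¹ * L^q ⊂ L^q: Minkowski applied to a superposition of translates of N. -/
theorem eLpNorm_lintegral_conv_le {h N : Rd d → ℝ≥0∞} (hh : Measurable h) (hN : Measurable N)
    {q : ℝ≥0∞} (hq : 1 ≤ q) :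
    eLpNorm (fun x => ∫⁻ y, h (x - y) * N y) q volume ≤ (∫⁻ y, h y) * eLpNorm N q volume := by
  have h1 : ∀ x : Rd d, ∫⁻ y, h (x - y) * N y = ∫⁻ y, h y * N (x - y) := fun x => by
    rw [← lintegral_sub_left_eq_self (fun y => h y * N (x - y)) x]
    simp
  simp_rw [h1]
  calc eLpNorm (fun x => ∫⁻ y, h y * N (x - y)) q volume
      ≤ ∫⁻ y, eLpNorm (fun x => h y * N (x - y)) q volume :=
        eLpNorm_lintegral_le (F := fun x y => h y * N (x - y))
          ((hh.comp measurable_snd).mul (hN.comp (measurable_fst.sub measurable_snd))) hq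
    _ = ∫⁻ y, h y * eLpNorm N q volume := by
        refine lintegral_congr fun y => ?_
        rw [eLpNorm_const_mul_ennreal (F := fun x => N (x - y)) hq (hN.comp (measurable_id.sub_const y)),
          eLpNorm_comp_sub_right hN]
    _ = _ := lintegral_mul_const _ hh

/-- If `w_s` is the outer weight, an operator in the outer variable dominated by convolution
with `h` in the inner norm is bounded on the weighted mixed-norm space. -/
theorem eLpNorm_mixed_le {p q : ℝ≥0∞} (hp : 1 ≤ p) (hq : 1 ≤ q) (s : ℝ)
    {G : Rd d → Rd d → ℝ≥0∞} {K : Rd d → Rd d → Rd d → ℝ≥0∞} {h N : Rd d → ℝ≥0∞}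
    (hK : ∀ b, Measurable (Function.uncurry (K b))) (hh : Measurable h) (hN : Measurable N)
    (hG : ∀ b a, G b a ≤ ∫⁻ b', K b b' a)
    (hKN : ∀ b b', eLpNorm (K b b') p volume ≤ h (b - b') * N b') :
    eLpNorm (fun b => eweight s b * eLpNorm (G b) p volume) q volume ≤
      ENNReal.ofReal (2 ^ (|s| / 2)) * (∫⁻ b, eweight |s| b * h b) *
        eLpNorm (fun b => eweight s b * N b) q volume := by
  have hm1 : Measurable fun b : Rd d => eweight |s| b * h b := (measurable_eweight _).mul hh
  have hm2 : Measurable fun b : Rd d => eweight s b * N b := (measurable_eweight _).mul hN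
  have hm3 : ∀ b : Rd d, Measurable fun b' : Rd d => h (b - b') * N b' := fun b =>
    (hh.comp (measurable_const.sub measurable_id)).mul hN
  have h1 : ∀ b, eLpNorm (G b) p volume ≤ ∫⁻ b', h (b - b') * N b' := by
    intro b
    calc eLpNorm (G b) p volume ≤ eLpNorm (fun a => ∫⁻ b', K b b' a) p volume :=
          eLpNorm_mono_ennreal p (hG b)
      _ ≤ ∫⁻ b', eLpNorm (K b b') p volume :=
          eLpNorm_lintegral_le (F := fun a b' => K b b' a) ((hK b).comp measurable_swap) hp
      _ ≤ _ := lintegral_mono fun b' => hKN b b'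
  -- Peetre's inequality splits the outer weight into one factor absorbed by h and one by N, which
  -- leaves an unweighted convolution.
  have h2 : ∀ b, eweight s b * eLpNorm (G b) p volume ≤ ENNReal.ofReal (2 ^ (|s| / 2)) *
      ∫⁻ b', (eweight |s| (b - b') * h (b - b')) * (eweight s b' * N b') := by
    intro b
    rw [← lintegral_const_mul']
    swap
    · exact ENNReal.ofReal_ne_top
    refine (mul_le_mul_right (h1 b) _).trans ?_
    rw [← lintegral_const_mul _ (hm3 b)]
    refine lintegral_mono fun b' => ?_
    calc eweight s b * (h (b - b') * N b') ≤
        ENNReal.ofReal (2 ^ (|s| / 2)) * (eweight |s| (b - b') * eweight s b') *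
          (h (b - b') * N b') := by
          gcongr
          exact eweight_le_mul s b b'
      _ = _ := by ring
  refine (eLpNorm_mono_ennreal q h2).trans ?_
  rw [eLpNorm_const_mul_ennreal hq, mul_assoc]
  · gcongr
    exact eLpNorm_lintegral_conv_le hm1 hm2 hq
  · exact Measurable.lintegral_prod_right' (f := fun z : Rd d × Rd d =>
      (eweight |s| (z.1 - z.2) * h (z.1 - z.2)) * (eweight s z.2 * N z.2))
      ((hm1.comp (measurable_fst.sub measurable_snd)).mul (hm2.comp measurable_snd))

/-- Convolution with a product kernel is bounded on weighted mixed-norm spaces. -/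
theorem eLpNorm_mixed_conv_le {p q : ℝ≥0∞} (hp : 1 ≤ p) (hq : 1 ≤ q) (r s : ℝ)
    {G F : Rd d → Rd d → ℝ≥0∞} {h₁ h₂ : Rd d → ℝ≥0∞}
    (hF : Measurable (Function.uncurry F)) (hh₁ : Measurable h₁) (hh₂ : Measurable h₂)
    (hG : ∀ b a, G b a ≤ ∫⁻ b', ∫⁻ a', h₂ (b - b') * (h₁ (a - a') * F b' a')) :
    eLpNorm (fun b => eweight s b * eLpNorm (fun a => eweight r a * G b a) p volume) q volume ≤
      ENNReal.ofReal (2 ^ (|s| / 2)) * (ENNReal.ofReal (2 ^ (|r| / 2)) *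
        (∫⁻ a, eweight |r| a * h₁ a) * (∫⁻ b, eweight |s| b * h₂ b)) *
        eLpNorm (fun b => eweight s b * eLpNorm (fun a => eweight r a * F b a) p volume)
          q volume := by
  set c := ENNReal.ofReal (2 ^ (|r| / 2)) with hc
  set I := ∫⁻ a, eweight |r| a * h₁ a with hI
  have hm1 : Measurable fun b : Rd d => eweight |r| b * h₁ b := (measurable_eweight _).mul hh₁
  have hFr : Measurable fun z : Rd d × Rd d => eweight r z.2 * F z.1 z.2 :=
    ((measurable_eweight r).comp measurable_snd).mul hF
  have hk1 : Measurable fun z : (Rd d × Rd d) × Rd d => z.1.2 - z.2 :=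
    (measurable_snd.comp measurable_fst).sub measurable_snd
  have hk2 : Measurable fun z : (Rd d × Rd d) × Rd d => (z.1.1, z.2) :=
    (measurable_fst.comp measurable_fst).prodMk measurable_snd
  have hk3 := hm1.comp hk1
  have hk4 := hFr.comp hk2
  have hker : Measurable fun z : (Rd d × Rd d) × Rd d =>
      (eweight |r| (z.1.2 - z.2) * h₁ (z.1.2 - z.2)) * (eweight r z.2 * F z.1.1 z.2) :=
    hk3.mul hk4
  -- J is the inner convolution after Peetre has distributed the inner weight over h₁ and F; Young's
  -- inequality then applies for each b'.
  let J : Rd d → Rd d → ℝ≥0∞ := fun b' a =>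
    ∫⁻ a', (eweight |r| (a - a') * h₁ (a - a')) * (eweight r a' * F b' a')
  have hJ : Measurable (Function.uncurry J) := by
    have := hker.lintegral_prod_right' (ν := (volume : Measure (Rd d)))
    exact this
  have hJb : ∀ b', Measurable (J b') := fun b' => hJ.of_uncurry_left
  have hFr' : Measurable (Function.uncurry fun a b : Rd d => eweight r a * F b a) :=
    ((measurable_eweight r).comp measurable_fst).mul (hF.comp measurable_swap)
  have hN := measurable_eLpNorm_left (μ := (volume : Measure (Rd d))) hFr' p
  have hK : ∀ b : Rd d, Measurable (Function.uncurry fun b' a : Rd d =>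
      (c * h₂ (b - b')) * J b' a) := fun b =>
    Measurable.mul (f := fun z : Rd d × Rd d => c * h₂ (b - z.1))
      (measurable_const.mul (hh₂.comp (measurable_const.sub measurable_fst))) hJ
  have hmain := eLpNorm_mixed_le hp hq s (G := fun b a => eweight r a * G b a) hK
    (hh₂.const_mul (c * I)) hN ?_ ?_
  · have e : ∫⁻ b, eweight |s| b * (c * I * h₂ b) = c * I * ∫⁻ b, eweight |s| b * h₂ b := by
      have hm : Measurable fun b : Rd d => eweight |s| b * h₂ b := (measurable_eweight _).mul hh₂
      rw [← lintegral_const_mul _ hm]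
      congr 1 with b
      ring
    rw [e] at hmain
    exact hmain
  · intro b a
    have e1 : Measurable fun b' : Rd d => ∫⁻ a', h₂ (b - b') * (h₁ (a - a') * F b' a') :=
      Measurable.lintegral_prod_right' (f := fun z : Rd d × Rd d =>
        h₂ (b - z.1) * (h₁ (a - z.2) * F z.1 z.2))
        ((hh₂.comp (measurable_const.sub measurable_fst)).mul
          ((hh₁.comp (measurable_const.sub measurable_snd)).mul hF))
    have e2 : ∀ b', Measurable fun a' : Rd d => h₂ (b - b') * (h₁ (a - a') * F b' a') := fun b' =>
      measurable_const.mul ((hh₁.comp (measurable_const.sub measurable_id)).mul hF.of_uncurry_left)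
    refine (mul_le_mul_right (hG b a) _).trans ?_
    rw [← lintegral_const_mul _ e1]
    refine lintegral_mono fun b' => ?_
    simp only [J]
    rw [← lintegral_const_mul _ (e2 b'), ← lintegral_const_mul]
    swap
    · exact (hm1.comp (measurable_const.sub measurable_id)).mul
        ((measurable_eweight r).mul hF.of_uncurry_left)
    refine lintegral_mono fun a' => ?_
    calc eweight r a * (h₂ (b - b') * (h₁ (a - a') * F b' a')) ≤
        c * (eweight |r| (a - a') * eweight r a') * (h₂ (b - b') * (h₁ (a - a') * F b' a')) := by
          gcongr
          exact eweight_le_mul r a a'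
      _ = _ := by ring
  · intro b b'
    rw [eLpNorm_const_mul_ennreal hp (hJb b')]
    calc c * h₂ (b - b') * eLpNorm (J b') p volume ≤
        c * h₂ (b - b') * (I * eLpNorm (fun a => eweight r a * F b' a) p volume) := by
          gcongr
          exact eLpNorm_lintegral_conv_le hm1
            (N := fun a => eweight r a * F b' a) ((measurable_eweight r).mul hF.of_uncurry_left) hp
      _ = _ := by ring

end Convolution


/-! ### Real interpolation -/

section Interpolation

variable {α : Type*} [MeasurableSpace α] {μ : Measure α}

/-- Layer cake for a negative exponent: by Tonelli each x contributes the integral of t^{a-1} over t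
≥ φ(x), which is φ(x)^a / (-a). -/
theorem lintegral_rpow_mul_meas_le [SFinite μ] {φ : α → ℝ} (hφ : Measurable φ) (hpos : ∀ x, 0 < φ x)
    {a : ℝ} (ha : a < 0) :
    ∫⁻ t in Set.Ioi (0 : ℝ), μ {x | φ x ≤ t} * ENNReal.ofReal (t ^ (a - 1)) =
      ENNReal.ofReal (-a)⁻¹ * ∫⁻ x, ENNReal.ofReal (φ x ^ a) ∂μ := by
  have hs : MeasurableSet {z : ℝ × α | φ z.2 ≤ z.1} :=
    measurableSet_le (hφ.comp measurable_snd) measurable_fst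
  have hw : Measurable fun t : ℝ => ENNReal.ofReal (t ^ (a - 1)) :=
    (measurable_id.pow_const _).ennreal_ofReal
  have h1 : ∀ t : ℝ, μ {x | φ x ≤ t} * ENNReal.ofReal (t ^ (a - 1)) =
      ∫⁻ x, {z : ℝ × α | φ z.2 ≤ z.1}.indicator (fun z => ENNReal.ofReal (z.1 ^ (a - 1))) (t, x)
        ∂μ := by
    intro t
    have : ∀ x, {z : ℝ × α | φ z.2 ≤ z.1}.indicator (fun z => ENNReal.ofReal (z.1 ^ (a - 1)))
        (t, x) = {x | φ x ≤ t}.indicator (fun _ => ENNReal.ofReal (t ^ (a - 1))) x := by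
      intro x
      simp [Set.indicator_apply]
    simp_rw [this]
    rw [lintegral_indicator_const (measurableSet_le hφ measurable_const), mul_comm]
  simp_rw [h1]
  rw [lintegral_lintegral_swap, ← lintegral_const_mul _ (hφ.pow_const _).ennreal_ofReal]
  · refine lintegral_congr fun x => ?_
    have h2 : ∀ t, {z : ℝ × α | φ z.2 ≤ z.1}.indicator (fun z => ENNReal.ofReal (z.1 ^ (a - 1)))
        (t, x) = (Set.Ici (φ x)).indicator (fun t => ENNReal.ofReal (t ^ (a - 1))) t := by
      intro t
      simp [Set.indicator_apply]
    simp_rw [h2]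
    rw [lintegral_indicator measurableSet_Ici, Measure.restrict_restrict measurableSet_Ici,
      Set.inter_eq_left.2 (Set.Ici_subset_Ioi.2 (hpos x)),
      Measure.restrict_congr_set Ioi_ae_eq_Ici.symm,
      ← ofReal_integral_eq_lintegral_ofReal (integrableOn_Ioi_rpow_of_lt (by linarith) (hpos x)),
      integral_Ioi_rpow_of_lt (by linarith) (hpos x), ← ENNReal.ofReal_mul (by simp [ha.le])]
    · congr 1
      rw [sub_add_cancel, neg_div, ← div_neg, div_eq_inv_mul]
    · filter_upwards [ae_restrict_mem measurableSet_Ioi] with t ht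
      exact Real.rpow_nonneg ((hpos x).trans ht).le _
  · exact ((hw.comp measurable_fst).indicator hs).aemeasurable

/-- The integration half of Marcinkiewicz for p > 2. The integral of F² over {t < 2AF} is the mass
of that set under F²μ, so the layer-cake integral of order p for u turns into one of order p - 2 for
2AF under the new measure. -/
theorem lintegral_rpow_le_of_weak_above [SFinite μ] {u F : α → ℝ} (hu : Measurable u)
    (hu0 : ∀ x, 0 ≤ u x) (hF : Measurable F) (hF0 : ∀ x, 0 ≤ F x) {p A : ℝ} (hp : 2 < p)
    (hA : 0 < A)
    (h : ∀ t : ℝ, 0 < t → μ {x | t < u x} ≤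
      ENNReal.ofReal (4 / t ^ 2) * ∫⁻ x in {x | t < 2 * A * F x}, ENNReal.ofReal (F x ^ 2) ∂μ) :
    ∫⁻ x, ENNReal.ofReal (u x ^ p) ∂μ ≤
      ENNReal.ofReal (4 * p / (p - 2) * (2 * A) ^ (p - 2)) * ∫⁻ x, ENNReal.ofReal (F x ^ p) ∂μ := by
  have hp0 : 0 < p := by linarith
  have hp2 : 0 < p - 2 := by linarith
  have hFm : Measurable fun x => ENNReal.ofReal (F x ^ 2) := (hF.pow_const _).ennreal_ofReal
  set ν := μ.withDensity fun x => ENNReal.ofReal (F x ^ 2) with hν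
  have hAF : Measurable fun x => 2 * A * F x := measurable_const.mul hF
  have hlay := lintegral_rpow_eq_lintegral_meas_lt_mul ν (f := fun x => 2 * A * F x)
    (Filter.Eventually.of_forall fun x => by have := hF0 x; positivity)
    hAF.aemeasurable hp2
  rw [lintegral_rpow_eq_lintegral_meas_lt_mul μ (Filter.Eventually.of_forall hu0)
    hu.aemeasurable hp0]
  have h1 : ∫⁻ t in Set.Ioi (0 : ℝ), μ {x | t < u x} * ENNReal.ofReal (t ^ (p - 1)) ≤
      ENNReal.ofReal 4 * ∫⁻ t in Set.Ioi (0 : ℝ),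
        ν {x | t < 2 * A * F x} * ENNReal.ofReal (t ^ (p - 2 - 1)) := by
    rw [← lintegral_const_mul' _ _ ENNReal.ofReal_ne_top]
    refine setLIntegral_mono' measurableSet_Ioi fun t ht => ?_
    have ht : 0 < t := ht
    rw [withDensity_apply _ (measurableSet_lt measurable_const hAF)]
    calc μ {x | t < u x} * ENNReal.ofReal (t ^ (p - 1)) ≤ (ENNReal.ofReal (4 / t ^ 2) *
          ∫⁻ x in {x | t < 2 * A * F x}, ENNReal.ofReal (F x ^ 2) ∂μ) *
            ENNReal.ofReal (t ^ (p - 1)) := by gcongr; exact h t ht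
      _ = (ENNReal.ofReal (4 / t ^ 2) * ENNReal.ofReal (t ^ (p - 1))) *
          ∫⁻ x in {x | t < 2 * A * F x}, ENNReal.ofReal (F x ^ 2) ∂μ := by ring
      _ = (ENNReal.ofReal 4 * ENNReal.ofReal (t ^ (p - 2 - 1))) *
          ∫⁻ x in {x | t < 2 * A * F x}, ENNReal.ofReal (F x ^ 2) ∂μ := by
          rw [← ENNReal.ofReal_mul (by positivity), ← ENNReal.ofReal_mul (by positivity)]
          congr 2
          rw [show p - 2 - 1 = p - 1 - 2 by ring, Real.rpow_sub ht (p - 1), Real.rpow_two]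
          ring
      _ = _ := by ring
  have h2 : ∫⁻ t in Set.Ioi (0 : ℝ), ν {x | t < 2 * A * F x} * ENNReal.ofReal (t ^ (p - 2 - 1)) =
      ENNReal.ofReal (p - 2)⁻¹ * (ENNReal.ofReal ((2 * A) ^ (p - 2)) *
        ∫⁻ x, ENNReal.ofReal (F x ^ p) ∂μ) := by
    have h3 : ∫⁻ x, ENNReal.ofReal ((2 * A * F x) ^ (p - 2)) ∂ν =
        ENNReal.ofReal ((2 * A) ^ (p - 2)) * ∫⁻ x, ENNReal.ofReal (F x ^ p) ∂μ := by
      rw [lintegral_withDensity_eq_lintegral_mul _ hFm (hAF.pow_const _).ennreal_ofReal,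
        ← lintegral_const_mul _ (hF.pow_const _).ennreal_ofReal]
      refine lintegral_congr fun x => ?_
      have hx := hF0 x
      rw [Pi.mul_apply, ← ENNReal.ofReal_mul (by positivity), ← ENNReal.ofReal_mul (by positivity),
        Real.mul_rpow (by positivity) hx]
      congr 1
      have : F x ^ p = F x ^ 2 * F x ^ (p - 2) := by
        rw [← Real.rpow_two, ← Real.rpow_add_of_nonneg hx (by norm_num) hp2.le]
        congr 1
        ring
      rw [this]
      ring
    rw [← h3, hlay, ← mul_assoc, ← ENNReal.ofReal_mul (by positivity), inv_mul_cancel₀ hp2.ne',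
      ENNReal.ofReal_one, one_mul]
  calc _ ≤ ENNReal.ofReal p * (ENNReal.ofReal 4 * ∫⁻ t in Set.Ioi (0 : ℝ),
        ν {x | t < 2 * A * F x} * ENNReal.ofReal (t ^ (p - 2 - 1))) := by gcongr
    _ = (ENNReal.ofReal p * ENNReal.ofReal 4 * ENNReal.ofReal (p - 2)⁻¹ *
        ENNReal.ofReal ((2 * A) ^ (p - 2))) * ∫⁻ x, ENNReal.ofReal (F x ^ p) ∂μ := by rw [h2]; ring
    _ = _ := by
        rw [← ENNReal.ofReal_mul (by positivity), ← ENNReal.ofReal_mul (by positivity),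
          ← ENNReal.ofReal_mul (by positivity)]
        congr 2
        ring

/-- The integration half of Marcinkiewicz for 1 < p < 2. The L¹ term becomes a layer cake of order p
- 1 under Fμ. The L² term becomes one of negative order p - 2 under F²μ, which is why sublevel sets
occur. -/
theorem lintegral_rpow_le_of_weak_below [SFinite μ] {u F : α → ℝ} (hu : Measurable u)
    (hu0 : ∀ x, 0 ≤ u x) (hF : Measurable F) (hF0 : ∀ x, 0 ≤ F x) {p A : ℝ} (hp1 : 1 < p)
    (hp : p < 2) (hA : 0 < A)
    (h : ∀ t : ℝ, 0 < t → μ {x | t < u x} ≤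
      ENNReal.ofReal (2 * A / t) * ∫⁻ x in {x | t < F x / A}, ENNReal.ofReal (F x) ∂μ +
      ENNReal.ofReal (4 / t ^ 2) * ∫⁻ x in {x | F x / A ≤ t}, ENNReal.ofReal (F x ^ 2) ∂μ) :
    ∫⁻ x, ENNReal.ofReal (u x ^ p) ∂μ ≤
      ENNReal.ofReal ((2 * p / (p - 1) + 4 * p / (2 - p)) * A ^ (2 - p)) *
        ∫⁻ x, ENNReal.ofReal (F x ^ p) ∂μ := by
  have hp0 : 0 < p := by linarith
  have hp11 : 0 < p - 1 := by linarith
  have hp2 : 0 < 2 - p := by linarith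
  have hFm : Measurable fun x => ENNReal.ofReal (F x ^ 2) := (hF.pow_const _).ennreal_ofReal
  have hFm1 : Measurable fun x => ENNReal.ofReal (F x) := hF.ennreal_ofReal
  have hAF : Measurable fun x => F x / A := hF.div_const _
  set ν₁ := μ.withDensity fun x => ENNReal.ofReal (F x) with hν₁
  have hlay := lintegral_rpow_eq_lintegral_meas_lt_mul ν₁ (f := fun x => F x / A)
    (Filter.Eventually.of_forall fun x => by have := hF0 x; positivity)
    hAF.aemeasurable hp11
  set ν₂ := μ.withDensity fun x => ENNReal.ofReal (F x ^ 2) with hν₂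
  -- The negative-order layer cake needs a strictly positive function. The value on {F = 0} is
  -- immaterial, since F²μ does not charge that set.
  let φ : α → ℝ := fun x => if F x = 0 then 1 else F x / A
  have hφ : Measurable φ :=
    Measurable.ite (hF (measurableSet_singleton 0)) measurable_const hAF
  have hφ0 : ∀ x, 0 < φ x := by
    intro x
    by_cases hx : F x = 0
    · simp [φ, hx]
    · have := lt_of_le_of_ne (hF0 x) (Ne.symm hx)
      simp only [φ, hx, if_false]
      positivity
  have hlay2 := lintegral_rpow_mul_meas_le (μ := ν₂) hφ hφ0 (a := p - 2) (by linarith)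
  rw [neg_sub] at hlay2
  rw [lintegral_rpow_eq_lintegral_meas_lt_mul μ (Filter.Eventually.of_forall hu0)
    hu.aemeasurable hp0]
  have hset : ∀ t, ∫⁻ x in {x | F x / A ≤ t}, ENNReal.ofReal (F x ^ 2) ∂μ ≤ ν₂ {x | φ x ≤ t} := by
    intro t
    have hm1 : MeasurableSet {x | F x / A ≤ t} := measurableSet_le hAF measurable_const
    have hm2 : MeasurableSet {x | φ x ≤ t} := measurableSet_le hφ measurable_const
    rw [withDensity_apply _ hm2, ← lintegral_indicator hm1, ← lintegral_indicator hm2]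
    refine lintegral_mono fun x => ?_
    by_cases hx : F x = 0
    · simp [Set.indicator_apply, hx]
    · simp [Set.indicator_apply, φ, hx]
  have h1 : ∫⁻ t in Set.Ioi (0 : ℝ), μ {x | t < u x} * ENNReal.ofReal (t ^ (p - 1)) ≤
      ENNReal.ofReal (2 * A) * (∫⁻ t in Set.Ioi (0 : ℝ),
        ν₁ {x | t < F x / A} * ENNReal.ofReal (t ^ (p - 1 - 1))) +
      ENNReal.ofReal 4 * ∫⁻ t in Set.Ioi (0 : ℝ),
        ν₂ {x | φ x ≤ t} * ENNReal.ofReal (t ^ (p - 2 - 1)) := by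
    rw [← lintegral_const_mul' _ _ ENNReal.ofReal_ne_top,
      ← lintegral_const_mul' _ _ ENNReal.ofReal_ne_top, ← lintegral_add_left]
    swap
    · have hanti : Antitone fun t : ℝ => ν₁ {x | t < F x / A} := fun a b hab =>
        measure_mono fun x hx => lt_of_le_of_lt hab hx
      exact measurable_const.mul (hanti.measurable.mul (measurable_id.pow_const _).ennreal_ofReal)
    refine setLIntegral_mono' measurableSet_Ioi fun t ht => ?_
    have ht : 0 < t := ht
    rw [withDensity_apply _ (measurableSet_lt measurable_const hAF)]
    calc μ {x | t < u x} * ENNReal.ofReal (t ^ (p - 1)) ≤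
        (ENNReal.ofReal (2 * A / t) * ∫⁻ x in {x | t < F x / A}, ENNReal.ofReal (F x) ∂μ +
          ENNReal.ofReal (4 / t ^ 2) * ν₂ {x | φ x ≤ t}) *
            ENNReal.ofReal (t ^ (p - 1)) := by
          gcongr
          refine (h t ht).trans ?_
          gcongr
          exact hset t
      _ = (ENNReal.ofReal (2 * A / t) * ENNReal.ofReal (t ^ (p - 1))) *
          (∫⁻ x in {x | t < F x / A}, ENNReal.ofReal (F x) ∂μ) +
          (ENNReal.ofReal (4 / t ^ 2) * ENNReal.ofReal (t ^ (p - 1))) * ν₂ {x | φ x ≤ t} := by ring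
      _ = (ENNReal.ofReal (2 * A) * ENNReal.ofReal (t ^ (p - 1 - 1))) *
          (∫⁻ x in {x | t < F x / A}, ENNReal.ofReal (F x) ∂μ) +
          (ENNReal.ofReal 4 * ENNReal.ofReal (t ^ (p - 2 - 1))) * ν₂ {x | φ x ≤ t} := by
          rw [← ENNReal.ofReal_mul (by positivity), ← ENNReal.ofReal_mul (by positivity),
            ← ENNReal.ofReal_mul (by positivity), ← ENNReal.ofReal_mul (by positivity)]
          congr 3
          · rw [Real.rpow_sub ht (p - 1) 1, Real.rpow_one]
            ring
          · rw [show p - 2 - 1 = p - 1 - 2 by ring, Real.rpow_sub ht (p - 1), Real.rpow_two]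
            ring
      _ = _ := by ring
  have h2 : ∫⁻ t in Set.Ioi (0 : ℝ), ν₁ {x | t < F x / A} * ENNReal.ofReal (t ^ (p - 1 - 1)) =
      ENNReal.ofReal (p - 1)⁻¹ * (ENNReal.ofReal (A ^ (1 - p)) *
        ∫⁻ x, ENNReal.ofReal (F x ^ p) ∂μ) := by
    have h3 : ∫⁻ x, ENNReal.ofReal ((F x / A) ^ (p - 1)) ∂ν₁ =
        ENNReal.ofReal (A ^ (1 - p)) * ∫⁻ x, ENNReal.ofReal (F x ^ p) ∂μ := by
      rw [lintegral_withDensity_eq_lintegral_mul _ hFm1 (hAF.pow_const _).ennreal_ofReal,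
        ← lintegral_const_mul _ (hF.pow_const _).ennreal_ofReal]
      refine lintegral_congr fun x => ?_
      have hx := hF0 x
      rw [Pi.mul_apply, ← ENNReal.ofReal_mul (by positivity), ← ENNReal.ofReal_mul (by positivity),
        Real.div_rpow hx hA.le]
      congr 1
      have : F x ^ p = F x * F x ^ (p - 1) := by
        conv_rhs => rw [← Real.rpow_one (F x), ← Real.rpow_mul hx, one_mul]
        rw [← Real.rpow_add_of_nonneg hx (by norm_num) hp11.le]
        congr 1
        ring
      rw [this, show 1 - p = -(p - 1) by ring, Real.rpow_neg hA.le]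
      ring
    rw [← h3, hlay, ← mul_assoc, ← ENNReal.ofReal_mul (by positivity), inv_mul_cancel₀ hp11.ne',
      ENNReal.ofReal_one, one_mul]
  have h4 : ∫⁻ x, ENNReal.ofReal (φ x ^ (p - 2)) ∂ν₂ =
      ENNReal.ofReal (A ^ (2 - p)) * ∫⁻ x, ENNReal.ofReal (F x ^ p) ∂μ := by
    rw [lintegral_withDensity_eq_lintegral_mul _ hFm (hφ.pow_const _).ennreal_ofReal,
      ← lintegral_const_mul _ (hF.pow_const _).ennreal_ofReal]
    refine lintegral_congr fun x => ?_
    have hx := hF0 x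
    rw [Pi.mul_apply, ← ENNReal.ofReal_mul (by positivity), ← ENNReal.ofReal_mul (by positivity)]
    congr 1
    by_cases hx0 : F x = 0
    · simp [hx0, Real.zero_rpow hp0.ne']
    · have hxp := lt_of_le_of_ne hx (Ne.symm hx0)
      simp only [φ, hx0, if_false]
      rw [Real.div_rpow hx hA.le, ← Real.rpow_two, show 2 - p = -(p - 2) by ring,
        Real.rpow_neg hA.le, show F x ^ p = F x ^ (2 + (p - 2)) by congr 1; ring,
        Real.rpow_add hxp]
      ring
  rw [hlay2, h4, h2] at h1
  have hAA : A * A ^ (1 - p) = A ^ (2 - p) := by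
    conv_lhs => rw [← Real.rpow_one A, ← Real.rpow_mul hA.le, one_mul, ← Real.rpow_add hA]
    congr 1
    ring
  set I := ∫⁻ x, ENNReal.ofReal (F x ^ p) ∂μ
  calc _ ≤ ENNReal.ofReal p * _ := mul_le_mul_right h1 _
    _ = (ENNReal.ofReal p * ENNReal.ofReal (2 * A) * ENNReal.ofReal (p - 1)⁻¹ *
          ENNReal.ofReal (A ^ (1 - p)) +
        ENNReal.ofReal p * ENNReal.ofReal 4 * ENNReal.ofReal (2 - p)⁻¹ *
          ENNReal.ofReal (A ^ (2 - p))) * I := by ring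
    _ = _ := by
        rw [← ENNReal.ofReal_mul (by positivity), ← ENNReal.ofReal_mul (by positivity),
          ← ENNReal.ofReal_mul (by positivity), ← ENNReal.ofReal_mul (by positivity),
          ← ENNReal.ofReal_mul (by positivity), ← ENNReal.ofReal_mul (by positivity),
          ← ENNReal.ofReal_add (by positivity) (by positivity)]
        congr 2
        rw [← hAA]
        field_simp

end Interpolation

/-! ### Convolution with a Schwartz kernel -/

section ConvolutionOperator

open scoped FourierTransform

variable {d : ℕ} {H : Type*} [NormedAddCommGroup H] [InnerProductSpace ℂ H] [CompleteSpace H]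

/-- Convolution with the kernel `k`. -/
def convOp (k : 𝓢(Rd d, ℂ)) (f : Rd d → H) (x : Rd d) : H := ∫ y, k (x - y) • f y

theorem convOp_schwartz (k : 𝓢(Rd d, ℂ)) (f : 𝓢(Rd d, H)) (x : Rd d) :
    convOp k f x = SchwartzMap.convolution (ContinuousLinearMap.lsmul ℂ ℂ) k f x := by
  rw [SchwartzMap.convolution_apply, MeasureTheory.convolution_eq_swap]
  rfl

/-- Plancherel: on the Fourier side the operator is multiplication by 𝓕 k. -/
theorem eLpNorm_convOp_schwartz_le (k : 𝓢(Rd d, ℂ)) {b : ℝ} (hb : ∀ ξ, ‖𝓕 k ξ‖ ≤ b)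
    (f : 𝓢(Rd d, H)) :
    eLpNorm (convOp k f) 2 volume ≤ ENNReal.ofReal b * eLpNorm f 2 volume := by
  have hpl : ∀ h : 𝓢(Rd d, H), eLpNorm ((𝓕 h : 𝓢(Rd d, H)) : Rd d → H) 2 volume = eLpNorm h 2 volume := by
    intro h
    have := SchwartzMap.norm_fourier_toL2_eq h
    rw [SchwartzMap.norm_toLp, SchwartzMap.norm_toLp] at this
    exact (ENNReal.toReal_eq_toReal_iff' ((𝓕 h).memLp 2 volume).2.ne (h.memLp 2 volume).2.ne).1 this
  have h1 : convOp k f = SchwartzMap.convolution (ContinuousLinearMap.lsmul ℂ ℂ) k f :=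
    funext (convOp_schwartz k f)
  rw [h1, ← hpl, SchwartzMap.fourier_convolution, ← hpl f]
  refine eLpNorm_le_mul_eLpNorm_of_ae_le_mul (Filter.Eventually.of_forall fun ξ => ?_) 2
  rw [SchwartzMap.pairing_apply_apply]
  simp only [ContinuousLinearMap.lsmul_apply, norm_smul]
  gcongr
  exact hb ξ

/-- Cauchy–Schwarz. It makes f ↦ (k * f)(x) continuous on L² for each x, as the density argument for
the L² bound requires. -/
theorem norm_convOp_le (k : 𝓢(Rd d, ℂ)) {f : Rd d → H} (hf : MemLp f 2 volume) (x : Rd d) :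
    ENNReal.ofReal ‖convOp k f x‖ ≤ eLpNorm k 2 volume * eLpNorm f 2 volume := by
  have hk : MemLp (fun y => k (x - y)) 2 volume :=
    (k.memLp 2 volume).comp_measurePreserving (Measure.measurePreserving_sub_left volume x)
  have e1 : eLpNorm (fun y => k (x - y)) 2 volume = eLpNorm k 2 volume :=
    eLpNorm_comp_measurePreserving (k.memLp 2 volume).1 (Measure.measurePreserving_sub_left volume x)
  rw [ofReal_norm, ← e1]
  calc ‖convOp k f x‖ₑ ≤ ∫⁻ y, ‖k (x - y) • f y‖ₑ := enorm_integral_le_lintegral_enorm _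
    _ = eLpNorm ((fun y => k (x - y)) • f) 1 volume := by
        rw [eLpNorm_one_eq_lintegral_enorm]
        rfl
    _ ≤ _ := eLpNorm_smul_le_mul_eLpNorm hf.1 hk.1

theorem integrable_kernel_smul (k : 𝓢(Rd d, ℂ)) {f : Rd d → H} (hf : MemLp f 2 volume) (x : Rd d) :
    Integrable (fun y => k (x - y) • f y) volume := by
  have hk : MemLp (fun y => k (x - y)) 2 volume :=
    (k.memLp 2 volume).comp_measurePreserving (Measure.measurePreserving_sub_left volume x)
  exact memLp_one_iff_integrable.1 (hf.smul hk)

/-- Approximate f in L² by Schwartz functions: the convolutions converge pointwise by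
`norm_convOp_le`, and Fatou passes the Schwartz bound to the limit. -/
theorem eLpNorm_two_convOp_le (k : 𝓢(Rd d, ℂ)) {b : ℝ} (hb : ∀ ξ, ‖𝓕 k ξ‖ ≤ b)
    {f : Rd d → H} (hf : MemLp f 2 volume) :
    eLpNorm (convOp k f) 2 volume ≤ ENNReal.ofReal b * eLpNorm f 2 volume := by
  obtain ⟨u, hu, hlim⟩ : ∃ u : ℕ → Lp H 2 (volume : Measure (Rd d)),
      (∀ i, u i ∈ Set.range (SchwartzMap.toLpCLM ℝ H 2 (volume : Measure (Rd d)))) ∧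
      Filter.Tendsto u Filter.atTop (nhds (hf.toLp f)) :=
    mem_closure_iff_seq_limit.1 (SchwartzMap.denseRange_toLpCLM (by norm_num) (hf.toLp f))
  choose g hg using hu
  have hdist : Filter.Tendsto (fun i => eLpNorm (⇑(g i) - f) 2 volume) Filter.atTop (nhds 0) := by
    have h1 := (Lp.tendsto_Lp_iff_tendsto_eLpNorm' u (hf.toLp f)).1 hlim
    refine h1.congr fun i => eLpNorm_congr_ae ?_
    rw [← hg i]
    filter_upwards [hf.coeFn_toLp, (g i).coeFn_toLp 2 volume] with x hx hx'
    rw [Pi.sub_apply, Pi.sub_apply, hx]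
    congr 1
  have hmem : ∀ i, MemLp (g i) 2 volume := fun i => (g i).memLp 2 volume
  have hpt : ∀ x, Filter.Tendsto (fun i => convOp k (g i) x) Filter.atTop
      (nhds (convOp k f x)) := by
    intro x
    rw [tendsto_iff_norm_sub_tendsto_zero]
    have h1 : ∀ i, convOp k (g i) x - convOp k f x = convOp k (⇑(g i) - f) x := by
      intro i
      unfold convOp
      rw [← integral_sub (integrable_kernel_smul k (hmem i) x) (integrable_kernel_smul k hf x)]
      simp [smul_sub]
    have h2 : Filter.Tendsto (fun i => eLpNorm k 2 volume * eLpNorm (⇑(g i) - f) 2 volume)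
        Filter.atTop (nhds (eLpNorm k 2 volume * 0)) :=
      ENNReal.Tendsto.const_mul hdist (Or.inr (k.memLp 2 volume).2.ne)
    rw [mul_zero] at h2
    have h3 : Filter.Tendsto (fun i => ENNReal.ofReal ‖convOp k (g i) x - convOp k f x‖)
        Filter.atTop (nhds 0) := by
      refine tendsto_of_tendsto_of_tendsto_of_le_of_le tendsto_const_nhds h2 (fun i => zero_le)
        fun i => ?_
      simp only [h1]
      exact norm_convOp_le k ((hmem i).sub hf) x
    have h4 := (ENNReal.tendsto_toReal ENNReal.zero_ne_top).comp h3
    simpa [Function.comp_def] using h4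
  have hfat := Lp.eLpNorm_lim_le_liminf_eLpNorm (p := 2) (μ := (volume : Measure (Rd d)))
    (f := fun i => convOp k (g i))
    (fun i => by
      have : convOp k (g i) = SchwartzMap.convolution (ContinuousLinearMap.lsmul ℂ ℂ) k (g i) :=
        funext (convOp_schwartz k (g i))
      rw [this]
      exact (SchwartzMap.memLp _ 2 volume).1) (convOp k f)
    (Filter.Eventually.of_forall hpt)
  refine hfat.trans ?_
  have hnorm : Filter.Tendsto (fun i => eLpNorm (g i) 2 volume) Filter.atTop
      (nhds (eLpNorm f 2 volume)) := by
    have h1 := (continuous_norm.tendsto _).comp hlim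
    have h2 : ∀ i, eLpNorm (g i) 2 volume = ENNReal.ofReal ‖u i‖ := by
      intro i
      rw [← hg i]
      change _ = ENNReal.ofReal ‖(g i).toLp 2 volume‖
      rw [SchwartzMap.norm_toLp, ENNReal.ofReal_toReal ((g i).memLp 2 volume).2.ne]
    have h3 : eLpNorm f 2 volume = ENNReal.ofReal ‖hf.toLp f‖ := by
      rw [Lp.norm_toLp, ENNReal.ofReal_toReal hf.2.ne]
    simp_rw [h2, h3]
    exact (ENNReal.continuous_ofReal.tendsto _).comp h1
  have h5 := (ENNReal.Tendsto.const_mul hnorm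
    (Or.inr (ENNReal.ofReal_ne_top (r := b)))).liminf_eq
  rw [← h5]
  exact Filter.liminf_le_liminf (Filter.Eventually.of_forall fun i =>
    eLpNorm_convOp_schwartz_le k hb (g i))

end ConvolutionOperator


/-! ### Weak-type bounds and Marcinkiewicz interpolation for convolution operators -/

section ConvolutionOperator

open scoped FourierTransform

variable {d : ℕ} {H : Type*} [NormedAddCommGroup H] [InnerProductSpace ℂ H] [CompleteSpace H]

theorem enorm_convOp_le (k : 𝓢(Rd d, ℂ)) (f : Rd d → H) (x : Rd d) :
    ‖convOp k f x‖ₑ ≤ ∫⁻ y, ‖k (x - y)‖ₑ * ‖f y‖ₑ :=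
  (enorm_integral_le_lintegral_enorm _).trans_eq (by simp_rw [enorm_smul])

theorem stronglyMeasurable_convOp (k : 𝓢(Rd d, ℂ)) {f : Rd d → H} (hf : StronglyMeasurable f) :
    StronglyMeasurable (convOp k f) := by
  refine StronglyMeasurable.integral_prod_right' (f := fun z : Rd d × Rd d => k (z.1 - z.2) • f z.2)
    (StronglyMeasurable.smul ?_ (hf.comp_measurable measurable_snd))
  exact (k.continuous.comp (continuous_fst.sub continuous_snd)).stronglyMeasurable

theorem eLpNorm_convOp_le_lintegral (k : 𝓢(Rd d, ℂ)) {f : Rd d → H} (hf : StronglyMeasurable f)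
    {p : ℝ≥0∞} (hp : 1 ≤ p) :
    eLpNorm (convOp k f) p volume ≤ (∫⁻ y, ‖k y‖ₑ) * eLpNorm f p volume := by
  rw [← eLpNorm_enorm, ← eLpNorm_enorm f]
  exact (eLpNorm_mono_ennreal p (enorm_convOp_le k f)).trans
    (eLpNorm_lintegral_conv_le k.continuous.enorm.measurable hf.enorm hp)

theorem norm_convOp_le_of_bound (k : 𝓢(Rd d, ℂ)) {A : ℝ} (hA : ∫⁻ y, ‖k y‖ₑ ≤ ENNReal.ofReal A)
    (hA0 : 0 ≤ A) {f : Rd d → H} {M : ℝ} (hM : ∀ x, ‖f x‖ ≤ M) (hM0 : 0 ≤ M) (x : Rd d) :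
    ‖convOp k f x‖ ≤ A * M := by
  have h : ‖convOp k f x‖ₑ ≤ ENNReal.ofReal (A * M) := by
    calc ‖convOp k f x‖ₑ ≤ ∫⁻ y, ‖k (x - y)‖ₑ * ‖f y‖ₑ := enorm_convOp_le k f x
      _ ≤ ∫⁻ y, ‖k (x - y)‖ₑ * ENNReal.ofReal M := by
          refine lintegral_mono fun y => ?_
          gcongr
          rw [← ofReal_norm]
          exact ENNReal.ofReal_le_ofReal (hM y)
      _ = (∫⁻ y, ‖k y‖ₑ) * ENNReal.ofReal M := by
          rw [lintegral_mul_const' _ _ ENNReal.ofReal_ne_top,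
            lintegral_sub_left_eq_self (fun y => ‖k y‖ₑ) x]
      _ ≤ _ := by
          rw [ENNReal.ofReal_mul hA0]
          gcongr
  rw [← ofReal_norm] at h
  exact (ENNReal.ofReal_le_ofReal_iff (by positivity)).1 h

theorem lintegral_norm_sq_convOp_le (k : 𝓢(Rd d, ℂ)) (hb : ∀ ξ, ‖𝓕 k ξ‖ ≤ 1)
    {f : Rd d → H} (hf : MemLp f 2 volume) :
    ∫⁻ x, ‖convOp k f x‖ₑ ^ 2 ≤ ∫⁻ x, ‖f x‖ₑ ^ 2 := by
  have h := eLpNorm_two_convOp_le k hb hf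
  rw [ENNReal.ofReal_one, one_mul, eLpNorm_eq_lintegral_rpow_enorm_toReal (by norm_num) (by norm_num),
    eLpNorm_eq_lintegral_rpow_enorm_toReal (by norm_num) (by norm_num)] at h
  have := (ENNReal.rpow_le_rpow_iff (by norm_num)).1 h
  simpa using this

theorem measure_lt_norm_le_sq {u : Rd d → H} (hu : StronglyMeasurable u) {t : ℝ} (ht : 0 < t) :
    volume {x | t / 2 < ‖u x‖} ≤ ENNReal.ofReal (4 / t ^ 2) * ∫⁻ x, ‖u x‖ₑ ^ 2 := by
  have h1 := meas_ge_le_lintegral_div (μ := volume) (hu.enorm.pow_const 2).aemeasurable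
    (ε := ENNReal.ofReal ((t / 2) ^ 2)) (by simp; positivity) ENNReal.ofReal_ne_top
  have h2 : {x | t / 2 < ‖u x‖} ⊆ {x | ENNReal.ofReal ((t / 2) ^ 2) ≤ ‖u x‖ₑ ^ 2} := by
    intro x hx
    have hx : t / 2 < ‖u x‖ := hx
    change ENNReal.ofReal ((t / 2) ^ 2) ≤ ‖u x‖ₑ ^ 2
    rw [← ofReal_norm, ← ENNReal.ofReal_pow (norm_nonneg _)]
    exact ENNReal.ofReal_le_ofReal (by gcongr)
  refine (measure_mono h2).trans (h1.trans_eq ?_)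
  rw [ENNReal.div_eq_inv_mul, ← ENNReal.ofReal_inv_of_pos (by positivity)]
  congr 2
  field_simp
  norm_num

theorem measure_lt_norm_le_one {u : Rd d → H} (hu : StronglyMeasurable u) {t : ℝ} (ht : 0 < t) :
    volume {x | t / 2 < ‖u x‖} ≤ ENNReal.ofReal (2 / t) * ∫⁻ x, ‖u x‖ₑ := by
  have h1 := meas_ge_le_lintegral_div (μ := volume) hu.enorm.aemeasurable
    (ε := ENNReal.ofReal (t / 2)) (by simp; positivity) ENNReal.ofReal_ne_top
  have h2 : {x | t / 2 < ‖u x‖} ⊆ {x | ENNReal.ofReal (t / 2) ≤ ‖u x‖ₑ} := by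
    intro x hx
    have hx : t / 2 < ‖u x‖ := hx
    change ENNReal.ofReal (t / 2) ≤ ‖u x‖ₑ
    rw [← ofReal_norm]
    exact ENNReal.ofReal_le_ofReal hx.le
  refine (measure_mono h2).trans (h1.trans_eq ?_)
  rw [ENNReal.div_eq_inv_mul, ← ENNReal.ofReal_inv_of_pos (by positivity), inv_div]

theorem convOp_add (k : 𝓢(Rd d, ℂ)) {f g : Rd d → H} (hf : MemLp f 2 volume)
    (hg : MemLp g 2 volume) (x : Rd d) : convOp k (f + g) x = convOp k f x + convOp k g x := by
  unfold convOp
  rw [← integral_add (integrable_kernel_smul k hf x) (integrable_kernel_smul k hg x)]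
  simp [smul_add]

/-- Cut f at height t/(2A). By the L^∞ bound the low part is mapped below t/2, so only the high part
can push the image above t; it is estimated by Chebyshev and the L² bound. -/
theorem weak_bound_above (k : 𝓢(Rd d, ℂ)) {A : ℝ} (hA0 : 0 < A)
    (hA : ∫⁻ y, ‖k y‖ₑ ≤ ENNReal.ofReal A) (hb : ∀ ξ, ‖𝓕 k ξ‖ ≤ 1) {f : Rd d → H}
    (hf : StronglyMeasurable f) (hf2 : MemLp f 2 volume) {t : ℝ} (ht : 0 < t) :
    volume {x | t < ‖convOp k f x‖} ≤ ENNReal.ofReal (4 / t ^ 2) *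
      ∫⁻ x in {x | t < 2 * A * ‖f x‖}, ENNReal.ofReal (‖f x‖ ^ 2) := by
  set S := {x | t < 2 * A * ‖f x‖} with hS
  have hSm : MeasurableSet S := measurableSet_lt measurable_const (measurable_const.mul hf.norm.measurable)
  have h1 : MemLp (S.indicator f) 2 volume := hf2.indicator hSm
  have h2 : MemLp (Sᶜ.indicator f) 2 volume := hf2.indicator hSm.compl
  have hsum : f = S.indicator f + Sᶜ.indicator f := (Set.indicator_self_add_compl S f).symm
  have hbd : ∀ x, ‖convOp k (Sᶜ.indicator f) x‖ ≤ t / 2 := by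
    intro x
    have := norm_convOp_le_of_bound k hA hA0.le (f := Sᶜ.indicator f) (M := t / (2 * A)) ?_
      (by positivity) x
    · calc _ ≤ _ := this
        _ = t / 2 := by field_simp
    · intro y
      by_cases hy : y ∈ S
      · simp only [Set.indicator_of_notMem (Set.notMem_compl_iff.2 hy), norm_zero]
        positivity
      · rw [Set.indicator_of_mem (Set.mem_compl hy)]
        have : ¬ t < 2 * A * ‖f y‖ := hy
        rw [le_div_iff₀ (by positivity)]
        linarith
  have hsub : {x | t < ‖convOp k f x‖} ⊆ {x | t / 2 < ‖convOp k (S.indicator f) x‖} := by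
    intro x hx
    have hx : t < ‖convOp k f x‖ := hx
    rw [hsum, convOp_add k h1 h2] at hx
    have := norm_add_le (convOp k (S.indicator f) x) (convOp k (Sᶜ.indicator f) x)
    have := hbd x
    change t / 2 < _
    linarith
  refine (measure_mono hsub).trans ((measure_lt_norm_le_sq
    (stronglyMeasurable_convOp k (hf.indicator hSm)) ht).trans ?_)
  refine mul_le_mul_right ?_ _
  refine (lintegral_norm_sq_convOp_le k hb h1).trans_eq ?_
  rw [← lintegral_indicator hSm]
  refine lintegral_congr fun x => ?_
  by_cases hx : x ∈ S
  · simp [Set.indicator_of_mem hx, ← ofReal_norm, ENNReal.ofReal_pow]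
  · simp [Set.indicator_of_notMem hx]

/-- Cut f at height At. The high part is estimated by Chebyshev and the L¹ bound, the low part by
Chebyshev and the L² bound. The cut at At makes the final power of A the interpolated one. -/
theorem weak_bound_below (k : 𝓢(Rd d, ℂ)) {A : ℝ} (hA0 : 0 < A)
    (hA : ∫⁻ y, ‖k y‖ₑ ≤ ENNReal.ofReal A) (hb : ∀ ξ, ‖𝓕 k ξ‖ ≤ 1) {f : Rd d → H}
    (hf : StronglyMeasurable f) (hf2 : MemLp f 2 volume) {t : ℝ} (ht : 0 < t) :
    volume {x | t < ‖convOp k f x‖} ≤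
      ENNReal.ofReal (2 * A / t) * (∫⁻ x in {x | t < ‖f x‖ / A}, ENNReal.ofReal ‖f x‖) +
      ENNReal.ofReal (4 / t ^ 2) *
        ∫⁻ x in {x | ‖f x‖ / A ≤ t}, ENNReal.ofReal (‖f x‖ ^ 2) := by
  set S := {x | t < ‖f x‖ / A} with hS
  have hSm : MeasurableSet S := measurableSet_lt measurable_const (hf.norm.measurable.div_const _)
  have hSc : {x | ‖f x‖ / A ≤ t} = Sᶜ := by
    ext x
    simp [hS]
  rw [hSc]
  have h1 : MemLp (S.indicator f) 2 volume := hf2.indicator hSm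
  have h2 : MemLp (Sᶜ.indicator f) 2 volume := hf2.indicator hSm.compl
  have hsum : f = S.indicator f + Sᶜ.indicator f := (Set.indicator_self_add_compl S f).symm
  have hsub : {x | t < ‖convOp k f x‖} ⊆ {x | t / 2 < ‖convOp k (S.indicator f) x‖} ∪
      {x | t / 2 < ‖convOp k (Sᶜ.indicator f) x‖} := by
    intro x hx
    have hx : t < ‖convOp k f x‖ := hx
    rw [hsum, convOp_add k h1 h2] at hx
    have := norm_add_le (convOp k (S.indicator f) x) (convOp k (Sᶜ.indicator f) x)
    by_contra hcon
    simp only [Set.mem_union, Set.mem_ofPred_eq, not_or, not_lt] at hcon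
    linarith [hcon.1, hcon.2]
  refine (measure_mono hsub).trans ((measure_union_le _ _).trans (add_le_add ?_ ?_))
  · refine (measure_lt_norm_le_one (stronglyMeasurable_convOp k (hf.indicator hSm)) ht).trans ?_
    have h3 := eLpNorm_convOp_le_lintegral k (hf.indicator hSm) (le_refl (1 : ℝ≥0∞))
    simp only [eLpNorm_one_eq_lintegral_enorm] at h3
    calc ENNReal.ofReal (2 / t) * ∫⁻ x, ‖convOp k (S.indicator f) x‖ₑ
        ≤ ENNReal.ofReal (2 / t) * (ENNReal.ofReal A * ∫⁻ x, ‖S.indicator f x‖ₑ) := by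
          gcongr
          exact h3.trans (mul_le_mul_left hA _)
      _ = ENNReal.ofReal (2 * A / t) * ∫⁻ x, ‖S.indicator f x‖ₑ := by
          rw [← mul_assoc, ← ENNReal.ofReal_mul (by positivity)]
          congr 2
          ring
      _ = _ := by
          rw [← lintegral_indicator hSm]
          congr 1
          refine lintegral_congr fun x => ?_
          by_cases hx : x ∈ S
          · simp [Set.indicator_of_mem hx]
          · simp [Set.indicator_of_notMem hx]
  · refine (measure_lt_norm_le_sq
      (stronglyMeasurable_convOp k (hf.indicator hSm.compl)) ht).trans ?_
    refine mul_le_mul_right ?_ _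
    refine (lintegral_norm_sq_convOp_le k hb h2).trans_eq ?_
    rw [← lintegral_indicator hSm.compl]
    refine lintegral_congr fun x => ?_
    by_cases hx : x ∈ Sᶜ
    · simp [Set.indicator_of_mem hx, ← ofReal_norm, ENNReal.ofReal_pow]
    · simp [Set.indicator_of_notMem hx]

theorem eLpNorm_le_of_lintegral_rpow_le {u f : Rd d → H} {p : ℝ≥0∞} (h0 : p ≠ 0) (ht : p ≠ ∞)
    {c : ℝ} (h : ∫⁻ x, ENNReal.ofReal (‖u x‖ ^ p.toReal) ≤
      ENNReal.ofReal c * ∫⁻ x, ENNReal.ofReal (‖f x‖ ^ p.toReal)) (hc : 0 ≤ c) :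
    eLpNorm u p volume ≤ ENNReal.ofReal (c ^ (1 / p.toReal)) * eLpNorm f p volume := by
  have hp0 : 0 < p.toReal := ENNReal.toReal_pos h0 ht
  rw [eLpNorm_eq_lintegral_rpow_enorm_toReal h0 ht, eLpNorm_eq_lintegral_rpow_enorm_toReal h0 ht,
    ← ENNReal.ofReal_rpow_of_nonneg hc (by positivity),
    ← ENNReal.mul_rpow_of_nonneg _ _ (by positivity)]
  refine ENNReal.rpow_le_rpow ?_ (by positivity)
  simpa [← ofReal_norm, ENNReal.ofReal_rpow_of_nonneg _ hp0.le] using h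

/-- Interpolation between the trivial `L¹`, `L^∞` bounds and the `L²` bound of a convolution
operator, for nice functions. -/
theorem exists_eLpNorm_convOp_le_of_memLp {p : ℝ≥0∞} (hp : 1 ≤ p) :
    ∃ C : ℝ, 0 < C ∧ ∀ (d : ℕ) (k : 𝓢(Rd d, ℂ)) (A : ℝ), 0 < A →
      ∫⁻ y, ‖k y‖ₑ ≤ ENNReal.ofReal A → (∀ ξ, ‖𝓕 k ξ‖ ≤ 1) → ∀ f : Rd d → H,
      StronglyMeasurable f → MemLp f 2 volume →
      eLpNorm (convOp k f) p volume ≤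
        ENNReal.ofReal (C * A ^ (2 * |1 / 2 - (p⁻¹).toReal|)) * eLpNorm f p volume := by
  rcases eq_or_ne p ∞ with rfl | ht
  · refine ⟨1, one_pos, fun d k A hA0 hA hb f hf hf2 => ?_⟩
    have : (2 : ℝ) * |1 / 2 - ((∞ : ℝ≥0∞)⁻¹).toReal| = 1 := by
      rw [ENNReal.inv_top, ENNReal.toReal_zero, sub_zero, abs_of_pos] <;> norm_num
    rw [this, Real.rpow_one, one_mul]
    exact (eLpNorm_convOp_le_lintegral k hf hp).trans (by gcongr)
  have h0 : p ≠ 0 := (zero_lt_one.trans_le hp).ne'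
  have hpr : 1 ≤ p.toReal := by
    rw [← ENNReal.toReal_one]
    exact (ENNReal.toReal_le_toReal ENNReal.one_ne_top ht).2 hp
  have hinv : (p⁻¹).toReal = p.toReal⁻¹ := ENNReal.toReal_inv p
  have hp0 : 0 < p.toReal := by linarith
  set P := p.toReal with hP
  rcases hpr.eq_or_lt with h1 | h1
  · refine ⟨1, one_pos, fun d k A hA0 hA hb f hf hf2 => ?_⟩
    have : (2 : ℝ) * |1 / 2 - (p⁻¹).toReal| = 1 := by
      rw [hinv, ← h1, abs_of_neg] <;> norm_num
    rw [this, Real.rpow_one, one_mul]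
    exact (eLpNorm_convOp_le_lintegral k hf hp).trans (by gcongr)
  -- The Marcinkiewicz constants blow up as P tends to 2, so P = 2 is left to Plancherel. Since p is
  -- fixed, only the power of A has to be sharp.
  rcases lt_trichotomy P 2 with h2 | h2 | h2
  · have h21 : 0 < 2 - P := by linarith
    have h11 : 0 < P - 1 := by linarith
    refine ⟨(2 * P / (P - 1) + 4 * P / (2 - P)) ^ (1 / P), by positivity,
      fun d k A hA0 hA hb f hf hf2 => ?_⟩
    have := lintegral_rpow_le_of_weak_below
      (stronglyMeasurable_convOp k hf).norm.measurable (fun x => norm_nonneg _)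
      hf.norm.measurable (fun x => norm_nonneg _) h1 h2 hA0
      fun t ht => weak_bound_below k hA0 hA hb hf hf2 ht
    refine (eLpNorm_le_of_lintegral_rpow_le h0 ht this (by positivity)).trans_eq ?_
    rw [Real.mul_rpow (by positivity) (by positivity), ← Real.rpow_mul hA0.le, hinv, abs_of_neg]
    · congr 4
      rw [← hP]
      field_simp
      ring
    · rw [sub_neg, div_lt_iff₀ (by norm_num), inv_mul_eq_div, lt_div_iff₀ hp0]
      linarith
  · refine ⟨1, one_pos, fun d k A hA0 hA hb f hf hf2 => ?_⟩
    have hp2 : p = 2 := by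
      rw [← ENNReal.ofReal_toReal ht, ← hP, h2]
      norm_num
    have : (2 : ℝ) * |1 / 2 - (p⁻¹).toReal| = 0 := by
      rw [hinv, h2]
      norm_num
    rw [this, Real.rpow_zero, mul_one, hp2]
    exact eLpNorm_two_convOp_le k hb hf2
  · have h22 : 0 < P - 2 := by linarith
    refine ⟨(4 * P / (P - 2) * 2 ^ (P - 2)) ^ (1 / P), by positivity,
      fun d k A hA0 hA hb f hf hf2 => ?_⟩
    have := lintegral_rpow_le_of_weak_above
      (stronglyMeasurable_convOp k hf).norm.measurable (fun x => norm_nonneg _)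
      hf.norm.measurable (fun x => norm_nonneg _) h2 hA0
      fun t ht => weak_bound_above k hA0 hA hb hf hf2 ht
    refine (eLpNorm_le_of_lintegral_rpow_le h0 ht this (by positivity)).trans_eq ?_
    rw [Real.mul_rpow (by norm_num : (0:ℝ) ≤ 2) hA0.le, ← mul_assoc,
      Real.mul_rpow (by positivity) (by positivity), ← Real.rpow_mul hA0.le, hinv, abs_of_pos]
    · congr 4
      rw [← hP]
      field_simp
    · rw [sub_pos, inv_eq_one_div]
      exact one_div_lt_one_div_of_lt (by norm_num) h2

/-- The `L^p` bound of a convolution operator obtained by interpolating between `L¹`, `L²`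
and `L^∞`. -/
theorem exists_eLpNorm_convOp_le {p : ℝ≥0∞} (hp : 1 ≤ p) :
    ∃ C : ℝ, 0 < C ∧ ∀ (d : ℕ) (k : 𝓢(Rd d, ℂ)) (A b : ℝ), 0 < A → 0 < b →
      ∫⁻ y, ‖k y‖ₑ ≤ ENNReal.ofReal (b * A) → (∀ ξ, ‖𝓕 k ξ‖ ≤ b) → ∀ f : Rd d → H,
      Continuous f → (∀ x, Integrable (fun y => k (x - y) • f y) volume) →
      eLpNorm (convOp k f) p volume ≤
        ENNReal.ofReal (C * b * A ^ (2 * |1 / 2 - (p⁻¹).toReal|)) * eLpNorm f p volume := by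
  obtain ⟨C, hC, h⟩ := exists_eLpNorm_convOp_le_of_memLp (H := H) hp
  refine ⟨C, hC, fun d k A b hA0 hb0 hA hb f hf hInt => ?_⟩
  set D := A ^ (2 * |1 / 2 - (p⁻¹).toReal|) with hD
  have hDpos : 0 < D := Real.rpow_pos_of_pos hA0 _
  have hfm : StronglyMeasurable f := hf.stronglyMeasurable
  -- Dividing the kernel by b normalises the L² bound to 1, so A measures the ratio of the L¹ bound
  -- to the L² bound.
  have hscale : ∀ f : Rd d → H, convOp k f = b • convOp (((b⁻¹ : ℝ) : ℂ) • k) f := by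
    intro f
    ext1 x
    have e : ∀ y, (((b⁻¹ : ℝ) : ℂ) • k) (x - y) • f y = b⁻¹ • (k (x - y) • f y) := by
      intro y
      rw [smul_apply, smul_eq_mul, ← smul_smul, Complex.coe_smul]
    simp only [convOp, Pi.smul_apply, e]
    rw [integral_smul, smul_smul, mul_inv_cancel₀ hb0.ne', one_smul]
  -- A continuous f need not lie in L², but its restrictions to balls do. The bound is uniform in
  -- the ball, and dominated convergence with Fatou removes the cut-off.
  have hball : ∀ N : ℕ, eLpNorm (convOp k ((Metric.ball 0 N).indicator f)) p volume ≤
      ENNReal.ofReal (C * b * D) * eLpNorm f p volume := by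
    intro N
    rw [hscale, eLpNorm_const_smul]
    have h1 := h d (((b⁻¹ : ℝ) : ℂ) • k) A hA0 ?_ ?_ ((Metric.ball 0 N).indicator f)
      (hfm.indicator measurableSet_ball) ?_
    · calc ‖b‖ₑ * _ ≤ ENNReal.ofReal b * (ENNReal.ofReal (C * D) * eLpNorm f p volume) := by
            rw [Real.enorm_of_nonneg hb0.le]
            gcongr
            refine h1.trans ?_
            gcongr
            exact eLpNorm_indicator_le f
        _ = _ := by
            rw [← mul_assoc, ← ENNReal.ofReal_mul hb0.le]
            congr 2
            ring
    · calc ∫⁻ y, ‖(((b⁻¹ : ℝ) : ℂ) • k) y‖ₑ = ENNReal.ofReal b⁻¹ * ∫⁻ y, ‖k y‖ₑ := by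
            rw [← lintegral_const_mul _ k.continuous.enorm.measurable]
            refine lintegral_congr fun y => ?_
            rw [smul_apply, enorm_smul, ← ofReal_norm ((b⁻¹ : ℝ) : ℂ)]
            simp [abs_of_pos hb0]
        _ ≤ ENNReal.ofReal b⁻¹ * ENNReal.ofReal (b * A) := by gcongr
        _ = ENNReal.ofReal A := by
            rw [← ENNReal.ofReal_mul (by positivity)]
            congr 1
            field_simp
    · intro ξ
      rw [FourierTransform.fourier_smul, smul_apply, norm_smul]
      simp only [Complex.norm_real, Real.norm_eq_abs, abs_of_pos (inv_pos.2 hb0)]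
      rw [inv_mul_le_iff₀ hb0, mul_one]
      exact hb ξ
    · rw [memLp_indicator_iff_restrict measurableSet_ball]
      obtain ⟨M, hM⟩ := (isCompact_closedBall (0 : Rd d) N).exists_bound_of_continuousOn
        hf.continuousOn
      have : IsFiniteMeasure ((volume : Measure (Rd d)).restrict (Metric.ball 0 (N : ℝ))) :=
        ⟨by rw [Measure.restrict_apply_univ]; exact measure_ball_lt_top⟩
      refine MemLp.of_bound hfm.aestronglyMeasurable M ?_
      filter_upwards [ae_restrict_mem measurableSet_ball] with x hx
      exact hM x (Metric.ball_subset_closedBall hx)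
  have hpt : ∀ x, Filter.Tendsto (fun N : ℕ => convOp k ((Metric.ball 0 N).indicator f) x)
      Filter.atTop (nhds (convOp k f x)) := by
    intro x
    refine tendsto_integral_of_dominated_convergence (fun y => ‖k (x - y) • f y‖) ?_ (hInt x).norm
      ?_ ?_
    · intro N
      have := (hInt x).1.indicator (measurableSet_ball (x := (0 : Rd d)) (ε := N))
      refine this.congr (Filter.Eventually.of_forall fun y => ?_)
      by_cases hy : y ∈ Metric.ball (0 : Rd d) N
      · simp [Set.indicator_of_mem hy]
      · simp [Set.indicator_of_notMem hy]
    · refine fun N => Filter.Eventually.of_forall fun y => ?_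
      rw [norm_smul, norm_smul]
      gcongr
      exact norm_indicator_le_norm_self f y
    · refine Filter.Eventually.of_forall fun y => ?_
      refine tendsto_const_nhds.congr' ?_
      obtain ⟨N₀, hN₀⟩ := exists_nat_gt ‖y‖
      filter_upwards [Filter.eventually_ge_atTop N₀] with N hN
      rw [Set.indicator_of_mem]
      rw [mem_ball_zero_iff]
      exact hN₀.trans_le (by exact_mod_cast hN)
  refine (Lp.eLpNorm_lim_le_liminf_eLpNorm (f := fun N : ℕ =>
    convOp k ((Metric.ball 0 N).indicator f)) (fun N => (stronglyMeasurable_convOp k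
      (hfm.indicator measurableSet_ball)).aestronglyMeasurable) (convOp k f)
      (Filter.Eventually.of_forall hpt)).trans ?_
  exact (Filter.liminf_le_liminf (Filter.Eventually.of_forall hball)).trans_eq
    (Filter.liminf_const _)

end ConvolutionOperator


/-! ### Completeness of the Schwartz space -/

section Complete

open Filter Topology

variable {E F : Type*} [NormedAddCommGroup E] [NormedSpace ℝ E] [NormedAddCommGroup F]
  [NormedSpace ℝ F]

theorem exists_seminorm_sub_lt {u : ℕ → 𝓢(E, F)} (hu : CauchySeq u) (k l : ℕ) {ε : ℝ}
    (hε : 0 < ε) : ∃ N, ∀ i ≥ N, ∀ j ≥ N, SchwartzMap.seminorm ℝ k l (u i - u j) < ε := by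
  have hc : Continuous (SchwartzMap.seminorm ℝ k l : 𝓢(E, F) → ℝ) :=
    (schwartz_withSeminorms ℝ E F).continuous_seminorm (k, l)
  have h0 : {f : 𝓢(E, F) | SchwartzMap.seminorm ℝ k l f < ε} ∈ 𝓝 (0 : 𝓢(E, F)) :=
    (isOpen_lt hc continuous_const).mem_nhds (by simpa using hε)
  have hV : {z : 𝓢(E, F) × 𝓢(E, F) | SchwartzMap.seminorm ℝ k l (z.2 - z.1) < ε} ∈
      uniformity 𝓢(E, F) := by
    rw [uniformity_eq_comap_nhds_zero]
    exact ⟨_, h0, subset_rfl⟩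
  obtain ⟨N, hN⟩ := cauchySeq_iff.1 hu _ hV
  exact ⟨N, fun i hi j hj => hN j hj i hi⟩

theorem iteratedFDeriv_schwartz_sub (f g : 𝓢(E, F)) (l : ℕ) (x : E) :
    iteratedFDeriv ℝ l (f - g : 𝓢(E, F)) x = iteratedFDeriv ℝ l f x - iteratedFDeriv ℝ l g x := by
  have : ((f - g : 𝓢(E, F)) : E → F) = (f : E → F) - g := rfl
  rw [this]
  exact iteratedFDeriv_sub_apply ((f.smooth l).contDiffAt) ((g.smooth l).contDiffAt)

/-- For a Cauchy sequence all weighted derivatives converge uniformly, and the limits form a Taylor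
series of the limit function. Completeness is what makes Banach–Steinhaus available on the Schwartz
space. -/
instance instCompleteSpaceSchwartz [CompleteSpace F] : CompleteSpace 𝓢(E, F) := by
  have : (uniformity 𝓢(E, F)).IsCountablyGenerated :=
    IsUniformAddGroup.uniformity_countably_generated
  refine UniformSpace.complete_of_cauchySeq_tendsto fun u hu => ?_
  have hpt : ∀ (l k : ℕ) (ε : ℝ), 0 < ε → ∃ N, ∀ i ≥ N, ∀ j ≥ N, ∀ x,
      ‖x‖ ^ k * ‖iteratedFDeriv ℝ l (u i) x - iteratedFDeriv ℝ l (u j) x‖ < ε := by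
    intro l k ε hε
    obtain ⟨N, hN⟩ := exists_seminorm_sub_lt hu k l hε
    refine ⟨N, fun i hi j hj x => ?_⟩
    rw [← iteratedFDeriv_schwartz_sub]
    exact (SchwartzMap.le_seminorm ℝ k l _ x).trans_lt (hN i hi j hj)
  have hlim : ∀ (l : ℕ) (x : E), ∃ G, Tendsto (fun i => iteratedFDeriv ℝ l (u i) x) atTop (𝓝 G) := by
    intro l x
    refine cauchySeq_tendsto_of_complete (Metric.cauchySeq_iff.2 fun ε hε => ?_)
    obtain ⟨N, hN⟩ := hpt l 0 ε hε
    refine ⟨N, fun i hi j hj => ?_⟩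
    simpa [dist_eq_norm] using hN i hi j hj x
  choose G hG using hlim
  have hG' : ∀ (l k : ℕ) (ε : ℝ), 0 < ε → ∃ N, ∀ i ≥ N, ∀ x,
      ‖x‖ ^ k * ‖iteratedFDeriv ℝ l (u i) x - G l x‖ ≤ ε := by
    intro l k ε hε
    obtain ⟨N, hN⟩ := hpt l k ε hε
    refine ⟨N, fun i hi x => ?_⟩
    have h1 : Tendsto (fun j => ‖x‖ ^ k *
        ‖iteratedFDeriv ℝ l (u i) x - iteratedFDeriv ℝ l (u j) x‖) atTop
        (𝓝 (‖x‖ ^ k * ‖iteratedFDeriv ℝ l (u i) x - G l x‖)) :=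
      (tendsto_const_nhds.sub (hG l x)).norm.const_mul _
    refine le_of_tendsto h1 ?_
    filter_upwards [eventually_ge_atTop N] with j hj
    exact (hN i hi j hj x).le
  have hunif : ∀ l, TendstoUniformly (fun i x => iteratedFDeriv ℝ l (u i) x) (G l) atTop := by
    intro l
    rw [Metric.tendstoUniformly_iff]
    intro ε hε
    obtain ⟨N, hN⟩ := hG' l 0 (ε / 2) (by positivity)
    filter_upwards [eventually_ge_atTop N] with i hi x
    have := hN i hi x
    rw [dist_comm, dist_eq_norm]
    rw [pow_zero, one_mul] at this
    linarith
  -- Uniform convergence of the derivatives of order l + 1 allows differentiating the limit of order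
  -- l.
  have hderiv : ∀ l x, HasFDerivAt (G l) ((G (l + 1) x).curryLeft) x := by
    intro l x
    have hcurry : ∀ i y, HasFDerivAt (iteratedFDeriv ℝ l (u i))
        ((iteratedFDeriv ℝ (l + 1) (u i) y).curryLeft) y := by
      intro i y
      have hd : DifferentiableAt ℝ (iteratedFDeriv ℝ l (u i)) y :=
        ((u i).smooth (l + 1 : ℕ)).differentiable_iteratedFDeriv (by exact_mod_cast Nat.lt_succ_self l) y
      have h2 := hd.hasFDerivAt
      convert! h2 using 1
    have hiso := (continuousMultilinearCurryLeftEquiv ℝ (fun _ : Fin (l + 1) => E) F).isometry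
    exact hasFDerivAt_of_tendstoUniformly (l := atTop)
      (hiso.uniformContinuous.comp_tendstoUniformly (hunif (l + 1))) hcurry (hG l) x
  let f : E → F := fun x => (G 0 x).curry0
  let P : E → FormalMultilinearSeries ℝ E F := fun x l => G l x
  have htaylor : HasFTaylorSeriesUpTo (⊤ : ℕ∞) f P :=
    (hasFTaylorSeriesUpTo_top_iff' le_rfl).2 ⟨fun x => rfl, hderiv⟩
  have hiter : ∀ l x, iteratedFDeriv ℝ l f x = G l x := fun l x =>
    (htaylor.eq_iteratedFDeriv (m := l) (by exact_mod_cast le_top) x).symm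
  let v : 𝓢(E, F) :=
    { toFun := f
      smooth' := htaylor.contDiff
      decay' := by
        intro k l
        obtain ⟨N, hN⟩ := hG' l k 1 one_pos
        refine ⟨SchwartzMap.seminorm ℝ k l (u N) + 1, fun x => ?_⟩
        rw [hiter]
        have h1 := hN N le_rfl x
        have h2 := SchwartzMap.le_seminorm ℝ k l (u N) x
        have h3 : ‖G l x‖ ≤ ‖iteratedFDeriv ℝ l (u N) x‖ + ‖iteratedFDeriv ℝ l (u N) x - G l x‖ := by
          rw [norm_sub_rev]
          exact norm_le_norm_add_norm_sub' _ _
        calc ‖x‖ ^ k * ‖G l x‖ ≤ ‖x‖ ^ k * (‖iteratedFDeriv ℝ l (u N) x‖ +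
              ‖iteratedFDeriv ℝ l (u N) x - G l x‖) := by gcongr
          _ ≤ _ := by rw [mul_add]; linarith }
  refine ⟨v, ?_⟩
  rw [(schwartz_withSeminorms ℝ E F).tendsto_nhds_atTop]
  rintro ⟨k, l⟩ ε hε
  obtain ⟨N, hN⟩ := hG' l k (ε / 2) (by positivity)
  refine ⟨N, fun i hi => ?_⟩
  refine (SchwartzMap.seminorm_le_bound ℝ k l (u i - v) (by positivity : 0 ≤ ε / 2) fun x => ?_).trans_lt
    (by linarith)
  rw [iteratedFDeriv_schwartz_sub]
  change ‖x‖ ^ k * ‖iteratedFDeriv ℝ l (u i) x - iteratedFDeriv ℝ l f x‖ ≤ _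
  rw [hiter]
  exact hN i hi x

/-- The uniform boundedness principle on the Schwartz space. -/
theorem eventually_forall_norm_lt_of_pointwise_bounded [CompleteSpace F] {ι G : Type*}
    [NormedAddCommGroup G] [NormedSpace ℝ G] (T : ι → 𝓢(E, F) →L[ℝ] G)
    (hT : ∀ φ, ∃ C, ∀ i, ‖T i φ‖ ≤ C) {ε : ℝ} (hε : 0 < ε) :
    ∀ᶠ φ in 𝓝 (0 : 𝓢(E, F)), ∀ i, ‖T i φ‖ < ε := by
  have hcg : (uniformity 𝓢(E, F)).IsCountablyGenerated :=
    IsUniformAddGroup.uniformity_countably_generated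
  -- The Schwartz space, complete with countably generated uniformity, is Baire and hence barrelled.
  have hbs : UniformEquicontinuous fun i => (T i : 𝓢(E, F) → G) := by
    refine (norm_withSeminorms ℝ G).banach_steinhaus (𝓕 := T) fun k φ => ?_
    obtain ⟨C, hC⟩ := hT φ
    refine ⟨C, ?_⟩
    rintro _ ⟨i, rfl⟩
    exact hC i
  have h0 := hbs.equicontinuous 0
  filter_upwards [Metric.equicontinuousAt_iff_right.1 h0 ε hε] with φ hφ i
  have := hφ i
  rwa [map_zero, dist_zero_left] at this

end Complete


open scoped FourierTransform

/-! ### Estimates for the exponential of dissipative operators -/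

section Exponential

open NormedSpace

variable {H : Type} [NormedAddCommGroup H] [InnerProductSpace ℂ H] [CompleteSpace H]

/-- The operators whose Hermitian part is at most `K`. -/
def HermitianPartLE (K : ℝ) (X : H →L[ℂ] H) : Prop := ∀ v, (⟪v, X v⟫_ℂ).re ≤ K * ‖v‖ ^ 2

theorem HermitianPartLE.add_norm {K : ℝ} {X : H →L[ℂ] H} (h : HermitianPartLE K X)
    (Y : H →L[ℂ] H) : HermitianPartLE (K + ‖Y‖) (X + Y) := by
  intro v
  have h1 : (⟪v, Y v⟫_ℂ).re ≤ ‖Y‖ * ‖v‖ ^ 2 := by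
    calc (⟪v, Y v⟫_ℂ).re ≤ ‖⟪v, Y v⟫_ℂ‖ := Complex.re_le_norm _
      _ ≤ ‖v‖ * ‖Y v‖ := norm_inner_le_norm _ _
      _ ≤ ‖v‖ * (‖Y‖ * ‖v‖) := by gcongr; exact Y.le_opNorm v
      _ = _ := by ring
  rw [add_apply, inner_add_right, Complex.add_re, add_mul]
  exact add_le_add (h v) h1

/-- Along y(s) = exp(sX)v the derivative of ‖y‖² is 2 Re⟨y, Xy⟩ ≤ 2K‖y‖², so e^{-2Ks}‖y(s)‖² is
nonincreasing; compare s = 1 with s = 0. -/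
theorem norm_exp_le_of_hermitianPartLE {K : ℝ} {X : H →L[ℂ] H} (h : HermitianPartLE K X) :
    ‖exp X‖ ≤ Real.exp K := by
  refine ContinuousLinearMap.opNorm_le_bound _ (Real.exp_pos K).le fun v => ?_
  let y : ℝ → H := fun s => exp (s • X) v
  have hy : ∀ s, HasDerivAt y (X (y s)) s := by
    intro s
    have h1 := hasDerivAt_exp_smul_const' (𝕂 := ℝ) X s
    exact ((ContinuousLinearMap.apply ℂ H v).restrictScalars ℝ).hasFDerivAt.comp_hasDerivAt s h1
  have hn : ∀ s, HasDerivAt (fun s => ‖y s‖ ^ 2) (2 * (⟪y s, X (y s)⟫_ℂ).re) s := by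
    intro s
    have h1 := Complex.reCLM.hasFDerivAt.comp_hasDerivAt s ((hy s).inner ℂ (hy s))
    have h2 : (fun s => ‖y s‖ ^ 2) = Complex.reCLM ∘ fun t => ⟪y t, y t⟫_ℂ := by
      ext t
      simp [inner_self_eq_norm_sq_to_K, ← Complex.ofReal_pow]
    rw [h2]
    convert! h1 using 1
    have h3 : (⟪X (y s), y s⟫_ℂ).re = (⟪y s, X (y s)⟫_ℂ).re := inner_re_symm (𝕜 := ℂ) _ _
    simp [h3]
    ring
  let q : ℝ → ℝ := fun s => Real.exp (-(2 * K) * s) * ‖y s‖ ^ 2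
  have hq : ∀ s, HasDerivAt q (Real.exp (-(2 * K) * s) *
      (2 * (⟪y s, X (y s)⟫_ℂ).re - 2 * K * ‖y s‖ ^ 2)) s := by
    intro s
    have h1 := (((hasDerivAt_id s).const_mul (-(2 * K))).exp).mul (hn s)
    convert! h1 using 1
    simp
    ring
  have hanti : Antitone q := by
    refine antitone_of_deriv_nonpos (fun s => (hq s).differentiableAt) fun s => ?_
    rw [(hq s).deriv]
    have := h (y s)
    exact mul_nonpos_of_nonneg_of_nonpos (Real.exp_pos _).le (by linarith)
  have h01 : q 1 ≤ q 0 := hanti zero_le_one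
  simp only [q, y, mul_one, mul_zero, Real.exp_zero, one_smul, zero_smul, exp_zero, one_mul,
    one_apply_eq_self] at h01
  have h2 : ‖exp X v‖ ^ 2 ≤ (Real.exp K * ‖v‖) ^ 2 := by
    rw [mul_pow, ← Real.exp_nat_mul]
    rw [Real.exp_neg, inv_mul_le_iff₀ (Real.exp_pos _)] at h01
    exact_mod_cast h01
  exact le_of_sq_le_sq h2 (by positivity)

theorem contDiff_exp_clm {N : WithTop ℕ∞} : ContDiff ℂ N (exp : (H →L[ℂ] H) → H →L[ℂ] H) :=
  contDiff_iff_contDiffAt.2 fun X => (exp_analytic (𝕂 := ℂ) X).contDiffAt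

/-- Cauchy's estimate for z ↦ F(X + zY) on the circle of radius 1/‖Y‖: there the perturbation has
norm one, so it raises the bound on the Hermitian part by at most one and costs a factor e. -/
theorem norm_fderiv_le_of_growth {W : Type*} [NormedAddCommGroup W] [NormedSpace ℂ W]
    {F : (H →L[ℂ] H) → W} {c : ℝ} (hc : 0 ≤ c) (hF : Differentiable ℂ F)
    (hb : ∀ K X, HermitianPartLE K X → ‖F X‖ ≤ c * Real.exp K) {K : ℝ} {X : H →L[ℂ] H}
    (hX : HermitianPartLE K X) : ‖fderiv ℂ F X‖ ≤ c * Real.exp 1 * Real.exp K := by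
  refine ContinuousLinearMap.opNorm_le_bound _ (by positivity) fun Y => ?_
  rcases eq_or_ne Y 0 with rfl | hY
  · simp
  have hY0 : 0 < ‖Y‖ := norm_pos_iff.2 hY
  let f : ℂ → W := fun z => F (X + z • Y)
  have hline : ∀ z : ℂ, HasDerivAt (fun z : ℂ => X + z • Y) Y z := by
    intro z
    simpa using ((hasDerivAt_id z).smul_const Y).const_add X
  have hf : ∀ z, HasDerivAt f (fderiv ℂ F (X + z • Y) Y) z := fun z =>
    (hF (X + z • Y)).hasFDerivAt.comp_hasDerivAt z (hline z)
  have h0 : deriv f 0 = fderiv ℂ F X Y := by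
    rw [(hf 0).deriv, zero_smul, add_zero]
  have hd : Differentiable ℂ f := fun z => (hf z).differentiableAt
  rw [← h0]
  have := Complex.norm_deriv_le_of_forall_mem_sphere_norm_le (c := 0) (R := ‖Y‖⁻¹)
    (C := c * Real.exp (K + 1)) (inv_pos.2 hY0) hd.diffContOnCl fun z hz => by
      refine hb _ _ ?_
      have hzn : ‖z • Y‖ = 1 := by
        rw [norm_smul, mem_sphere_zero_iff_norm.1 hz, inv_mul_cancel₀ hY0.ne']
      simpa [hzn] using hX.add_norm (z • Y)
  refine this.trans_eq ?_
  rw [div_inv_eq_mul, Real.exp_add]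
  ring

/-- The complex derivative of F satisfies the same growth hypothesis with c replaced by ce, so one
inducts on l with the target space varying. The iterated derivatives are real because the symbols
depend on a real frequency. -/
theorem norm_iteratedFDeriv_le_of_growth (l : ℕ) : ∀ {W : Type} [NormedAddCommGroup W]
    [NormedSpace ℂ W] {F : (H →L[ℂ] H) → W} {c : ℝ}, 0 ≤ c → ContDiff ℂ (⊤ : ℕ∞) F →
    (∀ K X, HermitianPartLE K X → ‖F X‖ ≤ c * Real.exp K) → ∀ K X, HermitianPartLE K X →
    ‖iteratedFDeriv ℝ l F X‖ ≤ c * Real.exp 1 ^ l * Real.exp K := by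
  induction l with
  | zero =>
    intro W _ _ F c hc hF hb K X hX
    simpa using hb K X hX
  | succ l ih =>
    intro W _ _ F c hc hF hb K X hX
    have hd : Differentiable ℂ F := hF.differentiable (by simp)
    have h1 : fderiv ℝ F = (ContinuousLinearMap.restrictScalarsIsometry ℂ (H →L[ℂ] H) W ℝ ℝ) ∘
        fderiv ℂ F := by
      ext1 Y
      exact ((hd Y).hasFDerivAt.restrictScalars ℝ).fderiv
    have hF' : ContDiff ℂ (⊤ : ℕ∞) (fderiv ℂ F) := hF.fderiv_right (by simp)
    rw [← norm_iteratedFDeriv_fderiv, h1, LinearIsometry.norm_iteratedFDeriv_comp_left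
      (n := (⊤ : ℕ∞)) _ (hF'.restrict_scalars ℝ).contDiffAt (by exact_mod_cast le_top)]
    refine (ih (by positivity) hF'
      (fun K X hX => norm_fderiv_le_of_growth hc hd hb hX) K X hX).trans_eq ?_
    ring

/-- The operators with vanishing Hermitian part. -/
def IsSkew (X : H →L[ℂ] H) : Prop := ∀ v, (⟪v, X v⟫_ℂ).re = 0

theorem IsSkew.hermitianPartLE {X : H →L[ℂ] H} (h : IsSkew X) : HermitianPartLE 0 X := by
  intro v
  rw [h v, zero_mul]

theorem IsSkew.real_smul {X : H →L[ℂ] H} (h : IsSkew X) (t : ℝ) : IsSkew (t • X) := by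
  intro v
  have : (t • X) v = (t : ℂ) • X v := by simp
  rw [this, inner_smul_right, Complex.re_ofReal_mul, h v, mul_zero]

theorem IsSkew.add {X Y : H →L[ℂ] H} (hX : IsSkew X) (hY : IsSkew Y) : IsSkew (X + Y) := by
  intro v
  rw [add_apply, inner_add_right, Complex.add_re, hX v, hY v, add_zero]

theorem isSkew_zero : IsSkew (0 : H →L[ℂ] H) := by
  intro v
  simp

theorem norm_iteratedFDeriv_exp_le (l : ℕ) {X : H →L[ℂ] H} (hX : IsSkew X) :
    ‖iteratedFDeriv ℝ l exp X‖ ≤ Real.exp 1 ^ l := by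
  have := norm_iteratedFDeriv_le_of_growth l (F := (exp : (H →L[ℂ] H) → _)) zero_le_one
    contDiff_exp_clm (fun K X h => by simpa using norm_exp_le_of_hermitianPartLE h) 0 X
    hX.hermitianPartLE
  simpa using this

/-- The second-order Taylor remainder of the exponential at the origin. -/
def expRem (X : H →L[ℂ] H) : H →L[ℂ] H := exp X - 1 - X

theorem contDiff_exp_real {N : WithTop ℕ∞} : ContDiff ℝ N (exp : (H →L[ℂ] H) → H →L[ℂ] H) :=
  contDiff_exp_clm.restrict_scalars ℝ

theorem contDiff_expRem {N : WithTop ℕ∞} : ContDiff ℝ N (expRem : (H →L[ℂ] H) → H →L[ℂ] H) :=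
  (contDiff_exp_real.sub contDiff_const).sub contDiff_id

theorem hasFDerivAt_expRem (X : H →L[ℂ] H) :
    HasFDerivAt expRem (fderiv ℝ exp X - ContinuousLinearMap.id ℝ (H →L[ℂ] H)) X :=
  ((contDiff_exp_real (N := 1).differentiable (by simp) X).hasFDerivAt.sub_const 1).sub
    (hasFDerivAt_id X)

theorem convex_isSkew_inter_ball (r : ℝ) :
    Convex ℝ {Y : H →L[ℂ] H | IsSkew Y ∧ ‖Y‖ ≤ r} := by
  rintro Y ⟨hY, hY'⟩ Z ⟨hZ, hZ'⟩ a b ha hb hab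
  refine ⟨(hY.real_smul a).add (hZ.real_smul b), ?_⟩
  calc ‖a • Y + b • Z‖ ≤ a * ‖Y‖ + b * ‖Z‖ := by
        refine (norm_add_le _ _).trans_eq ?_
        rw [norm_smul, norm_smul, Real.norm_of_nonneg ha, Real.norm_of_nonneg hb]
    _ ≤ a * r + b * r := by gcongr
    _ = r := by rw [← add_mul, hab, one_mul]

/-- The derivative of the exponential is the identity at 0, and its second derivative is at most e²
at skew operators. The mean value inequality is used on a convex set of skew operators, where that
bound is valid. -/
theorem norm_fderiv_expRem_le {X : H →L[ℂ] H} (hX : IsSkew X) :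
    ‖fderiv ℝ expRem X‖ ≤ Real.exp 1 ^ 2 * ‖X‖ := by
  have hexp1 : ContDiff ℝ 1 (fderiv ℝ (exp : (H →L[ℂ] H) → _)) :=
    (contDiff_exp_real (N := 2)).fderiv_right (by norm_num)
  have h1 := (convex_isSkew_inter_ball (H := H) ‖X‖).norm_image_sub_le_of_norm_fderiv_le (𝕜 := ℝ)
    (f := fderiv ℝ exp) (C := Real.exp 1 ^ 2) (x := 0) (y := X)
    (fun Y _ => hexp1.differentiable (by simp) Y)
    (fun Y hY => by
      rw [← norm_iteratedFDeriv_one, norm_iteratedFDeriv_fderiv]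
      exact norm_iteratedFDeriv_exp_le 2 hY.1)
    ⟨isSkew_zero, by simp⟩ ⟨hX, le_rfl⟩
  have h0 : fderiv ℝ exp (0 : H →L[ℂ] H) = ContinuousLinearMap.id ℝ (H →L[ℂ] H) :=
    (hasFDerivAt_exp_zero (𝕂 := ℝ)).fderiv
  rw [h0, sub_zero] at h1
  rw [(hasFDerivAt_expRem X).fderiv]
  exact h1

theorem norm_expRem_le {X : H →L[ℂ] H} (hX : IsSkew X) :
    ‖expRem X‖ ≤ Real.exp 1 ^ 2 * ‖X‖ ^ 2 := by
  have h1 := (convex_isSkew_inter_ball (H := H) ‖X‖).norm_image_sub_le_of_norm_fderiv_le (𝕜 := ℝ)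
    (f := expRem) (C := Real.exp 1 ^ 2 * ‖X‖) (x := 0) (y := X)
    (fun Y _ => (hasFDerivAt_expRem Y).differentiableAt)
    (fun Y hY => (norm_fderiv_expRem_le hY.1).trans (by gcongr; exact hY.2))
    ⟨isSkew_zero, by simp⟩ ⟨hX, le_rfl⟩
  have h0 : expRem (0 : H →L[ℂ] H) = 0 := by simp [expRem]
  rw [h0, sub_zero, sub_zero] at h1
  linarith

/-- The exponent `2 - l` is truncated: the remainder is quadratic, its derivative linear, and from
order two on its derivatives are those of the exponential. -/
theorem norm_iteratedFDeriv_expRem_le (l : ℕ) {X : H →L[ℂ] H} (hX : IsSkew X) :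
    ‖iteratedFDeriv ℝ l expRem X‖ ≤ Real.exp 1 ^ (l + 2) * ‖X‖ ^ (2 - l) := by
  have he : 1 ≤ Real.exp 1 := Real.one_le_exp zero_le_one
  match l with
  | 0 => simpa using norm_expRem_le hX
  | 1 =>
    rw [norm_iteratedFDeriv_one]
    refine (norm_fderiv_expRem_le hX).trans ?_
    simp only [Nat.add_one_sub_one, pow_one]
    gcongr
    norm_num
  | l + 2 =>
    have h1 : fderiv ℝ (expRem : (H →L[ℂ] H) → _) = fun X => fderiv ℝ exp X -
        ContinuousLinearMap.id ℝ (H →L[ℂ] H) := funext fun X => (hasFDerivAt_expRem X).fderiv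
    have h2 : fderiv ℝ (fderiv ℝ (expRem : (H →L[ℂ] H) → _)) = fderiv ℝ (fderiv ℝ exp) := by
      rw [h1]
      ext1 X
      exact fderiv_sub_const _
    rw [← norm_iteratedFDeriv_fderiv, ← norm_iteratedFDeriv_fderiv, h2,
      norm_iteratedFDeriv_fderiv, norm_iteratedFDeriv_fderiv]
    refine (norm_iteratedFDeriv_exp_le (l + 2) hX).trans ?_
    simp only [Nat.sub_eq_zero_of_le (Nat.le_add_left 2 l), pow_zero, mul_one]
    gcongr
    omega

end Exponential


/-! ### Multiplication by functions of polynomial growth -/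

section Bilinear

variable {𝕜 D E F G : Type*} [RCLike 𝕜] [NormedAddCommGroup D] [NormedSpace ℝ D]
  [NormedAddCommGroup E] [NormedSpace ℝ E] [NormedSpace 𝕜 E]
  [NormedAddCommGroup F] [NormedSpace ℝ F] [NormedSpace 𝕜 F]
  [NormedAddCommGroup G] [NormedSpace ℝ G] [NormedSpace 𝕜 G]

/-- The seminorms of `B (f, g)` with `f` a Schwartz function and `g` of polynomial growth. -/
theorem seminorm_bilinLeftCLM_le (B : E →L[𝕜] F →L[𝕜] G) {g : D → F} (hg : g.HasTemperateGrowth)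
    (k l a : ℕ) {A : ℝ} (hA : 0 ≤ A)
    (hb : ∀ j ≤ l, ∀ x, ‖iteratedFDeriv ℝ j g x‖ ≤ A * (1 + ‖x‖) ^ a) (f : 𝓢(D, E)) :
    SchwartzMap.seminorm 𝕜 k l (bilinLeftCLM B hg f) ≤
      ‖B‖ * ((l : ℝ) + 1) * l.choose (l / 2) * (A * 2 ^ (a + k)) *
        (Finset.Iic (a + k, l)).sup (fun m => SchwartzMap.seminorm 𝕜 m.1 m.2) f := by
  refine SchwartzMap.seminorm_le_bound 𝕜 k l _ (by positivity) fun x => ?_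
  have hxk : 0 ≤ ‖x‖ ^ k := by positivity
  rw [bilinLeftCLM_apply]
  simp_rw [← ContinuousLinearMap.bilinearRestrictScalars_apply_apply ℝ B]
  have hnorm_mul :=
    ContinuousLinearMap.norm_iteratedFDeriv_le_of_bilinear (B.bilinearRestrictScalars ℝ)
    (f.smooth ⊤) hg.1 x (n := l) (mod_cast le_top)
  grw [hnorm_mul]
  rw [ContinuousLinearMap.norm_bilinearRestrictScalars]
  move_mul [‖B‖, ‖B‖]
  gcongr ?_ * _
  rw [Finset.mul_sum]
  have : (∑ _x ∈ Finset.range (l + 1), (1 : ℝ)) = l + 1 := by simp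
  simp_rw [mul_assoc ((l : ℝ) + 1)]
  rw [← this, Finset.sum_mul]
  refine Finset.sum_le_sum fun i hi => ?_
  simp only [one_mul]
  move_mul [(Nat.choose l i : ℝ), (Nat.choose l (l / 2) : ℝ)]
  gcongr ?_ * ?_
  swap
  · norm_cast
    exact i.choose_le_middle l
  specialize hb (l - i) (by simp only [tsub_le_self]) x
  grw [hb]
  move_mul [A]
  gcongr ?_ * A
  rw [Finset.mem_range_succ_iff] at hi
  change i ≤ (a + k, l).snd at hi
  refine le_trans ?_ (one_add_le_sup_seminorm_apply (𝕜 := 𝕜) le_rfl hi f x)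
  rw [pow_add]
  move_mul [(1 + ‖x‖) ^ a]
  gcongr
  simp

theorem norm_iteratedFDeriv_comp_affine_le {f : F → G} (hf : ContDiff ℝ (⊤ : ℕ∞) f) (c : F)
    (Λ : D →L[ℝ] F) (l : ℕ) (x : D) :
    ‖iteratedFDeriv ℝ l (fun y => f (c + Λ y)) x‖ ≤
      ‖iteratedFDeriv ℝ l f (c + Λ x)‖ * ‖Λ‖ ^ l := by
  have hf' : ContDiff ℝ (⊤ : ℕ∞) (fun w => f (c + w)) := hf.comp (contDiff_const.add contDiff_id)
  have h1 := ContinuousLinearMap.iteratedFDeriv_comp_right Λ hf' x (i := l) (mod_cast le_top)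
  change ‖iteratedFDeriv ℝ l ((fun w => f (c + w)) ∘ Λ) x‖ ≤ _
  rw [h1, iteratedFDeriv_comp_add_left]
  refine (ContinuousMultilinearMap.norm_compContinuousLinearMap_le _ _).trans ?_
  simp

end Bilinear

/-! ### The propagator of a skew symbol -/

section Propagator

set_option linter.unusedSectionVars false

variable {E H : Type} [NormedAddCommGroup E] [NormedSpace ℝ E]
  [NormedAddCommGroup H] [InnerProductSpace ℂ H] [CompleteSpace H]

open NormedSpace

/-- The affine symbol `ξ ↦ c + Λ ξ`. -/
def symb (c : H →L[ℂ] H) (Λ : E →L[ℝ] H →L[ℂ] H) (ξ : E) : H →L[ℂ] H := c + Λ ξ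

/-- The symbol of the propagator. -/
def propag (c : H →L[ℂ] H) (Λ : E →L[ℝ] H →L[ℂ] H) (t : ℝ) (ξ : E) : H →L[ℂ] H :=
  exp (t • symb c Λ ξ)

variable {c : H →L[ℂ] H} {Λ : E →L[ℝ] H →L[ℂ] H}

theorem smul_symb (t : ℝ) (ξ : E) : t • symb c Λ ξ = t • c + (t • Λ) ξ := by
  simp [symb, smul_add]

theorem hasTemperateGrowth_symb : (symb c Λ).HasTemperateGrowth :=
  (Function.HasTemperateGrowth.const c).add Λ.hasTemperateGrowth

/-- Each derivative costs a factor e from Cauchy's estimate and a factor |t|‖Λ‖ from the chain rule.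
Skewness prevents any growth in ξ. All time dependence of the final estimates comes from here. -/
theorem norm_iteratedFDeriv_propag_le (hL : ∀ ξ, IsSkew (symb c Λ ξ)) (t : ℝ) (l : ℕ) (ξ : E) :
    ‖iteratedFDeriv ℝ l (propag c Λ t) ξ‖ ≤ (Real.exp 1 * (|t| * ‖Λ‖)) ^ l := by
  have h := norm_iteratedFDeriv_comp_affine_le (contDiff_exp_real (H := H)) (t • c) (t • Λ) l ξ
  have h2 : propag c Λ t = fun y => exp (t • c + (t • Λ) y) := by
    funext y; rw [propag, smul_symb]
  rw [h2]
  refine h.trans ?_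
  rw [norm_smul, Real.norm_eq_abs, mul_pow (Real.exp 1)]
  gcongr
  refine norm_iteratedFDeriv_exp_le l ?_
  rw [← smul_symb]
  exact (hL ξ).real_smul t

theorem hasTemperateGrowth_propag (hL : ∀ ξ, IsSkew (symb c Λ ξ)) (t : ℝ) :
    (propag c Λ t).HasTemperateGrowth := by
  refine ⟨?_, fun l => ⟨0, (Real.exp 1 * (|t| * ‖Λ‖)) ^ l, fun ξ => ?_⟩⟩
  · exact contDiff_exp_real.comp ((contDiff_const.add Λ.contDiff).const_smul t)
  · simpa using norm_iteratedFDeriv_propag_le hL t l ξ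

/-- The gain h² is paid for by quadratic growth in ξ, which is harmless against Schwartz functions;
this gives differentiability of the propagator in time. -/
theorem norm_iteratedFDeriv_expRem_symb_le (hL : ∀ ξ, IsSkew (symb c Λ ξ)) {h : ℝ} (hh : |h| ≤ 1)
    (l : ℕ) (ξ : E) :
    ‖iteratedFDeriv ℝ l (fun ξ => expRem (h • symb c Λ ξ)) ξ‖ ≤
      Real.exp 1 ^ (l + 2) * (1 + ‖c‖ + ‖Λ‖) ^ (l + 2) * h ^ 2 * (1 + ‖ξ‖) ^ 2 := by
  have h1 := norm_iteratedFDeriv_comp_affine_le (contDiff_expRem (H := H)) (h • c) (h • Λ) l ξ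
  have h2 : (fun ξ => expRem (h • symb c Λ ξ)) = fun y => expRem (h • c + (h • Λ) y) := by
    funext y; rw [smul_symb]
  rw [h2]
  refine h1.trans ?_
  rw [← smul_symb]
  have h3 := norm_iteratedFDeriv_expRem_le l ((hL ξ).real_smul h)
  set B := 1 + ‖c‖ + ‖Λ‖ with hB
  have hB1 : 1 ≤ B := by rw [hB]; linarith [norm_nonneg c, norm_nonneg Λ]
  have h4 : ‖h • symb c Λ ξ‖ ≤ |h| * (B * (1 + ‖ξ‖)) := by
    rw [norm_smul, Real.norm_eq_abs]
    gcongr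
    calc ‖symb c Λ ξ‖ ≤ ‖c‖ + ‖Λ‖ * ‖ξ‖ := (norm_add_le _ _).trans (by gcongr; exact Λ.le_opNorm ξ)
      _ ≤ B * (1 + ‖ξ‖) := by
        rw [hB]; nlinarith [norm_nonneg c, norm_nonneg Λ, norm_nonneg ξ,
          mul_nonneg (norm_nonneg c) (norm_nonneg ξ)]
  have h5 : ‖h • Λ‖ ≤ |h| * B := by
    rw [norm_smul, Real.norm_eq_abs]
    gcongr
    rw [hB]; linarith [norm_nonneg c]
  calc _ ≤ Real.exp 1 ^ (l + 2) * (|h| * (B * (1 + ‖ξ‖))) ^ (2 - l) * (|h| * B) ^ l := by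
        gcongr
        exact h3.trans (by gcongr)
    _ = Real.exp 1 ^ (l + 2) * (B ^ (2 - l + l) * |h| ^ (2 - l + l) * (1 + ‖ξ‖) ^ (2 - l)) := by
        rw [pow_add B, pow_add |h|, mul_pow |h|, mul_pow B, mul_pow |h|]; ring
    _ ≤ Real.exp 1 ^ (l + 2) * (B ^ (l + 2) * |h| ^ 2 * (1 + ‖ξ‖) ^ 2) := by
        -- With truncated subtraction `2 - l + l` is the maximum of 2 and l, so |h| ≤ 1 always
        -- leaves at least two powers of h.
        have : |h| ^ (2 - l + l) ≤ |h| ^ 2 := pow_le_pow_of_le_one (abs_nonneg h) hh (by omega)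
        have hB2 : B ^ (2 - l + l) ≤ B ^ (l + 2) := pow_le_pow_right₀ hB1 (by omega)
        have hξ : (1 + ‖ξ‖) ^ (2 - l) ≤ (1 + ‖ξ‖) ^ 2 :=
          pow_le_pow_right₀ (by linarith [norm_nonneg ξ]) (by omega)
        gcongr
    _ = _ := by rw [sq_abs]; ring

theorem hasTemperateGrowth_expRem_symb (hL : ∀ ξ, IsSkew (symb c Λ ξ)) (h : ℝ) :
    (fun ξ => expRem (h • symb c Λ ξ)).HasTemperateGrowth := by
  have h1 := ((hasTemperateGrowth_propag hL h).sub (Function.HasTemperateGrowth.const 1)).sub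
    ((Function.HasTemperateGrowth.const h).smul (hasTemperateGrowth_symb (c := c) (Λ := Λ)))
  exact h1

/-- Multiplication of an `H`-valued Schwartz function by an operator-valued function. -/
def opMul {g : E → H →L[ℂ] H} (hg : g.HasTemperateGrowth) : 𝓢(E, H) →L[ℂ] 𝓢(E, H) :=
  bilinLeftCLM (ContinuousLinearMap.apply ℂ H) hg

@[simp]
theorem opMul_apply {g : E → H →L[ℂ] H} (hg : g.HasTemperateGrowth) (Φ : 𝓢(E, H)) (ξ : E) :
    opMul hg Φ ξ = g ξ (Φ ξ) := rfl

theorem propag_add (s t : ℝ) (ξ : E) : propag c Λ (s + t) ξ = propag c Λ s ξ * propag c Λ t ξ := by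
  let _ : NormedAlgebra ℚ (H →L[ℂ] H) := NormedAlgebra.restrictScalars ℚ ℂ (H →L[ℂ] H)
  rw [propag, propag, propag, add_smul]
  exact exp_add_of_commute (((Commute.refl _).smul_left s).smul_right t)

theorem propag_zero (ξ : E) : propag c Λ 0 ξ = 1 := by
  simp [propag]

/-- By the group law the increment from t to t + h is e^{hL} - 1 applied to e^{tL}Φ, so its error to
first order is exactly `expRem` of hL. -/
theorem opMul_propag_add_sub (hL : ∀ ξ, IsSkew (symb c Λ ξ)) (t h : ℝ) (Φ : 𝓢(E, H)) :
    opMul (hasTemperateGrowth_propag hL (t + h)) Φ - opMul (hasTemperateGrowth_propag hL t) Φ -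
      h • opMul (hasTemperateGrowth_symb (c := c) (Λ := Λ))
        (opMul (hasTemperateGrowth_propag hL t) Φ) =
      opMul (hasTemperateGrowth_expRem_symb hL h) (opMul (hasTemperateGrowth_propag hL t) Φ) := by
  ext ξ
  have : propag c Λ (t + h) ξ = propag c Λ h ξ * propag c Λ t ξ := by rw [add_comm, propag_add]
  simp only [sub_apply, smul_apply, opMul_apply, this, expRem, mul_apply_eq_comp,
    one_apply_eq_self]
  simp [propag]

/-- The remainder is O(h²) in every Schwartz seminorm, so the propagator is differentiable in the
topology of the test functions and not merely pointwise in ξ. -/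
theorem tendsto_inv_smul_expRem (hL : ∀ ξ, IsSkew (symb c Λ ξ)) (Φ : 𝓢(E, H)) :
    Filter.Tendsto (fun h : ℝ => h⁻¹ • opMul (hasTemperateGrowth_expRem_symb hL h) Φ)
      (nhds 0) (nhds 0) := by
  rw [(schwartz_withSeminorms ℝ E H).tendsto_nhds]
  rintro ⟨k, l⟩ ε hε
  set A := Real.exp 1 ^ (l + 2) * (1 + ‖c‖ + ‖Λ‖) ^ (l + 2) with hA
  have hA0 : 0 ≤ A := by positivity
  have he : 1 ≤ Real.exp 1 := Real.one_le_exp zero_le_one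
  set M := ‖ContinuousLinearMap.apply ℂ H (E := H)‖ * ((l : ℝ) + 1) * l.choose (l / 2) *
    (A * 2 ^ (2 + k)) * (Finset.Iic (2 + k, l)).sup (fun m => SchwartzMap.seminorm ℂ m.1 m.2) Φ
    with hM
  have hM0 : 0 ≤ M := by positivity
  have key : ∀ h : ℝ, |h| ≤ 1 → SchwartzMap.seminorm ℝ k l
      (h⁻¹ • opMul (hasTemperateGrowth_expRem_symb hL h) Φ) ≤ M * |h| := by
    intro h hh
    rw [map_smul_eq_mul]
    have h1 := seminorm_bilinLeftCLM_le (ContinuousLinearMap.apply ℂ H)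
      (hasTemperateGrowth_expRem_symb hL h) k l 2 (A := A * h ^ 2) (by positivity)
      (fun j hj ξ => (norm_iteratedFDeriv_expRem_symb_le hL hh j ξ).trans (by
        rw [hA]
        have : 1 ≤ 1 + ‖c‖ + ‖Λ‖ := by linarith [norm_nonneg c, norm_nonneg Λ]
        gcongr)) Φ
    have h2 : SchwartzMap.seminorm ℝ k l (opMul (hasTemperateGrowth_expRem_symb hL h) Φ) ≤
        M * h ^ 2 := by
      refine (le_of_eq_of_le ?_ h1).trans (le_of_eq ?_)
      · rfl
      · rw [hM]; ring
    calc ‖h⁻¹‖ * _ ≤ ‖h⁻¹‖ * (M * h ^ 2) := by gcongr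
      _ = M * |h| := by
        rw [norm_inv, Real.norm_eq_abs, ← sq_abs h]
        -- Since `0⁻¹ = 0`, the bound holds also at h = 0 and the limit may be taken over a full
        -- neighbourhood.
        rcases eq_or_ne h 0 with rfl | h0
        · simp
        · have : |h| ≠ 0 := abs_ne_zero.2 h0
          field_simp
  have hball : ∀ᶠ h : ℝ in nhds 0, |h| < min 1 (ε / (M + 1)) := by
    have := Metric.ball_mem_nhds (0 : ℝ) (ε := min 1 (ε / (M + 1))) (by positivity)
    filter_upwards [this] with h hh
    simpa using hh
  filter_upwards [hball] with h hh
  rw [sub_zero]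
  refine (key h (hh.le.trans (min_le_left _ _))).trans_lt ?_
  have h3 : |h| < ε / (M + 1) := hh.trans_le (min_le_right _ _)
  rw [lt_div_iff₀ (by positivity)] at h3
  nlinarith [abs_nonneg h]

end Propagator


/-! ### Uniqueness and existence for the evolution equation -/

section Evolution

variable {E H : Type} [NormedAddCommGroup E] [NormedSpace ℝ E]
  [NormedAddCommGroup H] [InnerProductSpace ℂ H] [CompleteSpace H]
  {c : H →L[ℂ] H} {Λ : E →L[ℝ] H →L[ℂ] H}

open Filter Topology

theorem opMul_propag_add (hL : ∀ ξ, IsSkew (symb c Λ ξ)) (t h : ℝ) (Φ : 𝓢(E, H)) :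
    opMul (hasTemperateGrowth_propag hL (t + h)) Φ = opMul (hasTemperateGrowth_propag hL t) Φ +
      h • opMul (hasTemperateGrowth_symb (c := c) (Λ := Λ))
        (opMul (hasTemperateGrowth_propag hL t) Φ) +
      opMul (hasTemperateGrowth_expRem_symb hL h) (opMul (hasTemperateGrowth_propag hL t) Φ) := by
  rw [← opMul_propag_add_sub hL t h Φ]
  abel

theorem opMul_propag_zero (hL : ∀ ξ, IsSkew (symb c Λ ξ)) (Φ : 𝓢(E, H)) :
    opMul (hasTemperateGrowth_propag hL 0) Φ = Φ := by
  ext ξ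
  simp [propag_zero]

theorem hasDerivAt_apply_opMul_propag (hL : ∀ ξ, IsSkew (symb c Λ ξ)) (G : 𝓢(E, H) →L[ℂ] ℂ)
    (Φ : 𝓢(E, H)) (t : ℝ) :
    HasDerivAt (fun t => G (opMul (hasTemperateGrowth_propag hL t) Φ))
      (G (opMul (hasTemperateGrowth_symb (c := c) (Λ := Λ))
        (opMul (hasTemperateGrowth_propag hL t) Φ))) t := by
  rw [hasDerivAt_iff_tendsto_slope_zero]
  set Ψ := opMul (hasTemperateGrowth_propag hL t) Φ with hΨ
  have h1 : Tendsto (fun h : ℝ => G (opMul (hasTemperateGrowth_symb (c := c) (Λ := Λ)) Ψ) +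
      G (h⁻¹ • opMul (hasTemperateGrowth_expRem_symb hL h) Ψ)) (𝓝[≠] 0)
      (𝓝 (G (opMul (hasTemperateGrowth_symb (c := c) (Λ := Λ)) Ψ))) := by
    have := (G.continuous.tendsto 0).comp (tendsto_inv_smul_expRem hL Ψ)
    rw [map_zero] at this
    simpa using (this.mono_left nhdsWithin_le_nhds).const_add
      (G (opMul (hasTemperateGrowth_symb (c := c) (Λ := Λ)) Ψ))
  refine h1.congr' ?_
  filter_upwards [self_mem_nhdsWithin] with h hh
  have hh' : h ≠ 0 := hh
  rw [opMul_propag_add hL, ← hΨ, map_add, map_add, ContinuousLinearMap.map_smul_of_tower, ContinuousLinearMap.map_smul_of_tower]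
  rw [add_assoc, add_sub_cancel_left, smul_add, smul_smul, inv_mul_cancel₀ hh', one_smul]

/-- A weakly differentiable solution of `∂ₜ F = Lᵗ F` is given by the propagator. -/
theorem eq_apply_opMul_propag (hL : ∀ ξ, IsSkew (symb c Λ ξ)) (F : ℝ → 𝓢(E, H) →L[ℂ] ℂ)
    (hF : ∀ Φ t, HasDerivAt (fun t => F t Φ) (F t (opMul (hasTemperateGrowth_symb (c := c)
      (Λ := Λ)) Φ)) t) (t : ℝ) (Φ : 𝓢(E, H)) :
    F t Φ = F 0 (opMul (hasTemperateGrowth_propag hL t) Φ) := by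
  -- Duhamel by duality: the test function is propagated by e^{(t-s)L}, so w interpolates between F
  -- 0 of e^{tL}Φ at s = 0 and F t of Φ at s = t.
  set w : ℝ → ℂ := fun s => F s (opMul (hasTemperateGrowth_propag hL (t - s)) Φ) with hw
  have hder : ∀ s, HasDerivAt w 0 s := by
    intro s
    rw [hasDerivAt_iff_tendsto_slope_zero]
    set Ψ := opMul (hasTemperateGrowth_propag hL (t - s)) Φ with hΨ
    set LΨ := opMul (hasTemperateGrowth_symb (c := c) (Λ := Λ)) Ψ with hLΨ
    have h1 := hasDerivAt_iff_tendsto_slope_zero.1 (hF Ψ s)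
    have h2 : Tendsto (fun h : ℝ => F (s + h) LΨ) (𝓝[≠] 0) (𝓝 (F s LΨ)) := by
      have h3 : Tendsto (fun h : ℝ => s + h) (𝓝 0) (𝓝 s) := by
        have : Continuous fun h : ℝ => s + h := by fun_prop
        simpa using this.tendsto 0
      exact ((hF LΨ s).continuousAt.tendsto.comp h3).mono_left nhdsWithin_le_nhds
    have h3 : Tendsto (fun h : ℝ => F (s + h)
        ((-h)⁻¹ • opMul (hasTemperateGrowth_expRem_symb hL (-h)) Ψ)) (𝓝[≠] 0) (𝓝 0) := by
      rw [Metric.tendsto_nhds]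
      intro ε hε
      -- The functional F (s + h) varies together with its argument. Each s ↦ F s φ is continuous,
      -- hence bounded on a compact time interval, so uniform boundedness supplies the required
      -- equicontinuity.
      have hbs := eventually_forall_norm_lt_of_pointwise_bounded
        (fun i : Set.Icc (s - 1) (s + 1) => (F i).restrictScalars ℝ) (fun φ => by
          have hc : ContinuousOn (fun t => F t φ) (Set.Icc (s - 1) (s + 1)) :=
            fun x _ => (hF φ x).continuousAt.continuousWithinAt
          obtain ⟨C, hC⟩ := isCompact_Icc.exists_bound_of_continuousOn hc
          exact ⟨C, fun i => hC i i.2⟩) hε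
      have hneg : Tendsto (fun h : ℝ => -h) (𝓝 0) (𝓝 0) := by
        simpa using (continuous_neg (G := ℝ)).tendsto 0
      have h4 := ((tendsto_inv_smul_expRem hL Ψ).comp hneg).eventually hbs
      have h5 : ∀ᶠ h : ℝ in 𝓝 0, |h| < 1 := by
        filter_upwards [Metric.ball_mem_nhds (0 : ℝ) one_pos] with h hh
        simpa using hh
      refine nhdsWithin_le_nhds ?_
      filter_upwards [h4, h5] with h h4 h5
      rw [dist_zero_right]
      have := abs_lt.1 h5
      exact h4 ⟨s + h, by constructor <;> linarith [this.1, this.2]⟩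
    have h4 := (h1.sub h2).sub h3
    rw [sub_self, sub_zero] at h4
    refine h4.congr' ?_
    filter_upwards [self_mem_nhdsWithin] with h hh
    have hh' : h ≠ 0 := hh
    have h5 : t - (s + h) = (t - s) + -h := by ring
    simp only [hw]
    rw [h5, opMul_propag_add hL, ← hΨ, ← hLΨ, map_add, map_add, ContinuousLinearMap.map_smul_of_tower, ContinuousLinearMap.map_smul_of_tower]
    rw [inv_neg, neg_smul, neg_smul, sub_neg_eq_add]
    have h6 : h⁻¹ • (h • F (s + h) LΨ) = F (s + h) LΨ := by
      rw [smul_smul, inv_mul_cancel₀ hh', one_smul]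
    simp only [smul_add, smul_sub, smul_neg, h6]
    ring
  have h := is_const_of_deriv_eq_zero (fun s => (hder s).differentiableAt)
    (fun s => (hder s).deriv) t 0
  simp only [hw] at h
  have h7 : opMul (hasTemperateGrowth_propag hL (t - t)) Φ = Φ := by
    ext ξ; simp [propag_zero]
  rw [h7] at h
  simpa using h

end Evolution

/-! ### Vector-valued distributions and functionals on vector-valued functions -/

section Vector

variable {d n : ℕ}

/-- A temperate distribution as a continuous linear map. -/
def distCLM (f : 𝓢'(Rd d, Cn n)) : 𝓢(Rd d, ℂ) →L[ℂ] Cn n where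
  toFun := f
  map_add' := map_add f
  map_smul' := map_smul f
  cont := map_continuous f

@[simp]
theorem distCLM_apply (f : 𝓢'(Rd d, Cn n)) (φ : 𝓢(Rd d, ℂ)) : distCLM f φ = f φ := rfl

/-- The `j`-th coordinate of a vector-valued Schwartz function. -/
def coordCLM (j : Fin n) : 𝓢(Rd d, Cn n) →L[ℂ] 𝓢(Rd d, ℂ) :=
  postcompCLM (EuclideanSpace.proj j : Cn n →L[ℂ] ℂ)

/-- The Schwartz function `φ e_j`. -/
def singleCLM (j : Fin n) : 𝓢(Rd d, ℂ) →L[ℂ] 𝓢(Rd d, Cn n) :=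
  postcompCLM (ContinuousLinearMap.toSpanSingleton ℂ (EuclideanSpace.single j (1 : ℂ)))

@[simp]
theorem coordCLM_apply (j : Fin n) (Φ : 𝓢(Rd d, Cn n)) (x : Rd d) : coordCLM j Φ x = Φ x j := rfl

@[simp]
theorem singleCLM_apply (j : Fin n) (φ : 𝓢(Rd d, ℂ)) (x : Rd d) :
    singleCLM j φ x = φ x • EuclideanSpace.single j (1 : ℂ) := rfl

theorem coordCLM_singleCLM (i j : Fin n) (φ : 𝓢(Rd d, ℂ)) :
    coordCLM i (singleCLM j φ) = if i = j then φ else 0 := by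
  ext x
  by_cases h : i = j <;> simp [h]

/-- The scalar functional on `ℂ^n`-valued test functions defined by a `ℂ^n`-valued distribution. -/
def extend (f : 𝓢'(Rd d, Cn n)) : 𝓢(Rd d, Cn n) →L[ℂ] ℂ :=
  ∑ j, (EuclideanSpace.proj j : Cn n →L[ℂ] ℂ) ∘L distCLM f ∘L coordCLM j

theorem extend_apply (f : 𝓢'(Rd d, Cn n)) (Φ : 𝓢(Rd d, Cn n)) :
    extend f Φ = ∑ j, f (coordCLM j Φ) j := by
  simp [extend, sum_apply]

theorem extend_singleCLM (f : 𝓢'(Rd d, Cn n)) (j : Fin n) (φ : 𝓢(Rd d, ℂ)) :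
    extend f (singleCLM j φ) = f φ j := by
  rw [extend_apply, Finset.sum_eq_single j]
  · simp [coordCLM_singleCLM]
  · intro i _ hij
    simp [coordCLM_singleCLM, hij]
  · simp

theorem sum_extend_smul_single (f : 𝓢'(Rd d, Cn n)) (φ : 𝓢(Rd d, ℂ)) :
    ∑ j, extend f (singleCLM j φ) • EuclideanSpace.single j (1 : ℂ) = f φ := by
  ext i
  simp [extend_singleCLM, Pi.single_apply]

/-- The vector-valued distribution defined by a functional on `ℂ^n`-valued test functions. -/
def contract (G : 𝓢(Rd d, Cn n) →L[ℂ] ℂ) : 𝓢'(Rd d, Cn n) :=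
  ContinuousLinearMap.toPointwiseConvergenceCLM _ _ _ _
    (∑ j, ContinuousLinearMap.toSpanSingleton ℂ (EuclideanSpace.single j (1 : ℂ) : Cn n) ∘L
      G ∘L singleCLM j)

theorem contract_apply (G : 𝓢(Rd d, Cn n) →L[ℂ] ℂ) (φ : 𝓢(Rd d, ℂ)) (i : Fin n) :
    contract G φ i = G (singleCLM i φ) := by
  have h : contract G φ = (∑ j, ContinuousLinearMap.toSpanSingleton ℂ
      (EuclideanSpace.single j (1 : ℂ) : Cn n) ∘L G ∘L singleCLM j :
        𝓢(Rd d, ℂ) →L[ℂ] Cn n) φ := rfl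
  rw [h, sum_apply]
  simp [Pi.single_apply]

theorem sum_singleCLM_coordCLM (Φ : 𝓢(Rd d, Cn n)) : ∑ j, singleCLM j (coordCLM j Φ) = Φ := by
  ext x i
  simp [Pi.single_apply]

theorem extend_contract (G : 𝓢(Rd d, Cn n) →L[ℂ] ℂ) : extend (contract G) = G := by
  ext Φ
  rw [extend_apply]
  simp_rw [contract_apply]
  rw [← map_sum, sum_singleCLM_coordCLM]

end Vector

/-! ### The Dirac equation on the Fourier side -/

section Equation

variable {d n : ℕ}

/-- The zeroth order part of the transposed symbol. -/
def massSymb (m : ℝ) (α : Fin (d + 1) → Matrix (Fin n) (Fin n) ℂ) : Cn n →L[ℂ] Cn n :=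
  (-(2 * Real.pi * Complex.I) * m) • Matrix.toEuclideanCLM (n := Fin n) (𝕜 := ℂ) (α 0).transpose

/-- The first order part of the transposed symbol. -/
def diracSymb (α : Fin (d + 1) → Matrix (Fin n) (Fin n) ℂ) : Rd d →L[ℝ] Cn n →L[ℂ] Cn n :=
  ∑ j : Fin d, (EuclideanSpace.proj j : Rd d →L[ℝ] ℝ).smulRight
    ((-(2 * Real.pi * Complex.I)) •
      Matrix.toEuclideanCLM (n := Fin n) (𝕜 := ℂ) (α j.succ).transpose)

/-- ⟨v, Av⟩ is real for Hermitian A, and the prefactor is purely imaginary. -/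
theorem isSkew_of_isHermitian {A : Matrix (Fin n) (Fin n) ℂ} (hA : A.IsHermitian) (r : ℝ) :
    IsSkew ((-(2 * Real.pi * Complex.I) * r) •
      Matrix.toEuclideanCLM (n := Fin n) (𝕜 := ℂ) A) := by
  intro v
  have h1 : IsSelfAdjoint (Matrix.toEuclideanCLM (n := Fin n) (𝕜 := ℂ) A) :=
    IsSelfAdjoint.map (x := A) hA (Matrix.toEuclideanCLM (n := Fin n) (𝕜 := ℂ))
  have h2 := h1.isSymmetric.im_inner_self_apply v
  have h3 : (⟪v, Matrix.toEuclideanCLM (n := Fin n) (𝕜 := ℂ) A v⟫_ℂ).im = 0 := h2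
  rw [smul_apply, inner_smul_right, Complex.mul_re, h3]
  simp

theorem IsSkew.sum {H ι : Type} [NormedAddCommGroup H] [InnerProductSpace ℂ H]
    [CompleteSpace H] (s : Finset ι) {X : ι → H →L[ℂ] H} (h : ∀ i, IsSkew (X i)) : IsSkew (∑ i ∈ s, X i) := by
  classical
  induction s using Finset.induction_on with
  | empty => simpa using isSkew_zero
  | insert a s ha ih => rw [Finset.sum_insert ha]; exact (h a).add ih

theorem isSkew_symb_dirac (m : ℝ) {α : Fin (d + 1) → Matrix (Fin n) (Fin n) ℂ}
    (hα : IsDiracMatrices α) (ξ : Rd d) : IsSkew (symb (massSymb m α) (diracSymb α) ξ) := by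
  refine (isSkew_of_isHermitian (hα.isHermitian 0).transpose m).add ?_
  rw [diracSymb, sum_apply]
  refine IsSkew.sum _ fun j => ?_
  have h := isSkew_of_isHermitian (hα.isHermitian j.succ).transpose (ξ j)
  intro v
  have := h v
  simp only [smul_apply, mul_smul, ContinuousLinearMap.smulRight_apply] at this ⊢
  rw [smul_comm] at this
  simpa using this

/-- The distributional derivative moves to 𝓕 φ with a minus sign, and differentiating 𝓕 φ multiplies
φ by -2πi times a coordinate; together with the factor -i this produces 2π times the coordinate. -/
theorem diracOp_fourier_apply (m : ℝ) (α : Fin (d + 1) → Matrix (Fin n) (Fin n) ℂ)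
    (f : 𝓢'(Rd d, Cn n)) (φ : 𝓢(Rd d, ℂ)) :
    diracOp m α f (𝓕 φ) = (2 * Real.pi * m : ℂ) •
        Matrix.toEuclideanCLM (n := Fin n) (𝕜 := ℂ) (α 0) (f (𝓕 φ)) +
      ∑ j : Fin d, (2 * Real.pi : ℂ) • Matrix.toEuclideanCLM (n := Fin n) (𝕜 := ℂ) (α j.succ)
        (f (𝓕 (smulLeftCLM ℂ (fun x : Rd d => ⟪x, EuclideanSpace.single j (1 : ℝ)⟫_ℝ) φ))) := by
  have h1 : ∀ j : Fin d, matrixAct (α j.succ)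
      (∂_{(EuclideanSpace.single j (1 : ℝ) : Rd d)} f) (𝓕 φ) = (2 * Real.pi * Complex.I : ℂ) •
      Matrix.toEuclideanCLM (n := Fin n) (𝕜 := ℂ) (α j.succ)
        (f (𝓕 (smulLeftCLM ℂ (fun x : Rd d => ⟪x, EuclideanSpace.single j (1 : ℝ)⟫_ℝ) φ))) := by
    intro j
    change Matrix.toEuclideanCLM (n := Fin n) (𝕜 := ℂ) (α j.succ)
      (f (-∂_{(EuclideanSpace.single j (1 : ℝ) : Rd d)} (𝓕 φ))) = _
    rw [SchwartzMap.lineDerivOp_fourier_eq, FourierTransform.fourier_smul, neg_smul, neg_neg,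
      map_smul, map_smul]
  have h2 : diracOp m α f (𝓕 φ) = ((2 * Real.pi * m : ℝ) : ℂ) • matrixAct (α 0) f (𝓕 φ) -
    Complex.I • (∑ j : Fin d,
      matrixAct (α j.succ) (∂_{(EuclideanSpace.single j (1 : ℝ) : Rd d)} f) (𝓕 φ)) := by
    rw [← sum_apply]
    rfl
  rw [h2, Finset.smul_sum, sub_eq_add_neg, ← Finset.sum_neg_distrib]
  congr 1
  · push_cast
    rfl
  · refine Finset.sum_congr rfl fun j _ => ?_
    rw [h1, smul_smul, ← neg_smul]
    congr 1
    linear_combination (-2 * Real.pi : ℂ) * Complex.I_mul_I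

theorem coordCLM_opMul_symb (m : ℝ) (α : Fin (d + 1) → Matrix (Fin n) (Fin n) ℂ)
    (Φ : 𝓢(Rd d, Cn n)) (k : Fin n) :
    coordCLM k (opMul (hasTemperateGrowth_symb (c := massSymb m α) (Λ := diracSymb α)) Φ) =
      ∑ i, ((-(2 * Real.pi * Complex.I) * m * α 0 i k) • coordCLM i Φ +
        ∑ j : Fin d, (-(2 * Real.pi * Complex.I) * α j.succ i k) •
          smulLeftCLM ℂ (fun x : Rd d => ⟪x, EuclideanSpace.single j (1 : ℝ)⟫_ℝ)
            (coordCLM i Φ)) := by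
  ext ξ
  have hin : ∀ j : Fin d, Function.HasTemperateGrowth
    (fun x : Rd d => ⟪x, (EuclideanSpace.single j (1 : ℝ) : Rd d)⟫_ℝ) := fun j => by fun_prop
  simp only [coordCLM_apply, opMul_apply, add_apply, smul_apply,
    smulLeftCLM_apply_apply (hin _), symb, massSymb, diracSymb, sum_apply,
    ContinuousLinearMap.smulRight_apply, PiLp.add_apply, PiLp.smul_apply, WithLp.ofLp_sum,
    Finset.sum_apply, Matrix.ofLp_toEuclideanCLM, Matrix.mulVec, dotProduct, Finset.sum_add_distrib,
    Matrix.transpose_apply, smul_eq_mul, Finset.mul_sum]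
  rw [Finset.sum_comm]
  simp [mul_assoc, mul_comm, mul_left_comm, Finset.mul_sum, EuclideanSpace.inner_single_right]

/-- Reordering the double sum over components passes the matrices to the test function as
transposes. The factor i cancels against that of the equation and leaves ∂_t F = F ∘ L. -/
theorem extend_fourier_diracOp (m : ℝ) (α : Fin (d + 1) → Matrix (Fin n) (Fin n) ℂ)
    (f : 𝓢'(Rd d, Cn n)) (Φ : 𝓢(Rd d, Cn n)) :
    extend (𝓕 (diracOp m α f)) Φ = Complex.I *
      extend (𝓕 f) (opMul (hasTemperateGrowth_symb (c := massSymb m α) (Λ := diracSymb α)) Φ) := by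
  rw [extend_apply, extend_apply]
  simp_rw [TemperedDistribution.fourier_apply, diracOp_fourier_apply, coordCLM_opMul_symb,
    FourierTransform.fourier_sum, FourierTransform.fourier_add, FourierTransform.fourier_sum,
    FourierTransform.fourier_smul, map_sum, map_add, map_sum, map_smul]
  simp only [PiLp.add_apply, PiLp.smul_apply, WithLp.ofLp_sum,
    Finset.sum_apply, Matrix.ofLp_toEuclideanCLM, Matrix.mulVec, dotProduct, 
    smul_eq_mul, Finset.mul_sum]
  conv_rhs => rw [Finset.sum_comm]
  refine Finset.sum_congr rfl fun i _ => ?_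
  conv_lhs => rw [Finset.sum_comm, ← Finset.sum_add_distrib]
  refine Finset.sum_congr rfl fun k _ => ?_
  rw [mul_add, Finset.mul_sum]
  congr 1
  · linear_combination ((2 * Real.pi * m * α 0 i k * f (𝓕 (coordCLM i Φ)) k : ℂ)) *
      Complex.I_mul_I
  · refine Finset.sum_congr rfl fun j _ => ?_
    linear_combination ((2 * Real.pi * α j.succ i k * f (𝓕 (smulLeftCLM ℂ
      (fun x : Rd d => ⟪x, EuclideanSpace.single j (1 : ℝ)⟫_ℝ) (coordCLM i Φ))) k : ℂ)) *
      Complex.I_mul_I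

theorem isDiracSolution_iff (m : ℝ) (α : Fin (d + 1) → Matrix (Fin n) (Fin n) ℂ)
    (ψ₀ : 𝓢'(Rd d, Cn n)) (ψ : ℝ → 𝓢'(Rd d, Cn n)) :
    IsDiracSolution m α ψ₀ ψ ↔ ψ 0 = ψ₀ ∧ ∀ Φ t,
      HasDerivAt (fun t => extend (𝓕 (ψ t)) Φ) (extend (𝓕 (ψ t))
        (opMul (hasTemperateGrowth_symb (c := massSymb m α) (Λ := diracSymb α)) Φ)) t := by
  have hI : ∀ z w : ℂ, Complex.I * z = w ↔ z = -Complex.I * w := by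
    intro z w
    constructor
    · rintro rfl; rw [← mul_assoc]; simp
    · rintro rfl; rw [← mul_assoc]; simp
  constructor
  · intro h
    refine ⟨h.initial, fun Φ t => ?_⟩
    have h1 := ((hI _ _).1 (extend_fourier_diracOp m α (ψ t) Φ).symm)
    rw [h1, extend_apply, Finset.mul_sum]
    simp_rw [extend_apply]
    refine HasDerivAt.fun_sum fun j _ => ?_
    have h2 := (h.differentiable (𝓕 (coordCLM j Φ)) t).hasDerivAt
    have h3 := h.equation t (𝓕 (coordCLM j Φ))
    have h4 := (EuclideanSpace.proj j : Cn n →L[ℂ] ℂ).restrictScalars ℝ |>.hasFDerivAt.comp_hasDerivAt t h2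
    refine h4.congr_deriv ?_
    rw [TemperedDistribution.fourier_apply, ← h3]
    simp [← mul_assoc]
  · rintro ⟨h0, h⟩
    have key : ∀ t φ, HasDerivAt (fun t => ψ t φ) (-Complex.I • diracOp m α (ψ t) φ) t := by
      intro t φ
      have h1 : ∀ f : 𝓢'(Rd d, Cn n), f φ = ∑ j, extend (𝓕 f) (singleCLM j (𝓕⁻ φ)) •
          EuclideanSpace.single j (1 : ℂ) := by
        intro f
        rw [sum_extend_smul_single, TemperedDistribution.fourier_apply,
          FourierTransform.fourier_fourierInv_eq]
      rw [h1 (diracOp m α (ψ t)), Finset.smul_sum]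
      simp_rw [h1 (ψ _)]
      refine HasDerivAt.fun_sum fun j _ => ?_
      have h2 := (h (singleCLM j (𝓕⁻ φ)) t).smul_const (EuclideanSpace.single j (1 : ℂ) : Cn n)
      refine h2.congr_deriv ?_
      rw [(hI _ _).1 (extend_fourier_diracOp m α (ψ t) _).symm, smul_smul]
    refine ⟨h0, fun φ t => (key t φ).differentiableAt, fun t φ => ?_⟩
    rw [(key t φ).deriv, smul_smul]
    simp

theorem fourier_fourierInv_distribution (f : 𝓢'(Rd d, Cn n)) : 𝓕 (𝓕⁻ f) = f :=
  FourierTransform.fourier_fourierInv_eq f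

variable {m : ℝ} {α : Fin (d + 1) → Matrix (Fin n) (Fin n) ℂ}

/-- Solutions are exactly the transported functionals: one direction is uniqueness by duality, the
other is differentiability of the propagator. Existence and every later estimate use this formula.
-/
theorem isDiracSolution_iff_propag (hα : IsDiracMatrices α) (ψ₀ : 𝓢'(Rd d, Cn n))
    (ψ : ℝ → 𝓢'(Rd d, Cn n)) :
    IsDiracSolution m α ψ₀ ψ ↔ ∀ t Φ, extend (𝓕 (ψ t)) Φ =
      extend (𝓕 ψ₀) (opMul (hasTemperateGrowth_propag (isSkew_symb_dirac m hα) t) Φ) := by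
  rw [isDiracSolution_iff]
  constructor
  · rintro ⟨rfl, h⟩ t Φ
    exact eq_apply_opMul_propag (isSkew_symb_dirac m hα) (fun t => extend (𝓕 (ψ t))) h t Φ
  · intro h
    constructor
    · have h1 : 𝓕 (ψ 0) = 𝓕 ψ₀ := by
        ext φ i
        rw [← extend_singleCLM, ← extend_singleCLM, h, opMul_propag_zero (isSkew_symb_dirac m hα)]
      have h2 := congrArg (fun f : 𝓢'(Rd d, Cn n) => 𝓕⁻ f) h1
      simpa [FourierTransform.fourierInv_fourier_eq] using h2
    · intro Φ t
      rw [h]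
      simp_rw [h]
      have := hasDerivAt_apply_opMul_propag (isSkew_symb_dirac m hα) (extend (𝓕 ψ₀)) Φ t
      refine this.congr_deriv ?_
      congr 1
      ext1 ξ
      simp only [opMul_apply, propag]
      -- Differentiating gives L e^{tL}Φ, while the equation asks for e^{tL} LΦ.
      have hc : Commute (symb (massSymb m α) (diracSymb α) ξ)
          (NormedSpace.exp (t • symb (massSymb m α) (diracSymb α) ξ)) :=
        Commute.exp_right (((Commute.refl _).smul_right t))
      exact DFunLike.congr_fun hc.eq (Φ ξ)

theorem existsUnique_isDiracSolution (hα : IsDiracMatrices α) (ψ₀ : 𝓢'(Rd d, Cn n)) :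
    ∃! ψ : ℝ → 𝓢'(Rd d, Cn n), IsDiracSolution m α ψ₀ ψ := by
  refine ⟨fun t => 𝓕⁻ (contract (extend (𝓕 ψ₀) ∘L
    opMul (hasTemperateGrowth_propag (isSkew_symb_dirac m hα) t))), ?_, ?_⟩
  · refine (isDiracSolution_iff_propag hα _ _).2 fun t Φ => ?_
    rw [fourier_fourierInv_distribution, extend_contract]
    rfl
  · intro ψ hψ
    replace hψ := (isDiracSolution_iff_propag hα _ _).1 hψ
    funext t
    have h1 : 𝓕 (ψ t) = contract (extend (𝓕 ψ₀) ∘L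
        opMul (hasTemperateGrowth_propag (isSkew_symb_dirac m hα) t)) := by
      ext φ i
      rw [← extend_singleCLM, hψ, contract_apply]
      rfl
    rw [← h1, FourierTransform.fourierInv_fourier_eq]

end Equation


/-! ### Jets of Schwartz functions -/

section Jet

variable {E : Type*} [NormedAddCommGroup E] [NormedSpace ℝ E]

/-- Bounded families indexed by the pairs (order, point), where the order runs over a finite set. -/
abbrev JetSpace (E : Type*) [NormedAddCommGroup E] [NormedSpace ℝ E] (s : Finset (ℕ × ℕ)) : Type _ :=
  lp (fun i : {m // m ∈ s} × E => E [×i.1.1.2]→L[ℝ] ℂ) ∞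

theorem norm_jet_le (s : Finset (ℕ × ℕ)) (φ : 𝓢(E, ℂ)) (i : {m // m ∈ s} × E) :
    ‖((‖i.2‖ ^ i.1.1.1 : ℝ) : ℂ) • iteratedFDeriv ℝ i.1.1.2 φ i.2‖ ≤
      (s.sup (schwartzSeminormFamily ℂ E ℂ)) φ := by
  rw [norm_smul, Complex.norm_real, Real.norm_of_nonneg (by positivity)]
  refine (SchwartzMap.le_seminorm ℂ i.1.1.1 i.1.1.2 φ i.2).trans ?_
  exact Seminorm.le_finset_sup_apply (p := schwartzSeminormFamily ℂ E ℂ) i.1.2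

/-- The weighted derivatives of a Schwartz function. -/
def jet (s : Finset (ℕ × ℕ)) : 𝓢(E, ℂ) →ₗ[ℂ] JetSpace E s where
  toFun φ := ⟨fun i => ((‖i.2‖ ^ i.1.1.1 : ℝ) : ℂ) • iteratedFDeriv ℝ i.1.1.2 φ i.2,
    memℓp_infty ⟨_, by rintro _ ⟨i, rfl⟩; exact norm_jet_le s φ i⟩⟩
  map_add' φ ψ := by
    ext1
    funext i
    have h : iteratedFDeriv ℝ i.1.1.2 (φ + ψ : 𝓢(E, ℂ)) i.2 =
        iteratedFDeriv ℝ i.1.1.2 φ i.2 + iteratedFDeriv ℝ i.1.1.2 ψ i.2 := by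
      have : ((φ + ψ : 𝓢(E, ℂ)) : E → ℂ) = (φ : E → ℂ) + ψ := rfl
      rw [this]
      exact iteratedFDeriv_add_apply ((φ.smooth _).contDiffAt) ((ψ.smooth _).contDiffAt)
    change ((‖i.2‖ ^ i.1.1.1 : ℝ) : ℂ) • iteratedFDeriv ℝ i.1.1.2 (φ + ψ : 𝓢(E, ℂ)) i.2 = _
    rw [h, smul_add]
    rfl
  map_smul' c φ := by
    ext1
    funext i
    have h : iteratedFDeriv ℝ i.1.1.2 (c • φ : 𝓢(E, ℂ)) i.2 =
        c • iteratedFDeriv ℝ i.1.1.2 φ i.2 := by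
      have : ((c • φ : 𝓢(E, ℂ)) : E → ℂ) = c • (φ : E → ℂ) := rfl
      rw [this]
      exact iteratedFDeriv_const_smul_apply ((φ.smooth _).contDiffAt)
    simp only [h, RingHom.id_apply, lp.coeFn_smul, Pi.smul_apply]
    rw [smul_comm]

theorem jet_apply (s : Finset (ℕ × ℕ)) (φ : 𝓢(E, ℂ)) (i : {m // m ∈ s} × E) :
    jet s φ i = ((‖i.2‖ ^ i.1.1.1 : ℝ) : ℂ) • iteratedFDeriv ℝ i.1.1.2 φ i.2 := rfl

theorem norm_jet_le_sup (s : Finset (ℕ × ℕ)) (φ : 𝓢(E, ℂ)) :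
    ‖jet s φ‖ ≤ (s.sup (schwartzSeminormFamily ℂ E ℂ)) φ :=
  lp.norm_le_of_forall_le (apply_nonneg _ _) fun i => norm_jet_le s φ i

theorem sup_le_norm_jet (s : Finset (ℕ × ℕ)) (φ : 𝓢(E, ℂ)) :
    (s.sup (schwartzSeminormFamily ℂ E ℂ)) φ ≤ ‖jet s φ‖ := by
  refine Seminorm.finset_sup_apply_le (norm_nonneg _) fun m hm => ?_
  refine SchwartzMap.seminorm_le_bound ℂ m.1 m.2 φ (norm_nonneg _) fun x => ?_
  have h := lp.norm_apply_le_norm (by simp) (jet s φ) (⟨m, hm⟩, x)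
  rw [jet_apply, norm_smul, Complex.norm_real, Real.norm_of_nonneg (by positivity)] at h
  exact h

theorem continuous_jet (s : Finset (ℕ × ℕ)) : Continuous (jet s : 𝓢(E, ℂ) → JetSpace E s) := by
  refine WithSeminorms.continuous_of_isBounded (schwartz_withSeminorms ℂ E ℂ)
    (norm_withSeminorms ℂ (JetSpace E s)) (jet s) fun _ => ⟨s, 1, fun φ => ?_⟩
  simpa using norm_jet_le_sup s φ

/-- A continuous functional is bounded by finitely many seminorms, and these are dominated by the
norm of a jet in a Banach space. Hahn–Banach extends the functional to that space, so Bochner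
integration becomes available although the Schwartz space is not normed. -/
theorem exists_jet_factorization (f : 𝓢(E, ℂ) →L[ℂ] ℂ) :
    ∃ (s : Finset (ℕ × ℕ)) (F : JetSpace E s →L[ℂ] ℂ), ∀ φ, F (jet s φ) = f φ := by
  obtain ⟨s₀, C, -, hC⟩ := Seminorm.bound_of_continuous (schwartz_withSeminorms ℂ E ℂ)
    ((normSeminorm ℂ ℂ).comp f.toLinearMap) (by
      change Continuous fun φ => ‖f φ‖
      fun_prop)
  -- Adding (0, 0) puts the function itself into its jet, which makes the jet map injective.
  set s := insert (0, 0) s₀ with hs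
  have hb : ∀ φ, ‖f φ‖ ≤ C * ‖jet s φ‖ := by
    intro φ
    have h1 : ‖f φ‖ ≤ C * (s₀.sup (schwartzSeminormFamily ℂ E ℂ)) φ := hC φ
    refine h1.trans ?_
    gcongr
    refine le_trans ?_ (sup_le_norm_jet s φ)
    exact Seminorm.le_def.1 (Finset.sup_mono (by simp [hs])) φ
  have hinj : Function.Injective (jet s : 𝓢(E, ℂ) →ₗ[ℂ] JetSpace E s) := by
    rw [← LinearMap.ker_eq_bot, LinearMap.ker_eq_bot']
    intro φ hφ
    ext x
    have h := sup_le_norm_jet s φ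
    rw [hφ, norm_zero] at h
    have h2 := (SchwartzMap.norm_le_seminorm ℂ φ x).trans ((Seminorm.le_finset_sup_apply
      (p := schwartzSeminormFamily ℂ E ℂ) (i := (0, 0)) (s := s) (by simp [hs])).trans h)
    simpa using h2
  set e := LinearEquiv.ofInjective (jet s : 𝓢(E, ℂ) →ₗ[ℂ] JetSpace E s) hinj
  set f₁ : LinearMap.range (jet s : 𝓢(E, ℂ) →ₗ[ℂ] JetSpace E s) →L[ℂ] ℂ :=
    (f.toLinearMap ∘ₗ e.symm.toLinearMap).mkContinuous C (fun y => by
      obtain ⟨φ, rfl⟩ := e.surjective y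
      have h1 : f (e.symm (e φ)) = f φ := by rw [e.symm_apply_apply]
      change ‖f (e.symm (e φ))‖ ≤ C * ‖jet s φ‖
      rw [h1]
      exact hb φ)
  obtain ⟨F, hF, -⟩ := exists_extension_norm_eq _ f₁
  refine ⟨s, F, fun φ => ?_⟩
  have h1 := hF (e φ)
  have h2 : f₁ (e φ) = f φ := by simp [f₁]
  rw [← h2, ← h1]
  rfl

end Jet

/-! ### Integrals of families of Schwartz functions -/

section Integral

set_option linter.unusedSectionVars false

variable {E Z : Type*} [NormedAddCommGroup E] [NormedSpace ℝ E] [TopologicalSpace Z]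
  [SecondCountableTopology Z] [MeasurableSpace Z] [OpensMeasurableSpace Z] {μ : Measure Z}
  {Φ : Z → 𝓢(E, ℂ)}

theorem continuous_iteratedFDeriv_family (hΦ : Continuous Φ) (j : ℕ) (y : E) :
    Continuous fun z => iteratedFDeriv ℝ j (Φ z) y := by
  have h1 := (continuous_jet {(0, j)}).comp hΦ
  have h2 : LipschitzWith 1 fun F : JetSpace E {(0, j)} => F (⟨(0, j), by simp⟩, y) := by
    refine LipschitzWith.of_dist_le_mul fun F G => ?_
    rw [NNReal.coe_one, one_mul, dist_eq_norm, dist_eq_norm]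
    exact lp.norm_apply_le_norm (by simp) (F - G) _
  have h3 := h2.continuous.comp h1
  refine h3.congr fun z => ?_
  simp [jet_apply]

theorem integrable_iteratedFDeriv_family (hΦ : Continuous Φ)
    (hI : ∀ k l, Integrable (fun z => SchwartzMap.seminorm ℂ k l (Φ z)) μ) (j : ℕ) (y : E) :
    Integrable (fun z => iteratedFDeriv ℝ j (Φ z) y) μ := by
  refine (hI 0 j).mono' (continuous_iteratedFDeriv_family hΦ j y).aestronglyMeasurable ?_
  refine Filter.Eventually.of_forall fun z => ?_
  simpa using SchwartzMap.le_seminorm ℂ 0 j (Φ z) y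

/-- Differentiation under the integral sign, by induction on the order; the integrable seminorms are
the dominating functions. -/
theorem iteratedFDeriv_eq_integral (hΦ : Continuous Φ)
    (hI : ∀ k l, Integrable (fun z => SchwartzMap.seminorm ℂ k l (Φ z)) μ) {Ψ : 𝓢(E, ℂ)}
    (hΨ : ∀ y, Ψ y = ∫ z, Φ z y ∂μ) (j : ℕ) (y : E) :
    iteratedFDeriv ℝ j Ψ y = ∫ z, iteratedFDeriv ℝ j (Φ z) y ∂μ := by
  induction j generalizing y with
  | zero =>
    simp only [iteratedFDeriv_zero_eq_comp, Function.comp_apply]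
    rw [hΨ]
    exact (((continuousMultilinearCurryFin0 ℝ E ℂ).symm.toContinuousLinearEquiv).integral_comp_comm
      (fun z => Φ z y)).symm
  | succ j ih =>
    have hf : (iteratedFDeriv ℝ j Ψ) = fun y => ∫ z, iteratedFDeriv ℝ j (Φ z) y ∂μ := funext ih
    set e : (E [×(j + 1)]→L[ℝ] ℂ) ≃ₗᵢ[ℝ] (E →L[ℝ] E [×j]→L[ℝ] ℂ) :=
      continuousMultilinearCurryLeftEquiv ℝ (fun _ : Fin (j + 1) => E) ℂ
    have hsucc : ∀ (φ : 𝓢(E, ℂ)) x, fderiv ℝ (iteratedFDeriv ℝ j φ) x =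
        e (iteratedFDeriv ℝ (j + 1) φ x) := by
      intro φ x
      rw [iteratedFDeriv_succ_eq_comp_left]
      simp [e]
    have hd : HasFDerivAt (fun y => ∫ z, iteratedFDeriv ℝ j (Φ z) y ∂μ)
        (∫ z, e (iteratedFDeriv ℝ (j + 1) (Φ z) y) ∂μ) y := by
      refine hasFDerivAt_integral_of_dominated_of_fderiv_le (s := Set.univ)
        (F' := fun x z => e (iteratedFDeriv ℝ (j + 1) (Φ z) x))
        (bound := fun z => SchwartzMap.seminorm ℂ 0 (j + 1) (Φ z)) Filter.univ_mem
        (Filter.Eventually.of_forall fun x =>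
          (continuous_iteratedFDeriv_family hΦ j x).aestronglyMeasurable)
        (integrable_iteratedFDeriv_family hΦ hI j y)
        (e.continuous.comp (continuous_iteratedFDeriv_family hΦ (j + 1) y)).aestronglyMeasurable
        (Filter.Eventually.of_forall fun z x _ => ?_) (hI 0 (j + 1))
        (Filter.Eventually.of_forall fun z x _ => ?_)
      · rw [LinearIsometryEquiv.norm_map]
        simpa using SchwartzMap.le_seminorm ℂ 0 (j + 1) (Φ z) x
      · rw [← hsucc]
        exact (((Φ z).smooth (j + 1)).differentiable_iteratedFDeriv
          (by exact_mod_cast Nat.lt_succ_self j) x).hasFDerivAt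
    have h1 := hsucc Ψ y
    rw [hf, hd.fderiv] at h1
    have h2 : ∫ z, e (iteratedFDeriv ℝ (j + 1) (Φ z) y) ∂μ =
        e (∫ z, iteratedFDeriv ℝ (j + 1) (Φ z) y ∂μ) := by
      let eL : (E [×(j + 1)]→L[ℝ] ℂ) →L[ℝ] (E →L[ℝ] E [×j]→L[ℝ] ℂ) :=
        ⟨⟨⟨e, e.map_add⟩, e.map_smul⟩, e.continuous⟩
      exact ContinuousLinearMap.integral_comp_comm (𝕜 := ℝ) (E := E [×(j + 1)]→L[ℝ] ℂ)
        (Fₗ := E →L[ℝ] E [×j]→L[ℝ] ℂ) eL (integrable_iteratedFDeriv_family hΦ hI (j + 1) y)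
    exact (e.injective (h2.symm.trans h1)).symm

/-- A continuous functional on the Schwartz space commutes with integrals of continuous families
with integrable seminorms. -/
theorem apply_eq_integral_of_family (hΦ : Continuous Φ)
    (hI : ∀ k l, Integrable (fun z => SchwartzMap.seminorm ℂ k l (Φ z)) μ) {Ψ : 𝓢(E, ℂ)}
    (hΨ : ∀ y, Ψ y = ∫ z, Φ z y ∂μ) (f : 𝓢(E, ℂ) →L[ℂ] ℂ) :
    Integrable (fun z => f (Φ z)) μ ∧ f Ψ = ∫ z, f (Φ z) ∂μ := by
  obtain ⟨s, F, hF⟩ := exists_jet_factorization f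
  have hInt : Integrable (fun z => jet s (Φ z)) μ := by
    refine (integrable_finsetSum s (fun m _ => hI m.1 m.2)).mono'
      ((continuous_jet s).comp hΦ).aestronglyMeasurable (Filter.Eventually.of_forall fun z => ?_)
    refine (norm_jet_le_sup s (Φ z)).trans ?_
    refine Seminorm.finset_sup_apply_le (Finset.sum_nonneg fun _ _ => apply_nonneg _ _) fun m hm => ?_
    exact Finset.single_le_sum (f := fun m : ℕ × ℕ => SchwartzMap.seminorm ℂ m.1 m.2 (Φ z))
      (fun _ _ => apply_nonneg _ _) hm
  have hjet : jet s Ψ = ∫ z, jet s (Φ z) ∂μ := by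
    ext1
    funext i
    set ev : JetSpace E s →L[ℂ] (E [×i.1.1.2]→L[ℝ] ℂ) :=
      lp.evalCLM ℂ (fun i : {m // m ∈ s} × E => E [×i.1.1.2]→L[ℝ] ℂ) ∞ i
    have hev : ∀ G, ev G = G i := fun _ => rfl
    rw [← hev (∫ z, jet s (Φ z) ∂μ), ← ContinuousLinearMap.integral_comp_comm ev hInt]
    simp_rw [hev, jet_apply]
    rw [integral_smul, iteratedFDeriv_eq_integral hΦ hI hΨ]
  refine ⟨?_, ?_⟩
  · simpa only [hF] using F.integrable_comp hInt
  · rw [← hF, hjet, ← F.integral_comp_comm hInt]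
    simp_rw [hF]

end Integral


/-! ### Continuous families of Schwartz functions -/

section Family

variable {E : Type*} [NormedAddCommGroup E] [NormedSpace ℝ E]

open Filter Topology

/-- A family of Schwartz functions with jointly continuous derivatives and locally bounded
seminorms is continuous. -/
theorem continuous_schwartz_family [ProperSpace E] {Z : Type*} [TopologicalSpace Z]
    {Φ : Z → 𝓢(E, ℂ)}
    (hc : ∀ l, Continuous fun p : Z × E => iteratedFDeriv ℝ l (Φ p.1) p.2)
    (hb : ∀ k l z₀, ∃ M, ∀ᶠ z in 𝓝 z₀, SchwartzMap.seminorm ℝ k l (Φ z) ≤ M) :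
    Continuous Φ := by
  rw [continuous_iff_continuousAt]
  intro z₀
  rw [ContinuousAt, (schwartz_withSeminorms ℝ E ℂ).tendsto_nhds]
  rintro ⟨k, l⟩ ε hε
  obtain ⟨M, hM⟩ := hb (k + 1) l z₀
  have hM0 : 0 ≤ M := (apply_nonneg _ _).trans hM.self_of_nhds
  -- Outside radius ρ the bound with one more power of ‖y‖ gives at most 2M/‖y‖ ≤ ε/2; inside, joint
  -- continuity and compactness suffice.
  set ρ := 1 + 4 * M / ε with hρ
  have hρ0 : 0 < ρ := by positivity
  have hcomp : ∀ᶠ z in 𝓝 z₀, ∀ y ∈ Metric.closedBall (0 : E) ρ,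
      ‖iteratedFDeriv ℝ l (Φ z) y - iteratedFDeriv ℝ l (Φ z₀) y‖ < ε / (2 * (ρ ^ k + 1)) := by
    refine (isCompact_closedBall (0 : E) ρ).eventually_forall_of_forall_eventually fun y _ => ?_
    have hcont : Continuous fun p : Z × E =>
        ‖iteratedFDeriv ℝ l (Φ p.1) p.2 - iteratedFDeriv ℝ l (Φ z₀) p.2‖ :=
      ((hc l).sub ((hc l).comp (by fun_prop : Continuous fun p : Z × E => (z₀, p.2)))).norm
    exact (hcont.tendsto (z₀, y)).eventually (gt_mem_nhds (by simpa using by positivity))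
  filter_upwards [hcomp, hM] with z hz hMz
  refine lt_of_le_of_lt (b := ε / 2) ?_ (by linarith)
  refine SchwartzMap.seminorm_le_bound ℝ k l _ (by positivity) fun y => ?_
  rw [iteratedFDeriv_schwartz_sub]
  rcases le_or_gt ‖y‖ ρ with hy | hy
  · have h1 := hz y (by simpa using hy)
    calc ‖y‖ ^ k * _ ≤ ρ ^ k * (ε / (2 * (ρ ^ k + 1))) := by gcongr
      _ ≤ (ρ ^ k + 1) * (ε / (2 * (ρ ^ k + 1))) := by gcongr; linarith
      _ = ε / 2 := by
        have : ρ ^ k + 1 ≠ 0 := by positivity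
        field_simp
  · have hy0 : 0 < ‖y‖ := hρ0.trans hy
    have h1 := (SchwartzMap.le_seminorm ℝ (k + 1) l (Φ z) y).trans hMz
    have h2 := (SchwartzMap.le_seminorm ℝ (k + 1) l (Φ z₀) y).trans hM.self_of_nhds
    have h3 : ‖y‖ * (‖y‖ ^ k * ‖iteratedFDeriv ℝ l (Φ z) y - iteratedFDeriv ℝ l (Φ z₀) y‖) ≤
        2 * M := by
      calc _ ≤ ‖y‖ * (‖y‖ ^ k * (‖iteratedFDeriv ℝ l (Φ z) y‖ + ‖iteratedFDeriv ℝ l (Φ z₀) y‖)) := by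
            gcongr; exact norm_sub_le _ _
        _ = ‖y‖ ^ (k + 1) * ‖iteratedFDeriv ℝ l (Φ z) y‖ +
            ‖y‖ ^ (k + 1) * ‖iteratedFDeriv ℝ l (Φ z₀) y‖ := by ring
        _ ≤ 2 * M := by linarith
    have h4 : 2 * M ≤ ‖y‖ * (ε / 2) := by
      have : ρ * (ε / 2) = ε / 2 + 2 * M := by rw [hρ]; field_simp; ring
      nlinarith
    exact le_of_mul_le_mul_left (h3.trans h4) hy0

theorem continuous_iteratedFDeriv_right {Z : Type*} [NormedAddCommGroup Z] [NormedSpace ℝ Z]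
    {G : Z × E → ℂ} (hG : ContDiff ℝ (⊤ : ℕ∞) G) (l : ℕ) :
    Continuous fun p : Z × E => iteratedFDeriv ℝ l (fun y => G (p.1, y)) p.2 := by
  have h1 : ∀ p : Z × E, iteratedFDeriv ℝ l (fun y => G (p.1, y)) p.2 =
      ContinuousMultilinearMap.compContinuousLinearMapL
        (fun _ : Fin l => ContinuousLinearMap.inr ℝ Z E) (iteratedFDeriv ℝ l G p) := by
    intro p
    have h2 : (fun y => G (p.1, y)) = (fun w => G ((p.1, 0) + w)) ∘
        ContinuousLinearMap.inr ℝ Z E := by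
      funext y; simp
    have hG' : ContDiff ℝ (⊤ : ℕ∞) (fun w => G ((p.1, 0) + w)) :=
      hG.comp (contDiff_const.add contDiff_id)
    rw [h2, ContinuousLinearMap.iteratedFDeriv_comp_right _ hG' _ (mod_cast le_top),
      iteratedFDeriv_comp_add_left]
    simp
  simp_rw [h1]
  exact (ContinuousLinearMap.continuous _).comp (hG.continuous_iteratedFDeriv (mod_cast le_top))

/-- Weighted pointwise bounds for a continuous operator on the Schwartz space. -/
theorem exists_pow_mul_norm_apply_le {F : Type*} [NormedAddCommGroup F] [NormedSpace ℝ F]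
    (T : 𝓢(E, ℂ) →L[ℂ] 𝓢(F, ℂ)) (N : ℕ) :
    ∃ (s : Finset (ℕ × ℕ)) (C : ℝ), 0 ≤ C ∧ ∀ h ξ, (1 + ‖ξ‖) ^ N * ‖T h ξ‖ ≤
      C * (s.sup (schwartzSeminormFamily ℂ E ℂ)) h := by
  set q : Seminorm ℂ 𝓢(F, ℂ) := (Finset.Iic (N, 0)).sup (schwartzSeminormFamily ℂ F ℂ)
  have hq : Continuous q := by
    refine Seminorm.continuous_of_le (q := ∑ i ∈ Finset.Iic (N, 0), schwartzSeminormFamily ℂ F ℂ i)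
      ?_ (Seminorm.finset_sup_le_sum _ _)
    have : ((∑ i ∈ Finset.Iic (N, 0), schwartzSeminormFamily ℂ F ℂ i : Seminorm ℂ 𝓢(F, ℂ)) :
        𝓢(F, ℂ) → ℝ) = fun x => ∑ i ∈ Finset.Iic (N, 0), schwartzSeminormFamily ℂ F ℂ i x := by
      funext x; simp
    rw [this]
    exact continuous_finsetSum _ fun i _ =>
      (schwartz_withSeminorms ℂ F ℂ).continuous_seminorm i
  obtain ⟨s, C, -, hC⟩ := Seminorm.bound_of_continuous (schwartz_withSeminorms ℂ E ℂ)
    (q.comp T.toLinearMap) (hq.comp T.continuous)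
  refine ⟨s, 2 ^ N * C, by positivity, fun h ξ => ?_⟩
  have h1 := one_add_le_sup_seminorm_apply (𝕜 := ℂ) (m := (N, 0)) le_rfl le_rfl (T h) ξ
  rw [norm_iteratedFDeriv_zero] at h1
  have h2 : q (T h) ≤ C * (s.sup (schwartzSeminormFamily ℂ E ℂ)) h := hC h
  calc _ ≤ 2 ^ N * q (T h) := h1
    _ ≤ 2 ^ N * (C * (s.sup (schwartzSeminormFamily ℂ E ℂ)) h) := by gcongr
    _ = _ := by ring

end Family

/-! ### Time-frequency shifts -/

section TimeFrequency

variable {d : ℕ}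

@[simp]
theorem translation_apply (x : Rd d) (g : 𝓢(Rd d, ℂ)) (y : Rd d) :
    translation x g y = g (y - x) := by
  simp [translation]

theorem iteratedFDeriv_translation (x : Rd d) (g : 𝓢(Rd d, ℂ)) (l : ℕ) (y : Rd d) :
    iteratedFDeriv ℝ l (translation x g) y = iteratedFDeriv ℝ l g (y - x) := by
  have : (translation x g : Rd d → ℂ) = fun y => g (y - x) := by
    funext y; simp
  rw [this, iteratedFDeriv_comp_sub]

theorem seminorm_translation_le (x : Rd d) (g : 𝓢(Rd d, ℂ)) (k l : ℕ) :
    SchwartzMap.seminorm ℂ k l (translation x g) ≤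
      (1 + ‖x‖) ^ k * (2 ^ k * (Finset.Iic (k, l)).sup (schwartzSeminormFamily ℂ (Rd d) ℂ) g) := by
  refine SchwartzMap.seminorm_le_bound ℂ k l _ (by positivity) fun y => ?_
  rw [iteratedFDeriv_translation]
  have h1 := one_add_le_sup_seminorm_apply (𝕜 := ℂ) (m := (k, l)) le_rfl le_rfl g (y - x)
  have h2 : ‖y‖ ≤ (1 + ‖x‖) * (1 + ‖y - x‖) := by
    have := norm_add_le (y - x) x
    rw [sub_add_cancel] at this
    nlinarith [norm_nonneg x, norm_nonneg (y - x)]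
  calc ‖y‖ ^ k * ‖iteratedFDeriv ℝ l g (y - x)‖ ≤
      ((1 + ‖x‖) * (1 + ‖y - x‖)) ^ k * ‖iteratedFDeriv ℝ l g (y - x)‖ := by gcongr
    _ = (1 + ‖x‖) ^ k * ((1 + ‖y - x‖) ^ k * ‖iteratedFDeriv ℝ l g (y - x)‖) := by
      rw [mul_pow]; ring
    _ ≤ _ := mul_le_mul_of_nonneg_left h1 (by positivity)

/-- The seminorms of a product of a Schwartz function with a function of polynomial growth. -/
theorem exists_seminorm_smulLeftCLM_le (k l a : ℕ) : ∃ C : ℝ, 0 ≤ C ∧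
    ∀ (u : Rd d → ℂ), u.HasTemperateGrowth → ∀ A : ℝ, 0 ≤ A →
      (∀ j ≤ l, ∀ x, ‖iteratedFDeriv ℝ j u x‖ ≤ A * (1 + ‖x‖) ^ a) → ∀ f : 𝓢(Rd d, ℂ),
      SchwartzMap.seminorm ℂ k l (smulLeftCLM ℂ u f) ≤
        C * A * (Finset.Iic (a + k, l)).sup (schwartzSeminormFamily ℂ (Rd d) ℂ) f := by
  refine ⟨‖(ContinuousLinearMap.lsmul ℂ ℂ (E := ℂ)).flip‖ * ((l : ℝ) + 1) * l.choose (l / 2) *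
    2 ^ (a + k), by positivity, fun u hu A hA hb f => ?_⟩
  have h1 : smulLeftCLM ℂ u f = bilinLeftCLM (ContinuousLinearMap.lsmul ℂ ℂ).flip hu f := by
    simp [smulLeftCLM, hu]
  rw [h1]
  refine (seminorm_bilinLeftCLM_le _ hu k l a hA hb f).trans (le_of_eq ?_)
  change _ * _ * _ * (A * _) * (Finset.Iic (a + k, l)).sup (schwartzSeminormFamily ℂ (Rd d) ℂ) f = _
  ring

theorem norm_iteratedFDeriv_schwartz_le (g : 𝓢(Rd d, ℂ)) (l N : ℕ) : ∃ C : ℝ, 0 ≤ C ∧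
    ∀ j ≤ l, ∀ y, (1 + ‖y‖) ^ N * ‖iteratedFDeriv ℝ j g y‖ ≤ C :=
  ⟨2 ^ N * (Finset.Iic (N, l)).sup (schwartzSeminormFamily ℂ (Rd d) ℂ) g, by positivity,
    fun _ hj y => one_add_le_sup_seminorm_apply (𝕜 := ℂ) (m := (N, l)) le_rfl hj g y⟩

/-- The product of a Schwartz function with a translate of another one decays rapidly in the
translation parameter. -/
theorem exists_seminorm_mul_translation_le (φ g : 𝓢(Rd d, ℂ)) (k l N : ℕ) : ∃ C : ℝ, 0 ≤ C ∧
    ∀ x, SchwartzMap.seminorm ℂ k l (smulLeftCLM ℂ (translation x g) φ) ≤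
      C / (1 + ‖x‖) ^ N := by
  obtain ⟨C₁, hC₁, h₁⟩ := exists_seminorm_smulLeftCLM_le (d := d) k l N
  obtain ⟨C₂, hC₂, h₂⟩ := norm_iteratedFDeriv_schwartz_le g l N
  refine ⟨C₁ * C₂ * (Finset.Iic (N + k, l)).sup (schwartzSeminormFamily ℂ (Rd d) ℂ) φ,
    by positivity, fun x => ?_⟩
  refine (h₁ (translation x g) (translation x g).hasTemperateGrowth (C₂ / (1 + ‖x‖) ^ N)
    (by positivity) (fun j hj y => ?_) φ).trans (le_of_eq (by ring))
  rw [iteratedFDeriv_translation, div_mul_eq_mul_div, le_div_iff₀ (by positivity)]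
  have h3 : 1 + ‖x‖ ≤ (1 + ‖y‖) * (1 + ‖y - x‖) := by
    have := norm_sub_le y (y - x)
    rw [sub_sub_cancel] at this
    nlinarith [norm_nonneg y, norm_nonneg (y - x)]
  calc _ ≤ ‖iteratedFDeriv ℝ j g (y - x)‖ * ((1 + ‖y‖) * (1 + ‖y - x‖)) ^ N := by gcongr
    _ = ((1 + ‖y - x‖) ^ N * ‖iteratedFDeriv ℝ j g (y - x)‖) * (1 + ‖y‖) ^ N := by
      rw [mul_pow]; ring
    _ ≤ _ := by gcongr; exact h₂ j hj _

theorem norm_iteratedFDeriv_character_le (ξ : Rd d) (j : ℕ) (y : Rd d) :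
    ‖iteratedFDeriv ℝ j (character ξ) y‖ ≤ (2 * Real.pi * ‖ξ‖) ^ j := by
  have hk : ∀ k : ℕ, iteratedDeriv k
      (fun t : ℝ => Complex.exp (2 * Real.pi * Complex.I * (t : ℝ))) =
      fun t : ℝ => (2 * Real.pi * Complex.I) ^ k *
        Complex.exp (2 * Real.pi * Complex.I * (t : ℝ)) := by
    intro k
    induction k with
    | zero => simp
    | succ k ih =>
      rw [iteratedDeriv_succ, ih]
      funext t
      have h := (((hasDerivAt_id (t : ℂ)).const_mul
        (2 * Real.pi * Complex.I)).cexp.comp_ofReal).const_mul ((2 * Real.pi * Complex.I) ^ k)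
      simp only [id] at h
      rw [h.deriv]
      ring
  have h1 := norm_iteratedFDeriv_comp_affine_le (D := Rd d)
    (f := fun t : ℝ => Complex.exp (2 * Real.pi * Complex.I * (t : ℝ)))
    (contDiff_const.mul Complex.ofRealCLM.contDiff).cexp 0 (innerSL ℝ ξ) j y
  have h2 : character ξ = fun y => Complex.exp (2 * Real.pi * Complex.I *
      ((0 + innerSL ℝ ξ y : ℝ) : ℂ)) := by
    funext y
    rw [character, zero_add, innerSL_apply_apply, real_inner_comm]
  rw [h2]
  refine h1.trans ?_
  rw [innerSL_apply_norm, mul_pow]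
  gcongr
  rw [norm_iteratedFDeriv_eq_norm_iteratedDeriv, hk, norm_mul, norm_pow]
  have hre : (2 * (Real.pi : ℂ) * Complex.I * ((0 + innerSL ℝ ξ y : ℝ) : ℂ)).re = 0 := by simp
  rw [Complex.norm_exp, hre]
  simp [abs_of_pos Real.pi_pos]

/-- The conjugate time-frequency shift of a window. -/
def shiftConj (g : 𝓢(Rd d, ℂ)) (z : Rd d × Rd d) : 𝓢(Rd d, ℂ) :=
  conjugate (modulation z.2 (translation z.1 g))

theorem shiftConj_apply (g : 𝓢(Rd d, ℂ)) (z : Rd d × Rd d) (y : Rd d) :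
    shiftConj g z y = star (character z.2 y * g (y - z.1)) :=
  conjugate_modulation_translation_apply z.1 z.2 y g

theorem seminorm_conjugate (g : 𝓢(Rd d, ℂ)) (k l : ℕ) :
    SchwartzMap.seminorm ℂ k l (conjugate g) = SchwartzMap.seminorm ℂ k l g := by
  have h : ∀ y, ‖iteratedFDeriv ℝ l (conjugate g) y‖ = ‖iteratedFDeriv ℝ l g y‖ := fun y =>
    Complex.conjLIE.norm_iteratedFDeriv_comp_left g y l
  refine le_antisymm ?_ ?_ <;> refine SchwartzMap.seminorm_le_bound ℂ k l _ (apply_nonneg _ _) ?_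
  · intro y; rw [h]; exact SchwartzMap.le_seminorm ℂ k l g y
  · intro y; rw [← h]; exact SchwartzMap.le_seminorm ℂ k l (conjugate g) y

/-- Translation by x costs k powers through the weight and modulation by ξ costs l powers through
the derivatives. This polynomial growth is beaten by the decay of the coefficients in the inversion
formula. -/
theorem exists_seminorm_shiftConj_le (g : 𝓢(Rd d, ℂ)) (k l : ℕ) : ∃ C : ℝ, 0 ≤ C ∧
    ∀ z, SchwartzMap.seminorm ℂ k l (shiftConj g z) ≤ C * (1 + ‖z.1‖) ^ k * (1 + ‖z.2‖) ^ l := by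
  obtain ⟨C, hC, h⟩ := exists_seminorm_smulLeftCLM_le (d := d) k l 0
  set S := (Finset.Iic (k, l)).sup (schwartzSeminormFamily ℂ (Rd d) ℂ) g with hS
  have hS0 : 0 ≤ S := apply_nonneg _ _
  have hpi : 1 ≤ 2 * Real.pi := by linarith [Real.pi_gt_three]
  refine ⟨C * (2 * Real.pi) ^ l * (2 ^ k * S), by positivity, fun z => ?_⟩
  rw [shiftConj, seminorm_conjugate, modulation]
  refine (h _ (character_hasTemperateGrowth z.2) ((2 * Real.pi * (1 + ‖z.2‖)) ^ l) (by positivity)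
    (fun j hj y => ?_) _).trans ?_
  · rw [pow_zero, mul_one]
    refine (norm_iteratedFDeriv_character_le z.2 j y).trans ?_
    calc (2 * Real.pi * ‖z.2‖) ^ j ≤ (2 * Real.pi * (1 + ‖z.2‖)) ^ j := by gcongr; linarith
      _ ≤ _ := pow_le_pow_right₀ (by nlinarith [norm_nonneg z.2]) hj
  · have h1 : (Finset.Iic (0 + k, l)).sup (schwartzSeminormFamily ℂ (Rd d) ℂ) (translation z.1 g) ≤
        (1 + ‖z.1‖) ^ k * (2 ^ k * S) := by
      refine Seminorm.finset_sup_apply_le (by positivity) fun m hm => ?_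
      rw [Finset.mem_Iic, zero_add] at hm
      refine (seminorm_translation_le z.1 g m.1 m.2).trans ?_
      have h3 : (Finset.Iic (m.1, m.2)).sup (schwartzSeminormFamily ℂ (Rd d) ℂ) g ≤ S :=
        Seminorm.le_def.1 (Finset.sup_mono (Finset.Iic_subset_Iic.2 hm)) g
      have h4 : m.1 ≤ k := hm.1
      have h5 : (1 + ‖z.1‖) ^ m.1 ≤ (1 + ‖z.1‖) ^ k :=
        pow_le_pow_right₀ (by linarith [norm_nonneg z.1]) h4
      have h6 : (2 : ℝ) ^ m.1 ≤ 2 ^ k := pow_le_pow_right₀ (by norm_num) h4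
      gcongr
    calc _ ≤ C * (2 * Real.pi * (1 + ‖z.2‖)) ^ l * ((1 + ‖z.1‖) ^ k * (2 ^ k * S)) := by gcongr
      _ = _ := by rw [mul_pow]; ring

theorem contDiff_character_uncurry :
    ContDiff ℝ (⊤ : ℕ∞) fun p : Rd d × Rd d => character p.1 p.2 := by
  unfold character
  refine (contDiff_const.mul (Complex.ofRealCLM.contDiff.comp ?_)).cexp
  exact contDiff_snd.inner ℝ contDiff_fst

theorem continuous_shiftConj (g : 𝓢(Rd d, ℂ)) : Continuous (shiftConj g) := by
  refine continuous_schwartz_family (fun l => ?_) fun k l z₀ => ?_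
  · have hG : ContDiff ℝ (⊤ : ℕ∞) fun p : (Rd d × Rd d) × Rd d =>
        star (character p.1.2 p.2 * g (p.2 - p.1.1)) := by
      have h1 : ContDiff ℝ (⊤ : ℕ∞) fun p : (Rd d × Rd d) × Rd d => character p.1.2 p.2 :=
        contDiff_character_uncurry.comp (f := fun p : (Rd d × Rd d) × Rd d => (p.1.2, p.2))
          (by fun_prop)
      have h2 : ContDiff ℝ (⊤ : ℕ∞) fun p : (Rd d × Rd d) × Rd d => g (p.2 - p.1.1) :=
        (g.smooth ⊤).comp (by fun_prop)
      exact Complex.conjCLE.contDiff.comp (h1.mul h2)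
    refine (continuous_iteratedFDeriv_right hG l).congr fun p => ?_
    congr 1
    funext y
    exact (shiftConj_apply g p.1 y).symm
  · obtain ⟨C, -, hC⟩ := exists_seminorm_shiftConj_le g k l
    refine ⟨C * (1 + ‖z₀.1‖) ^ k * (1 + ‖z₀.2‖) ^ l + 1, ?_⟩
    have hcont : Continuous fun z : Rd d × Rd d => C * (1 + ‖z.1‖) ^ k * (1 + ‖z.2‖) ^ l := by
      fun_prop
    filter_upwards [(hcont.tendsto z₀).eventually (gt_mem_nhds (lt_add_one _))] with z hz
    exact (hC z).trans hz.le

end TimeFrequency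


/-! ### Inversion of the short-time Fourier transform -/

section Inversion

variable {d n : ℕ}

/-- The bilinear pairing of a test function with a time-frequency shift of the window. -/
def shiftCoeff (φ g : 𝓢(Rd d, ℂ)) (z : Rd d × Rd d) : ℂ :=
  𝓕⁻ (smulLeftCLM ℂ (translation z.1 g) φ) z.2

theorem shiftCoeff_eq_integral (φ g : 𝓢(Rd d, ℂ)) (z : Rd d × Rd d) :
    shiftCoeff φ g z = ∫ y, conjugate (shiftConj g z) y • φ y := by
  rw [shiftCoeff, SchwartzMap.fourierInv_coe, Real.fourierInv_eq']
  refine integral_congr_ae (Filter.Eventually.of_forall fun y => ?_)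
  have h1 : conjugate (shiftConj g z) y = character z.2 y * g (y - z.1) := by
    change (starRingEnd ℂ) (shiftConj g z y) = _
    rw [shiftConj_apply]
    simp
  simp only [h1, smulLeftCLM_apply_apply (translation z.1 g).hasTemperateGrowth,
    translation_apply, character, smul_eq_mul]
  rw [← mul_assoc]
  congr 3
  push_cast
  ring

theorem continuous_shiftCoeff (φ g : 𝓢(Rd d, ℂ)) : Continuous (shiftCoeff φ g) := by
  have h1 : ∀ z, shiftCoeff φ g z = toTemperedDistributionCLM (Rd d) ℂ volume φ
      (conjugate (shiftConj g z)) := by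
    intro z
    rw [shiftCoeff_eq_integral]
    exact (toTemperedDistributionCLM_apply_apply volume φ _).symm
  rw [funext h1]
  refine (map_continuous (toTemperedDistributionCLM (Rd d) ℂ volume φ)).comp ?_
  exact (ContinuousLinearMap.continuous _).comp (continuous_shiftConj g)

/-- The product of φ with a translate of g decays in the translation in every seminorm, and
continuity of the inverse Fourier transform adds decay in the frequency. -/
theorem exists_norm_shiftCoeff_le (φ g : 𝓢(Rd d, ℂ)) (N : ℕ) : ∃ C : ℝ, 0 ≤ C ∧
    ∀ z, ‖shiftCoeff φ g z‖ ≤ C * (((1 + ‖z.1‖) ^ N)⁻¹ * ((1 + ‖z.2‖) ^ N)⁻¹) := by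
  obtain ⟨s, C, hC, h⟩ := exists_pow_mul_norm_apply_le
    (FourierTransform.fourierInvCLM ℂ 𝓢(Rd d, ℂ)) N
  choose C' hC' h' using fun m : ℕ × ℕ => exists_seminorm_mul_translation_le φ g m.1 m.2 N
  refine ⟨C * ∑ m ∈ s, C' m, mul_nonneg hC (Finset.sum_nonneg fun m _ => hC' m), fun z => ?_⟩
  have h1 := h (smulLeftCLM ℂ (translation z.1 g) φ) z.2
  have h2 : (s.sup (schwartzSeminormFamily ℂ (Rd d) ℂ)) (smulLeftCLM ℂ (translation z.1 g) φ) ≤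
      (∑ m ∈ s, C' m) * ((1 + ‖z.1‖) ^ N)⁻¹ := by
    refine Seminorm.finset_sup_apply_le
      (mul_nonneg (Finset.sum_nonneg fun m _ => hC' m) (by positivity)) fun m hm => ?_
    refine (h' m z.1).trans ?_
    rw [div_eq_mul_inv]
    gcongr
    exact Finset.single_le_sum (f := C') (fun m _ => hC' m) hm
  have h3 : (1 + ‖z.2‖) ^ N * ‖shiftCoeff φ g z‖ ≤
      C * ((∑ m ∈ s, C' m) * ((1 + ‖z.1‖) ^ N)⁻¹) := h1.trans (by gcongr)
  calc ‖shiftCoeff φ g z‖ = ((1 + ‖z.2‖) ^ N)⁻¹ * ((1 + ‖z.2‖) ^ N * ‖shiftCoeff φ g z‖) := by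
        rw [inv_mul_cancel_left₀ (by positivity)]
    _ ≤ ((1 + ‖z.2‖) ^ N)⁻¹ * (C * ((∑ m ∈ s, C' m) * ((1 + ‖z.1‖) ^ N)⁻¹)) := by gcongr
    _ = _ := by ring

theorem integrable_inv_pow {N : ℕ} (hN : d < N) :
    Integrable (fun x : Rd d => ((1 + ‖x‖) ^ N)⁻¹) := by
  have h := integrable_one_add_norm (E := Rd d) (μ := volume) (r := N) (by simpa using hN)
  refine h.congr (Filter.Eventually.of_forall fun x => ?_)
  simp only
  rw [Real.rpow_neg (by positivity), Real.rpow_natCast]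

theorem integrable_inv_pow_prod {N : ℕ} (hN : d < N) :
    Integrable (fun z : Rd d × Rd d => ((1 + ‖z.1‖) ^ N)⁻¹ * ((1 + ‖z.2‖) ^ N)⁻¹) :=
  (integrable_inv_pow hN).mul_prod (integrable_inv_pow hN)

theorem integrable_seminorm_shiftCoeff (φ g : 𝓢(Rd d, ℂ)) (k l : ℕ) :
    Integrable (fun z => SchwartzMap.seminorm ℂ k l (shiftCoeff φ g z • shiftConj g z)) := by
  set N := d + 1 + (k + l)
  obtain ⟨C, hC, h⟩ := exists_norm_shiftCoeff_le φ g N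
  obtain ⟨C', hC', h'⟩ := exists_seminorm_shiftConj_le g k l
  have hcont : Continuous fun z => SchwartzMap.seminorm ℂ k l (shiftCoeff φ g z • shiftConj g z) :=
    ((schwartz_withSeminorms ℂ (Rd d) ℂ).continuous_seminorm (k, l)).comp
      ((continuous_shiftCoeff φ g).smul (continuous_shiftConj g))
  refine ((integrable_inv_pow_prod (d := d) (N := d + 1) (by omega)).const_mul (C * C')).mono'
    hcont.aestronglyMeasurable (Filter.Eventually.of_forall fun z => ?_)
  rw [Real.norm_of_nonneg (apply_nonneg _ _), map_smul_eq_mul]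
  have hx : ∀ (x : Rd d) (a : ℕ), a ≤ k + l →
      ((1 + ‖x‖) ^ N)⁻¹ * (1 + ‖x‖) ^ a ≤ ((1 + ‖x‖) ^ (d + 1))⁻¹ := by
    intro x a ha
    have h1 : (1 + ‖x‖) ^ a ≤ (1 + ‖x‖) ^ (k + l) :=
      pow_le_pow_right₀ (by linarith [norm_nonneg x]) ha
    calc _ ≤ ((1 + ‖x‖) ^ N)⁻¹ * (1 + ‖x‖) ^ (k + l) := by gcongr
      _ = _ := by
        rw [pow_add]
        field_simp
  calc _ ≤ (C * (((1 + ‖z.1‖) ^ N)⁻¹ * ((1 + ‖z.2‖) ^ N)⁻¹)) *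
        (C' * (1 + ‖z.1‖) ^ k * (1 + ‖z.2‖) ^ l) := by
        gcongr
        · exact h z
        · exact h' z
    _ = (C * C') * ((((1 + ‖z.1‖) ^ N)⁻¹ * (1 + ‖z.1‖) ^ k) *
        (((1 + ‖z.2‖) ^ N)⁻¹ * (1 + ‖z.2‖) ^ l)) := by ring
    _ ≤ _ := by
        gcongr
        · exact hx _ _ (by omega)
        · exact hx _ _ (by omega)

/-- The squared `L²` norm of a window. -/
def energy (g : 𝓢(Rd d, ℂ)) : ℝ := ∫ y, ‖g y‖ ^ 2

theorem energy_pos {g : 𝓢(Rd d, ℂ)} (hg : g ≠ 0) : 0 < energy g := by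
  obtain ⟨y, hy⟩ := DFunLike.ne_iff.1 hg
  have hc : Continuous fun y => ‖g y‖ ^ 2 := by fun_prop
  have hInt : Integrable fun y => ‖g y‖ ^ 2 :=
    (memLp_two_iff_integrable_sq_norm g.continuous.aestronglyMeasurable).1 (g.memLp 2 volume)
  exact integral_pos_of_integrable_nonneg_nonzero (x := y) hc hInt (fun _ => by positivity)
    (by simpa using hy)

/-- For fixed x the frequency integral is Fourier inversion for φ times the translate of g;
integrating over x then produces ‖g‖². -/
theorem integral_shiftCoeff_smul_shiftConj (φ g : 𝓢(Rd d, ℂ)) (y : Rd d) :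
    ∫ z, (shiftCoeff φ g z • shiftConj g z) y = (energy g : ℂ) * φ y := by
  have hInt : Integrable fun z => (shiftCoeff φ g z • shiftConj g z) y := by
    have h1 := integrable_iteratedFDeriv_family ((continuous_shiftCoeff φ g).smul
      (continuous_shiftConj g)) (integrable_seminorm_shiftCoeff φ g) 0 y
    refine h1.norm.mono' ?_ (Filter.Eventually.of_forall fun z => ?_)
    · refine Continuous.aestronglyMeasurable ?_
      simp only [smul_apply, shiftConj_apply]
      have hch : Continuous fun z : Rd d × Rd d => character z.2 y :=
        contDiff_character_uncurry.continuous.comp (by fun_prop :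
          Continuous fun z : Rd d × Rd d => (z.2, y))
      exact (continuous_shiftCoeff φ g).smul (continuous_star.comp
        (hch.mul (g.continuous.comp (by fun_prop))))
    · rw [norm_iteratedFDeriv_zero]
      exact le_rfl
  rw [Measure.volume_eq_prod, integral_prod _ hInt]
  have hinner : ∀ x : Rd d, ∫ ξ, (shiftCoeff φ g (x, ξ) • shiftConj g (x, ξ)) y =
      ((‖g (y - x)‖ ^ 2 : ℝ) : ℂ) * φ y := by
    intro x
    set h := smulLeftCLM ℂ (translation x g) φ with hh
    have h1 : ∀ ξ, (shiftCoeff φ g (x, ξ) • shiftConj g (x, ξ)) y =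
        star (g (y - x)) * (Complex.exp ((-2 * Real.pi * ⟪ξ, y⟫_ℝ : ℝ) * Complex.I) •
          (𝓕⁻ h : 𝓢(Rd d, ℂ)) ξ) := by
      intro ξ
      simp only [smul_apply, shiftConj_apply, shiftCoeff, smul_eq_mul, character, star_mul',
        ← hh]
      have h2 : star (Complex.exp (2 * Real.pi * Complex.I * (⟪y, ξ⟫_ℝ : ℝ))) =
          Complex.exp ((-2 * Real.pi * ⟪ξ, y⟫_ℝ : ℝ) * Complex.I) := by
        rw [real_inner_comm ξ y]
        change (starRingEnd ℂ) _ = _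
        rw [← Complex.exp_conj]
        congr 1
        simp [Complex.conj_ofNat]
        ring
      rw [h2]
      ring
    simp_rw [h1]
    rw [integral_const_mul, ← Real.fourier_eq', ← SchwartzMap.fourier_coe,
      FourierTransform.fourier_fourierInv_eq, hh,
      smulLeftCLM_apply_apply (translation x g).hasTemperateGrowth, translation_apply, smul_eq_mul,
      ← mul_assoc]
    congr 1
    change (starRingEnd ℂ) _ * _ = _
    rw [mul_comm, Complex.mul_conj, Complex.normSq_eq_norm_sq]
  simp_rw [hinner]
  rw [integral_mul_const, integral_complex_ofReal]
  congr 2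
  rw [energy]
  exact integral_sub_left_eq_self (fun x => ‖g x‖ ^ 2) volume y

/-- The inversion formula for the short-time Fourier transform of a distribution. -/
theorem stft_inversion (g φ : 𝓢(Rd d, ℂ)) (f : 𝓢'(Rd d, Cn n)) :
    Integrable (fun z : Rd d × Rd d => shiftCoeff φ g z • stft g f z.1 z.2) ∧
      (energy g : ℂ) • f φ = ∫ z : Rd d × Rd d, shiftCoeff φ g z • stft g f z.1 z.2 := by
  have key := fun i : Fin n => apply_eq_integral_of_family
    ((continuous_shiftCoeff φ g).smul (continuous_shiftConj g))
    (integrable_seminorm_shiftCoeff φ g) (Ψ := (energy g : ℂ) • φ)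
    (fun y => (integral_shiftCoeff_smul_shiftConj φ g y).symm)
    ((EuclideanSpace.proj i : Cn n →L[ℂ] ℂ) ∘L distCLM f)
  have hst : ∀ z : Rd d × Rd d, shiftCoeff φ g z • stft g f z.1 z.2 =
      distCLM f (shiftCoeff φ g z • shiftConj g z) := by
    intro z
    rw [map_smul]
    rfl
  have hInt : Integrable (fun z : Rd d × Rd d => shiftCoeff φ g z • stft g f z.1 z.2) := by
    have h1 : Integrable fun z => ∑ i, ‖distCLM f (shiftCoeff φ g z • shiftConj g z) i‖ :=
      integrable_finsetSum _ fun i _ => (key i).1.norm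
    simp_rw [hst]
    refine h1.mono' ?_ (Filter.Eventually.of_forall fun z => ?_)
    · exact ((distCLM f).continuous.comp ((continuous_shiftCoeff φ g).smul
        (continuous_shiftConj g))).aestronglyMeasurable
    · set v := distCLM f (shiftCoeff φ g z • shiftConj g z)
      have hv : v = ∑ i, v i • (EuclideanSpace.single i (1 : ℂ) : Cn n) := by
        ext j; simp [Pi.single_apply]
      calc ‖v‖ = ‖∑ i, v i • (EuclideanSpace.single i (1 : ℂ) : Cn n)‖ := by rw [← hv]
        _ ≤ ∑ i, ‖v i • (EuclideanSpace.single i (1 : ℂ) : Cn n)‖ := norm_sum_le _ _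
        _ = ∑ i, ‖v i‖ := by simp [norm_smul]
  refine ⟨hInt, ?_⟩
  ext i
  have h2 := (key i).2
  have h3 := (EuclideanSpace.proj i : Cn n →L[ℂ] ℂ).integral_comp_comm hInt
  change (energy g : ℂ) * f φ i = (EuclideanSpace.proj i : Cn n →L[ℂ] ℂ) _
  rw [← h3]
  simp_rw [hst]
  refine Eq.trans ?_ h2
  simp

end Inversion


/-! ### The Gabor matrix of a Fourier multiplier -/

section Kernel

variable {d n : ℕ}

/-- The Fourier multiplier acting on test functions. -/
def fourierMul (u : Rd d → ℂ) (φ : 𝓢(Rd d, ℂ)) : 𝓢(Rd d, ℂ) := 𝓕 (smulLeftCLM ℂ u (𝓕⁻ φ))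

/-- The symbol of the Gabor kernel of a Fourier multiplier. -/
def gaborSymb (u : Rd d → ℂ) (g : 𝓢(Rd d, ℂ)) (ξ ζ : Rd d) : 𝓢(Rd d, ℂ) :=
  smulLeftCLM ℂ (fun η => u (η + ξ)) (smulLeftCLM ℂ (translation ζ (𝓕 g)) (conjugate (𝓕 g)))

theorem hasTemperateGrowth_comp_add {u : Rd d → ℂ} (hu : u.HasTemperateGrowth) (ξ : Rd d) :
    (fun η => u (η + ξ)).HasTemperateGrowth :=
  hu.comp (Function.HasTemperateGrowth.id.add (Function.HasTemperateGrowth.const ξ))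

theorem gaborSymb_apply {u : Rd d → ℂ} (hu : u.HasTemperateGrowth) (g : 𝓢(Rd d, ℂ))
    (ξ ζ η : Rd d) : gaborSymb u g ξ ζ η = u (η + ξ) * ((𝓕 g) (η - ζ) * star ((𝓕 g) η)) := by
  rw [gaborSymb, smulLeftCLM_apply_apply (hasTemperateGrowth_comp_add hu ξ),
    smulLeftCLM_apply_apply (translation ζ (𝓕 g)).hasTemperateGrowth, translation_apply]
  rfl

theorem character_add_left (ξ ξ' y : Rd d) :
    character (ξ + ξ') y = character ξ y * character ξ' y := by
  rw [character, character, character, ← Complex.exp_add, inner_add_right]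
  push_cast
  ring_nf

theorem character_add_right (ξ y y' : Rd d) :
    character ξ (y + y') = character ξ y * character ξ y' := by
  rw [character, character, character, ← Complex.exp_add, inner_add_left]
  push_cast
  ring_nf

theorem character_comm (ξ y : Rd d) : character ξ y = character y ξ := by
  rw [character, character, real_inner_comm]

theorem star_character (ξ y : Rd d) : star (character ξ y) = character (-ξ) y := by
  rw [character, character, inner_neg_right]
  change (starRingEnd ℂ) _ = _
  rw [← Complex.exp_conj]
  congr 1
  simp [Complex.conj_ofNat]

theorem norm_character (ξ y : Rd d) : ‖character ξ y‖ = 1 := by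
  have hre : (2 * (Real.pi : ℂ) * Complex.I * ((⟪y, ξ⟫_ℝ : ℝ) : ℂ)).re = 0 := by simp
  rw [character, Complex.norm_exp, hre, Real.exp_zero]

theorem fourier_eq_integral_character (f : 𝓢(Rd d, ℂ)) (η : Rd d) :
    (𝓕 f) η = ∫ y, character (-η) y * f y := by
  rw [SchwartzMap.fourier_coe, Real.fourier_eq']
  refine integral_congr_ae (Filter.Eventually.of_forall fun y => ?_)
  simp only [character, smul_eq_mul, inner_neg_right]
  congr 2
  push_cast
  ring

theorem fourierInv_eq_integral_character (f : 𝓢(Rd d, ℂ)) (η : Rd d) :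
    (𝓕⁻ f) η = ∫ y, character η y * f y := by
  rw [SchwartzMap.fourierInv_coe, Real.fourierInv_eq']
  refine integral_congr_ae (Filter.Eventually.of_forall fun y => ?_)
  simp only [character, smul_eq_mul]
  congr 2
  push_cast
  ring

theorem conjugate_shiftConj_apply (g : 𝓢(Rd d, ℂ)) (z : Rd d × Rd d) (y : Rd d) :
    conjugate (shiftConj g z) y = character z.2 y * g (y - z.1) := by
  change (starRingEnd ℂ) (shiftConj g z y) = _
  rw [shiftConj_apply]
  simp

theorem fourier_conjugate_shiftConj (g : 𝓢(Rd d, ℂ)) (z : Rd d × Rd d) (η : Rd d) :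
    𝓕 (conjugate (shiftConj g z)) η = character (z.2 - η) z.1 * (𝓕 g) (η - z.2) := by
  rw [fourier_eq_integral_character, fourier_eq_integral_character,
    ← integral_add_right_eq_self _ z.1, ← integral_const_mul]
  refine integral_congr_ae (Filter.Eventually.of_forall fun y => ?_)
  simp only
  rw [conjugate_shiftConj_apply, add_sub_cancel_right, ← mul_assoc, ← mul_assoc,
    ← character_add_left, character_add_right]
  rw [show -η + z.2 = z.2 - η by abel, show -(η - z.2) = z.2 - η by abel]
  ring

theorem fourierInv_shiftConj (g : 𝓢(Rd d, ℂ)) (z : Rd d × Rd d) (η : Rd d) :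
    𝓕⁻ (shiftConj g z) η = star (𝓕 (conjugate (shiftConj g z)) η) := by
  rw [fourier_eq_integral_character, fourierInv_eq_integral_character]
  change _ = (starRingEnd ℂ) _
  rw [← integral_conj]
  refine integral_congr_ae (Filter.Eventually.of_forall fun y => ?_)
  simp only
  rw [map_mul]
  change _ = star _ * (starRingEnd ℂ) ((starRingEnd ℂ) (shiftConj g z y))
  rw [star_character, neg_neg, Complex.conj_conj]

/-- The Gabor matrix of a Fourier multiplier is a convolution kernel in the space variables. -/
theorem shiftCoeff_fourierMul {u : Rd d → ℂ} (hu : u.HasTemperateGrowth) (g : 𝓢(Rd d, ℂ))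
    (x ξ x' ξ' : Rd d) : shiftCoeff (fourierMul u (shiftConj g (x, ξ))) g (x', ξ') =
      character (ξ' - ξ) x' * 𝓕⁻ (gaborSymb u g ξ (ξ' - ξ)) (x - x') := by
  rw [shiftCoeff_eq_integral, fourierMul]
  simp only [smul_eq_mul]
  -- Moving the Fourier transform across the pairing leaves a product of transforms of the two
  -- windows and the symbol. The substitution η ↦ η + ξ centres one window at the origin.
  rw [← SchwartzMap.integral_fourier_mul_eq, fourierInv_eq_integral_character,
    ← integral_const_mul, ← integral_add_right_eq_self _ ξ]
  refine integral_congr_ae (Filter.Eventually.of_forall fun η => ?_)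
  simp only
  rw [smulLeftCLM_apply_apply hu, fourierInv_shiftConj, fourier_conjugate_shiftConj,
    fourier_conjugate_shiftConj, gaborSymb_apply hu, star_mul', star_character]
  simp only [add_sub_cancel_right, smul_eq_mul]
  rw [show η + ξ - ξ' = η - (ξ' - ξ) by abel, show ξ' - (η + ξ) = (ξ' - ξ) + -η by abel,
    show -(ξ - (η + ξ)) = η by abel, character_add_left, character_comm (x - x') η,
    sub_eq_add_neg x x', character_add_right η, show character η (-x') = character (-η) x' by
      rw [character, character, inner_neg_left, inner_neg_right]]
  ring

/-- Symbols whose derivatives of order `j` are bounded by `R ^ j`. -/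
structure SymbolBound (R : ℝ) (u : Rd d → ℂ) : Prop where
  temperate : u.HasTemperateGrowth
  bound : ∀ j y, ‖iteratedFDeriv ℝ j u y‖ ≤ R ^ j

/-- Each derivative of u costs R. The decay in ζ comes from the overlap of two windows at distance
ζ, and translating u by ξ changes none of its bounds. -/
theorem exists_seminorm_gaborSymb_le (g : 𝓢(Rd d, ℂ)) (k l N : ℕ) : ∃ C : ℝ, 0 ≤ C ∧
    ∀ (R : ℝ) (u : Rd d → ℂ), 1 ≤ R → SymbolBound R u → ∀ ξ ζ,
      SchwartzMap.seminorm ℂ k l (gaborSymb u g ξ ζ) ≤ C * R ^ l / (1 + ‖ζ‖) ^ N := by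
  obtain ⟨C₁, hC₁, h₁⟩ := exists_seminorm_smulLeftCLM_le (d := d) k l 0
  choose C₂ hC₂ h₂ using fun m : ℕ × ℕ =>
    exists_seminorm_mul_translation_le (conjugate (𝓕 g)) (𝓕 g) m.1 m.2 N
  have hsum : 0 ≤ ∑ m ∈ Finset.Iic (0 + k, l), C₂ m := Finset.sum_nonneg fun m _ => hC₂ m
  refine ⟨C₁ * ∑ m ∈ Finset.Iic (0 + k, l), C₂ m, by positivity, fun R u hR hu ξ ζ => ?_⟩
  refine (h₁ _ (hasTemperateGrowth_comp_add hu.temperate ξ) (R ^ l) (by positivity)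
    (fun j hj η => ?_) _).trans ?_
  · rw [iteratedFDeriv_comp_add_right, pow_zero, mul_one]
    exact (hu.bound j _).trans (pow_le_pow_right₀ hR hj)
  · have h3 : (Finset.Iic (0 + k, l)).sup (schwartzSeminormFamily ℂ (Rd d) ℂ)
        (smulLeftCLM ℂ (translation ζ (𝓕 g)) (conjugate (𝓕 g))) ≤
        (∑ m ∈ Finset.Iic (0 + k, l), C₂ m) / (1 + ‖ζ‖) ^ N := by
      refine Seminorm.finset_sup_apply_le (by positivity) fun m hm => (h₂ m ζ).trans ?_
      gcongr
      exact Finset.single_le_sum (f := C₂) (fun m _ => hC₂ m) hm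
    calc _ ≤ C₁ * R ^ l * ((∑ m ∈ Finset.Iic (0 + k, l), C₂ m) / (1 + ‖ζ‖) ^ N) := by gcongr
      _ = _ := by ring

/-- With no derivatives there is no power of R: this is the L² multiplier bound, uniform in time. -/
theorem exists_norm_gaborSymb_le (g : 𝓢(Rd d, ℂ)) (N : ℕ) : ∃ C : ℝ, 0 ≤ C ∧
    ∀ (R : ℝ) (u : Rd d → ℂ), 1 ≤ R → SymbolBound R u → ∀ ξ ζ η,
      ‖gaborSymb u g ξ ζ η‖ ≤ C / (1 + ‖ζ‖) ^ N := by
  obtain ⟨C, hC, h⟩ := exists_seminorm_gaborSymb_le g 0 0 N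
  refine ⟨C, hC, fun R u hR hu ξ ζ η => ?_⟩
  simpa using (SchwartzMap.norm_le_seminorm ℂ _ η).trans (h R u hR hu ξ ζ)

/-- Here the constant may depend on R: pointwise decay in both variables is all that boundedness at
a fixed time requires. -/
theorem exists_norm_fourierInv_gaborSymb_le (g : 𝓢(Rd d, ℂ)) (N : ℕ) {R : ℝ} (hR : 1 ≤ R) :
    ∃ C : ℝ, 0 ≤ C ∧ ∀ u : Rd d → ℂ, SymbolBound R u → ∀ ξ ζ x,
      ‖𝓕⁻ (gaborSymb u g ξ ζ) x‖ ≤ C * (((1 + ‖x‖) ^ N)⁻¹ * ((1 + ‖ζ‖) ^ N)⁻¹) := by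
  obtain ⟨s, C, hC, h⟩ := exists_pow_mul_norm_apply_le
    (FourierTransform.fourierInvCLM ℂ 𝓢(Rd d, ℂ)) N
  choose C' hC' h' using fun m : ℕ × ℕ => exists_seminorm_gaborSymb_le g m.1 m.2 N
  have hsum : 0 ≤ ∑ m ∈ s, C' m * R ^ m.2 :=
    Finset.sum_nonneg fun m _ => mul_nonneg (hC' m) (by positivity)
  refine ⟨C * ∑ m ∈ s, C' m * R ^ m.2, by positivity, fun u hu ξ ζ x => ?_⟩
  have h2 : (s.sup (schwartzSeminormFamily ℂ (Rd d) ℂ)) (gaborSymb u g ξ ζ) ≤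
      (∑ m ∈ s, C' m * R ^ m.2) * ((1 + ‖ζ‖) ^ N)⁻¹ := by
    refine Seminorm.finset_sup_apply_le (by positivity) fun m hm => ?_
    refine (h' m R u hR hu ξ ζ).trans ?_
    rw [div_eq_mul_inv]
    gcongr
    exact Finset.single_le_sum (f := fun m : ℕ × ℕ => C' m * R ^ m.2)
      (fun m _ => mul_nonneg (hC' m) (by positivity)) hm
  have h3 : (1 + ‖x‖) ^ N * ‖𝓕⁻ (gaborSymb u g ξ ζ) x‖ ≤
      C * ((∑ m ∈ s, C' m * R ^ m.2) * ((1 + ‖ζ‖) ^ N)⁻¹) :=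
    (h (gaborSymb u g ξ ζ) x).trans (by gcongr)
  calc ‖𝓕⁻ (gaborSymb u g ξ ζ) x‖ =
      ((1 + ‖x‖) ^ N)⁻¹ * ((1 + ‖x‖) ^ N * ‖𝓕⁻ (gaborSymb u g ξ ζ) x‖) := by
        rw [inv_mul_cancel_left₀ (by positivity)]
    _ ≤ ((1 + ‖x‖) ^ N)⁻¹ * (C * ((∑ m ∈ s, C' m * R ^ m.2) * ((1 + ‖ζ‖) ^ N)⁻¹)) := by gcongr
    _ = _ := by ring

end Kernel

/-! ### Weighted Plancherel identities -/

section WeightedPlancherel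

variable {d : ℕ}

theorem fourierInv_iterate_lineDerivOp (h : 𝓢(Rd d, ℂ)) (v : Rd d) (M : ℕ) (x : Rd d) :
    𝓕⁻ (∂^{fun _ : Fin M => v} h) x = (-(2 * Real.pi * Complex.I) * (⟪x, v⟫_ℝ : ℝ)) ^ M *
      𝓕⁻ h x := by
  induction M with
  | zero => simp
  | succ M ih =>
    have hv : Function.HasTemperateGrowth (fun x : Rd d => ⟪x, v⟫_ℝ) := by fun_prop
    rw [LineDeriv.iteratedLineDerivOp_succ_left, SchwartzMap.fourierInv_lineDerivOp_eq, smul_apply,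
      smulLeftCLM_apply_apply hv]
    have : (Fin.tail fun _ : Fin (M + 1) => v) = fun _ : Fin M => v := rfl
    rw [this, ih, pow_succ]
    simp only [smul_eq_mul, Complex.real_smul]
    ring

theorem integral_norm_sq_fourierInv (h : 𝓢(Rd d, ℂ)) :
    ∫ x, ‖𝓕⁻ h x‖ ^ 2 = ∫ x, ‖h x‖ ^ 2 := by
  have h1 := SchwartzMap.integral_norm_sq_fourier (𝓕⁻ h)
  rw [FourierTransform.fourier_fourierInv_eq] at h1
  exact h1.symm

theorem integrable_norm_sq (h : 𝓢(Rd d, ℂ)) : Integrable fun x => ‖h x‖ ^ 2 :=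
  (memLp_two_iff_integrable_sq_norm h.continuous.aestronglyMeasurable).1 (h.memLp 2 volume)

theorem norm_pow_le_sum_coord (M : ℕ) (x : Rd d) :
    ‖x‖ ^ (2 * M) ≤ 1 + (d : ℝ) ^ M * ∑ i, |x i| ^ (2 * M) := by
  rcases Nat.eq_zero_or_pos d with rfl | hd
  · have : x = 0 := Subsingleton.elim _ _
    rw [this, norm_zero]
    have : (0 : ℝ) ^ (2 * M) ≤ 1 := pow_le_one₀ le_rfl zero_le_one
    simpa using this
  have : Nonempty (Fin d) := ⟨⟨0, hd⟩⟩
  obtain ⟨i, hi⟩ := Finite.exists_max fun i : Fin d => |x i|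
  have h1 : ‖x‖ ^ 2 ≤ d * |x i| ^ 2 := by
    rw [EuclideanSpace.norm_sq_eq]
    calc ∑ j, ‖x j‖ ^ 2 ≤ ∑ _j : Fin d, |x i| ^ 2 :=
          Finset.sum_le_sum fun j _ => by
            rw [Real.norm_eq_abs]
            exact pow_le_pow_left₀ (abs_nonneg _) (hi j) 2
      _ = _ := by simp
  calc ‖x‖ ^ (2 * M) = (‖x‖ ^ 2) ^ M := by rw [pow_mul]
    _ ≤ (d * |x i| ^ 2) ^ M := by gcongr
    _ = (d : ℝ) ^ M * |x i| ^ (2 * M) := by rw [mul_pow, pow_mul]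
    _ ≤ (d : ℝ) ^ M * ∑ i, |x i| ^ (2 * M) := by
      gcongr
      exact Finset.single_le_sum (f := fun i => |x i| ^ (2 * M)) (fun _ _ => by positivity)
        (Finset.mem_univ i)
    _ ≤ _ := by linarith

end WeightedPlancherel


/-! ### The integral of a Fourier transform -/

section IntegralBound

variable {d : ℕ}

theorem integrable_inv_one_add_pow (d : ℕ) :
    Integrable fun x : Rd d => (1 + ‖x‖ ^ (2 * (d + 1)))⁻¹ := by
  have h1 := (integrable_inv_pow (d := d) (N := 2 * (d + 1)) (by omega)).const_mul
    (2 ^ (2 * (d + 1) - 1))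
  have hc : Continuous fun x : Rd d => (1 + ‖x‖ ^ (2 * (d + 1)))⁻¹ :=
    Continuous.inv₀ (by fun_prop) fun x => by positivity
  refine h1.mono' hc.aestronglyMeasurable (Filter.Eventually.of_forall fun x => ?_)
  rw [Real.norm_of_nonneg (by positivity), ← div_eq_mul_inv, le_div_iff₀ (by positivity),
    inv_mul_le_iff₀ (by positivity)]
  have h2 := add_pow_le zero_le_one (norm_nonneg x) (2 * (d + 1))
  rw [one_pow] at h2
  linarith

theorem norm_sq_lineDeriv_le {h : 𝓢(Rd d, ℂ)} {M : ℕ} {B R : ℝ} {η v : Rd d} (hv : ‖v‖ = 1)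
    (hb : ‖iteratedFDeriv ℝ M h η‖ ≤ B * R ^ M / (1 + ‖η‖) ^ (d + 1)) :
    ‖(∂^{fun _ : Fin M => v} h) η‖ ^ 2 ≤
      B ^ 2 * R ^ (2 * M) * ((1 + ‖η‖) ^ (2 * (d + 1)))⁻¹ := by
  rw [SchwartzMap.iteratedLineDerivOp_eq_iteratedFDeriv]
  have h1 : ‖iteratedFDeriv ℝ M h η fun _ => v‖ ≤ ‖iteratedFDeriv ℝ M h η‖ := by
    refine (ContinuousMultilinearMap.le_opNorm _ _).trans ?_
    simp [hv]
  calc _ ≤ (B * R ^ M / (1 + ‖η‖) ^ (d + 1)) ^ 2 :=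
        pow_le_pow_left₀ (norm_nonneg _) (h1.trans hb) 2
    _ = _ := by rw [div_pow, mul_pow, ← pow_mul, ← pow_mul, div_eq_mul_inv]; ring_nf

/-- The `L¹` norm of the Fourier transform of a function living at scale one whose derivatives of
order `j` have size `R ^ j` is at most a multiple of `R ^ (d / 2)`. -/
theorem exists_integral_norm_fourierInv_le (d : ℕ) : ∃ C : ℝ, 0 < C ∧
    ∀ (h : 𝓢(Rd d, ℂ)) (R B : ℝ), 1 ≤ R → 0 < B →
      (∀ j ≤ d + 1, ∀ η, ‖iteratedFDeriv ℝ j h η‖ ≤ B * R ^ j / (1 + ‖η‖) ^ (d + 1)) →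
      ∫ x, ‖𝓕⁻ h x‖ ≤ C * B * R ^ ((d : ℝ) / 2) := by
  set M := d + 1 with hM
  set I := ∫ η : Rd d, ((1 + ‖η‖) ^ (2 * (d + 1)))⁻¹ with hI
  set J := ∫ x : Rd d, (1 + ‖x‖ ^ (2 * (d + 1)))⁻¹ with hJ
  have hI0 : 0 ≤ I := integral_nonneg fun _ => by positivity
  have hJ0 : 0 ≤ J := integral_nonneg fun _ => by positivity
  have hIint := integrable_inv_pow (d := d) (N := 2 * (d + 1)) (by omega)
  refine ⟨1 + (J + (2 * I + (d : ℝ) ^ M * (d * I))) / 2, by positivity,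
    fun h R B hR hB hb => ?_⟩
  have hR0 : 0 < R := by linarith
  set k := (𝓕⁻ h : 𝓢(Rd d, ℂ)) with hk
  set e : Fin d → Rd d := fun i => EuclideanSpace.single i (1 : ℝ) with he
  set Dk : Fin d → 𝓢(Rd d, ℂ) := fun i => 𝓕⁻ (∂^{fun _ : Fin M => e i} h) with hDk
  -- The balancing parameter of the Young inequality below: the weight has integral of order R^d and
  -- the weighted L² norm is of order B, so both terms become multiples of B R^{d/2}.
  set lam := B * R ^ (-((d : ℝ) / 2)) with hlam
  have hlam0 : 0 < lam := by positivity
  have hL2 : ∫ x, ‖k x‖ ^ 2 ≤ B ^ 2 * I := by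
    rw [hk, integral_norm_sq_fourierInv, hI, ← integral_const_mul]
    refine integral_mono (integrable_norm_sq h) (hIint.const_mul _) fun η => ?_
    have h1 := hb 0 (by omega) η
    rw [norm_iteratedFDeriv_zero, pow_zero, mul_one] at h1
    calc ‖h η‖ ^ 2 ≤ (B / (1 + ‖η‖) ^ (d + 1)) ^ 2 := pow_le_pow_left₀ (norm_nonneg _) h1 2
      _ = _ := by rw [div_pow, ← pow_mul, div_eq_mul_inv]; ring_nf
  have hDL2 : ∀ i, ∫ x, ‖Dk i x‖ ^ 2 ≤ R ^ (2 * M) * (B ^ 2 * I) := by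
    intro i
    rw [hDk]
    simp only
    rw [integral_norm_sq_fourierInv, hI, ← integral_const_mul, ← integral_const_mul]
    refine integral_mono (integrable_norm_sq _) ((hIint.const_mul _).const_mul _) fun η => ?_
    refine (norm_sq_lineDeriv_le (by simp [he]) (hb M le_rfl η)).trans (le_of_eq ?_)
    ring
  have hcoord : ∀ i x, |x i| ^ (2 * M) * ‖k x‖ ^ 2 ≤ ‖Dk i x‖ ^ 2 := by
    intro i x
    rw [hDk]
    simp only
    rw [fourierInv_iterate_lineDerivOp, norm_mul, norm_pow, norm_mul, mul_pow, ← hk]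
    have h1 : ‖((⟪x, e i⟫_ℝ : ℝ) : ℂ)‖ = |x i| := by
      rw [Complex.norm_real, he, EuclideanSpace.inner_single_right]
      simp
    have h2 : ‖-(2 * (Real.pi : ℂ) * Complex.I)‖ = 2 * Real.pi := by
      simp [abs_of_pos Real.pi_pos]
    rw [h1, h2, ← pow_mul, mul_comm M 2, mul_pow]
    have h3 : 1 ≤ (2 * Real.pi) ^ (2 * M) :=
      one_le_pow₀ (by linarith [Real.pi_gt_three])
    have h4 : 0 ≤ |x i| ^ (2 * M) * ‖k x‖ ^ 2 := by positivity
    nlinarith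
  -- With W = 1 + |x/R|^{2(d+1)}, the inequality ‖k‖ ≤ λ/(2W) + W‖k‖²/(2λ) plays the part of
  -- Cauchy–Schwarz. The weighted square is controlled by Plancherel for the pure derivatives of h
  -- of order d + 1, each costing R per derivative and regaining it from the scaling of x.
  set V : Rd d → ℝ := fun x => lam / 2 * (1 + ‖R⁻¹ • x‖ ^ (2 * (d + 1)))⁻¹ +
    (2 * lam)⁻¹ * (2 * ‖k x‖ ^ 2 + (d : ℝ) ^ M * ∑ i, (R ^ (2 * M))⁻¹ * ‖Dk i x‖ ^ 2) with hV
  have hInt1 : Integrable fun x : Rd d => (1 + ‖R⁻¹ • x‖ ^ (2 * (d + 1)))⁻¹ :=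
    (integrable_inv_one_add_pow d).comp_smul (inv_ne_zero hR0.ne')
  have hInt2 : Integrable fun x => ∑ i, (R ^ (2 * M))⁻¹ * ‖Dk i x‖ ^ 2 :=
    integrable_finsetSum _ fun i _ => (integrable_norm_sq (Dk i)).const_mul _
  have hInt3 : Integrable fun x => 2 * ‖k x‖ ^ 2 +
      (d : ℝ) ^ M * ∑ i, (R ^ (2 * M))⁻¹ * ‖Dk i x‖ ^ 2 :=
    ((integrable_norm_sq k).const_mul 2).add (hInt2.const_mul _)
  have hVint : Integrable V := (hInt1.const_mul _).add (hInt3.const_mul _)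
  have hpt : ∀ x, ‖k x‖ ≤ V x := by
    intro x
    set W := 1 + ‖R⁻¹ • x‖ ^ (2 * (d + 1)) with hW
    have hW0 : 0 < W := by positivity
    have h1 : W * ‖k x‖ ^ 2 ≤ 2 * ‖k x‖ ^ 2 +
        (d : ℝ) ^ M * ∑ i, (R ^ (2 * M))⁻¹ * ‖Dk i x‖ ^ 2 := by
      have h2 := norm_pow_le_sum_coord M (R⁻¹ • x)
      have h3 : ∑ i, |(R⁻¹ • x) i| ^ (2 * M) * ‖k x‖ ^ 2 ≤
          ∑ i, (R ^ (2 * M))⁻¹ * ‖Dk i x‖ ^ 2 := by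
        refine Finset.sum_le_sum fun i _ => ?_
        have h4 : |(R⁻¹ • x) i| ^ (2 * M) = (R ^ (2 * M))⁻¹ * |x i| ^ (2 * M) := by
          rw [PiLp.smul_apply, smul_eq_mul, abs_mul, mul_pow, abs_of_pos (inv_pos.2 hR0), inv_pow]
        rw [h4, mul_assoc]
        gcongr
        exact hcoord i x
      calc W * ‖k x‖ ^ 2 ≤ (2 + (d : ℝ) ^ M * ∑ i, |(R⁻¹ • x) i| ^ (2 * M)) * ‖k x‖ ^ 2 := by
            gcongr
            rw [hW]
            linarith
        _ = 2 * ‖k x‖ ^ 2 + (d : ℝ) ^ M * ∑ i, |(R⁻¹ • x) i| ^ (2 * M) * ‖k x‖ ^ 2 := by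
            rw [← Finset.sum_mul]; ring
        _ ≤ _ := by gcongr
    have h5 : ‖k x‖ ≤ lam / 2 * W⁻¹ + (2 * lam)⁻¹ * (W * ‖k x‖ ^ 2) := by
      have h6 : lam / 2 * W⁻¹ + (2 * lam)⁻¹ * (W * ‖k x‖ ^ 2) - ‖k x‖ =
          (2 * lam * W)⁻¹ * (lam - W * ‖k x‖) ^ 2 := by
        field_simp
        ring
      have h7 : 0 ≤ (2 * lam * W)⁻¹ * (lam - W * ‖k x‖) ^ 2 := by positivity
      linarith
    refine h5.trans ?_
    rw [hV]
    simp only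
    gcongr
  have hscale : ∫ x : Rd d, (1 + ‖R⁻¹ • x‖ ^ (2 * (d + 1)))⁻¹ = R ^ d * J := by
    have := Measure.integral_comp_inv_smul_of_nonneg (volume : Measure (Rd d))
      (fun x : Rd d => (1 + ‖x‖ ^ (2 * (d + 1)))⁻¹) hR0.le
    rw [this]
    simp [hJ]
  calc ∫ x, ‖k x‖ ≤ ∫ x, V x := integral_mono k.integrable.norm hVint hpt
    _ = lam / 2 * (R ^ d * J) + (2 * lam)⁻¹ * (2 * (∫ x, ‖k x‖ ^ 2) +
        (d : ℝ) ^ M * ∑ i, (R ^ (2 * M))⁻¹ * ∫ x, ‖Dk i x‖ ^ 2) := by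
      rw [hV, integral_add (hInt1.const_mul _) (hInt3.const_mul _), integral_const_mul,
        integral_const_mul, integral_add ((integrable_norm_sq k).const_mul 2) (hInt2.const_mul _),
        integral_const_mul, integral_const_mul, integral_finsetSum _ fun i _ =>
          (integrable_norm_sq (Dk i)).const_mul _, hscale]
      simp_rw [integral_const_mul]
    _ ≤ lam / 2 * (R ^ d * J) + (2 * lam)⁻¹ * (2 * (B ^ 2 * I) +
        (d : ℝ) ^ M * ∑ _i : Fin d, (R ^ (2 * M))⁻¹ * (R ^ (2 * M) * (B ^ 2 * I))) := by
      gcongr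
      exact hDL2 _
    _ = lam / 2 * (R ^ d * J) + (2 * lam)⁻¹ * (B ^ 2 * (2 * I + (d : ℝ) ^ M * (d * I))) := by
      congr 2
      rw [inv_mul_cancel_left₀ (by positivity)]
      simp
      ring
    _ = (J + (2 * I + (d : ℝ) ^ M * (d * I))) / 2 * B * R ^ ((d : ℝ) / 2) := by
      have h1 : R ^ (-((d : ℝ) / 2)) * R ^ d = R ^ ((d : ℝ) / 2) := by
        rw [← Real.rpow_natCast R d, ← Real.rpow_add hR0]
        congr 1
        ring
      have h2 : (2 * lam)⁻¹ * B ^ 2 = B * R ^ ((d : ℝ) / 2) / 2 := by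
        rw [hlam, Real.rpow_neg hR0.le]
        field_simp
      rw [← mul_assoc (2 * lam)⁻¹, h2, hlam]
      linear_combination (B * J / 2) * h1
    _ ≤ _ := by
      gcongr
      linarith

end IntegralBound


/-! ### Estimates for the Gabor matrix -/

section KernelEstimates

variable {d n : ℕ}

theorem exists_lintegral_fourierInv_gaborSymb_le (g : 𝓢(Rd d, ℂ)) (N : ℕ) : ∃ C : ℝ, 0 < C ∧
    ∀ (R : ℝ) (u : Rd d → ℂ), 1 ≤ R → SymbolBound R u → ∀ ξ ζ,
      ∫⁻ x, ‖𝓕⁻ (gaborSymb u g ξ ζ) x‖ₑ ≤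
        ENNReal.ofReal (C * ((1 + ‖ζ‖) ^ N)⁻¹ * R ^ ((d : ℝ) / 2)) := by
  obtain ⟨C₁, hC₁, h₁⟩ := exists_integral_norm_fourierInv_le d
  choose C₂ hC₂ h₂ using fun m : ℕ × ℕ => exists_seminorm_gaborSymb_le g m.1 m.2 N
  set S := ∑ m ∈ Finset.Iic (d + 1, d + 1), C₂ m with hS
  have hS0 : 0 ≤ S := Finset.sum_nonneg fun m _ => hC₂ m
  refine ⟨C₁ * (2 ^ (d + 1) * S + 1), by positivity, fun R u hR hu ξ ζ => ?_⟩
  have hR0 : 0 < R := by linarith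
  -- The added 1 keeps B positive even if all the seminorm constants vanish.
  set B := (2 ^ (d + 1) * S + 1) * ((1 + ‖ζ‖) ^ N)⁻¹ with hB
  have hB0 : 0 < B := by positivity
  have h3 := h₁ (gaborSymb u g ξ ζ) R B hR hB0 (fun j hj η => by
    rw [le_div_iff₀ (by positivity), mul_comm]
    have h4 := one_add_le_sup_seminorm_apply (𝕜 := ℂ) (m := (d + 1, j)) le_rfl le_rfl
      (gaborSymb u g ξ ζ) η
    have h5 : ((Finset.Iic (d + 1, j)).sup fun m => SchwartzMap.seminorm ℂ m.1 m.2)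
        (gaborSymb u g ξ ζ) ≤ S * R ^ j * ((1 + ‖ζ‖) ^ N)⁻¹ := by
      refine Seminorm.finset_sup_apply_le (by positivity) fun m hm => (h₂ m R u hR hu ξ ζ).trans ?_
      rw [Finset.mem_Iic] at hm
      have hm2 : m.2 ≤ j := hm.2
      rw [div_eq_mul_inv]
      gcongr
      · exact Finset.single_le_sum (f := C₂) (fun m _ => hC₂ m)
          (Finset.mem_Iic.2 ⟨hm.1, hm2.trans hj⟩)
    calc _ ≤ 2 ^ (d + 1) * (S * R ^ j * ((1 + ‖ζ‖) ^ N)⁻¹) := h4.trans (by gcongr)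
      _ = (2 ^ (d + 1) * S) * ((1 + ‖ζ‖) ^ N)⁻¹ * R ^ j := by ring
      _ ≤ _ := by rw [hB]; gcongr; linarith)
  rw [← ofReal_integral_norm_eq_lintegral_enorm (𝓕⁻ (gaborSymb u g ξ ζ)).integrable]
  refine ENNReal.ofReal_le_ofReal (h3.trans (le_of_eq ?_))
  rw [hB]
  ring

theorem stronglyMeasurable_fourierInv_gaborSymb {u : Rd d → ℂ} (hu : u.HasTemperateGrowth)
    (g : 𝓢(Rd d, ℂ)) (ξ : Rd d) :
    StronglyMeasurable fun z : Rd d × Rd d => 𝓕⁻ (gaborSymb u g ξ (z.1 - ξ)) z.2 := by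
  have h1 : Continuous fun p : (Rd d × Rd d) × Rd d => character p.1.2 p.2 :=
    contDiff_character_uncurry.continuous.comp (by fun_prop :
      Continuous fun p : (Rd d × Rd d) × Rd d => (p.1.2, p.2))
  have h2 : Continuous fun p : (Rd d × Rd d) × Rd d => u (p.2 + ξ) :=
    hu.1.continuous.comp (by fun_prop)
  have h3 : Continuous fun p : (Rd d × Rd d) × Rd d => (𝓕 g) (p.2 - (p.1.1 - ξ)) :=
    (𝓕 g).continuous.comp (by fun_prop)
  have h4 : Continuous fun p : (Rd d × Rd d) × Rd d => star ((𝓕 g) p.2) :=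
    continuous_star.comp ((𝓕 g).continuous.comp (by fun_prop))
  have h5 : StronglyMeasurable fun p : (Rd d × Rd d) × Rd d => character p.1.2 p.2 *
      (u (p.2 + ξ) * ((𝓕 g) (p.2 - (p.1.1 - ξ)) * star ((𝓕 g) p.2))) :=
    (h1.mul (h2.mul (h3.mul h4))).stronglyMeasurable
  have h6 := h5.integral_prod_right' (ν := (volume : Measure (Rd d)))
  have h7 : (fun z : Rd d × Rd d => 𝓕⁻ (gaborSymb u g ξ (z.1 - ξ)) z.2) = fun z => ∫ η, character z.2 η *
      (u (η + ξ) * ((𝓕 g) (η - (z.1 - ξ)) * star ((𝓕 g) η))) := by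
    funext z
    rw [fourierInv_eq_integral_character]
    refine integral_congr_ae (Filter.Eventually.of_forall fun η => ?_)
    simp only [gaborSymb_apply hu]
  rw [h7]
  exact h6

theorem continuous_stft (g : 𝓢(Rd d, ℂ)) (f : 𝓢'(Rd d, Cn n)) :
    Continuous fun z : Rd d × Rd d => stft g f z.1 z.2 :=
  (map_continuous f).comp (continuous_shiftConj g)

/-- A continuous functional sees only finitely many seminorms of the shifted window. Polynomial
growth in x makes the convolutions with Schwartz kernels absolutely convergent. -/
theorem exists_norm_stft_le (g : 𝓢(Rd d, ℂ)) (f : 𝓢'(Rd d, Cn n)) (ξ : Rd d) :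
    ∃ (C : ℝ) (a : ℕ), 0 ≤ C ∧ ∀ x, ‖stft g f x ξ‖ ≤ C * (1 + ‖x‖) ^ a := by
  obtain ⟨s, C, -, hC⟩ := Seminorm.bound_of_continuous (schwartz_withSeminorms ℂ (Rd d) ℂ)
    ((normSeminorm ℂ (Cn n)).comp (distCLM f).toLinearMap) (by
      change Continuous fun φ => ‖distCLM f φ‖
      fun_prop)
  choose C' hC' h' using fun m : ℕ × ℕ => exists_seminorm_shiftConj_le g m.1 m.2
  set a := s.sup Prod.fst
  have hsum : 0 ≤ ∑ m ∈ s, C' m * (1 + ‖ξ‖) ^ m.2 :=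
    Finset.sum_nonneg fun m _ => mul_nonneg (hC' m) (by positivity)
  refine ⟨C * ∑ m ∈ s, C' m * (1 + ‖ξ‖) ^ m.2, a, by positivity, fun x => ?_⟩
  have h1 : ‖stft g f x ξ‖ ≤ C * (s.sup (schwartzSeminormFamily ℂ (Rd d) ℂ))
    (shiftConj g (x, ξ)) := hC (shiftConj g (x, ξ))
  refine h1.trans ?_
  rw [mul_assoc]
  gcongr
  refine Seminorm.finset_sup_apply_le (by positivity) fun m hm => (h' m (x, ξ)).trans ?_
  have h2 : (1 + ‖x‖) ^ m.1 ≤ (1 + ‖x‖) ^ a :=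
    pow_le_pow_right₀ (by linarith [norm_nonneg x]) (Finset.le_sup (f := Prod.fst) hm)
  have hnn := hC' m
  calc C' m * (1 + ‖x‖) ^ m.1 * (1 + ‖ξ‖) ^ m.2 ≤ C' m * (1 + ‖x‖) ^ a * (1 + ‖ξ‖) ^ m.2 := by
        gcongr
    _ = (C' m * (1 + ‖ξ‖) ^ m.2) * (1 + ‖x‖) ^ a := by ring
    _ ≤ _ := by
      gcongr
      exact Finset.single_le_sum (f := fun m : ℕ × ℕ => C' m * (1 + ‖ξ‖) ^ m.2)
        (fun m _ => mul_nonneg (hC' m) (by positivity)) hm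

theorem integrable_kernel_smul_of_growth (k : 𝓢(Rd d, ℂ)) {F : Rd d → Cn n} (hF : Continuous F)
    {C : ℝ} {a : ℕ} (hC : 0 ≤ C) (hb : ∀ y, ‖F y‖ ≤ C * (1 + ‖y‖) ^ a) (x : Rd d) :
    Integrable fun y => k (x - y) • F y := by
  obtain ⟨C', hC', h'⟩ := norm_iteratedFDeriv_schwartz_le k 0 (a + (d + 1))
  have h0 : Integrable fun y : Rd d => (C * C' * (1 + ‖x‖) ^ a) * ((1 + ‖x - y‖) ^ (d + 1))⁻¹ :=
    (((integrable_inv_pow (d := d) (N := d + 1) (by omega)).comp_sub_left x)).const_mul _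
  refine h0.mono' ?_ (Filter.Eventually.of_forall fun y => ?_)
  · exact ((k.continuous.comp (by fun_prop)).smul hF).aestronglyMeasurable
  · have h1 := h' 0 le_rfl (x - y)
    rw [norm_iteratedFDeriv_zero] at h1
    have h2 : 1 + ‖y‖ ≤ (1 + ‖x‖) * (1 + ‖x - y‖) := by
      have := norm_sub_le x (x - y)
      rw [sub_sub_cancel] at this
      nlinarith [norm_nonneg x, norm_nonneg (x - y)]
    rw [norm_smul, ← div_eq_mul_inv, le_div_iff₀ (by positivity)]
    calc ‖k (x - y)‖ * ‖F y‖ * (1 + ‖x - y‖) ^ (d + 1)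
        ≤ ‖k (x - y)‖ * (C * ((1 + ‖x‖) * (1 + ‖x - y‖)) ^ a) * (1 + ‖x - y‖) ^ (d + 1) := by
          gcongr
          exact (hb y).trans (by gcongr)
      _ = C * (1 + ‖x‖) ^ a * ((1 + ‖x - y‖) ^ (a + (d + 1)) * ‖k (x - y)‖) := by
          rw [mul_pow, pow_add]; ring
      _ ≤ C * (1 + ‖x‖) ^ a * C' := by gcongr
      _ = _ := by ring

/-- The demodulated short-time Fourier transform at a fixed frequency. -/
def demod (g : 𝓢(Rd d, ℂ)) (f : 𝓢'(Rd d, Cn n)) (ξ ξ' x' : Rd d) : Cn n :=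
  character (ξ' - ξ) x' • stft g f x' ξ'

theorem continuous_demod (g : 𝓢(Rd d, ℂ)) (f : 𝓢'(Rd d, Cn n)) (ξ : Rd d) :
    Continuous fun z : Rd d × Rd d => demod g f ξ z.1 z.2 := by
  have h1 : Continuous fun z : Rd d × Rd d => character (z.1 - ξ) z.2 :=
    Continuous.comp (g := fun z : Rd d × Rd d => character z.1 z.2)
      (f := fun z : Rd d × Rd d => (z.1 - ξ, z.2)) contDiff_character_uncurry.continuous
      (by fun_prop)
  have h2 : Continuous fun z : Rd d × Rd d => stft g f z.2 z.1 :=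
    Continuous.comp (g := fun z : Rd d × Rd d => stft g f z.1 z.2)
      (f := fun z : Rd d × Rd d => (z.2, z.1)) (continuous_stft g f) (by fun_prop)
  exact Continuous.smul h1 h2

theorem norm_demod (g : 𝓢(Rd d, ℂ)) (f : 𝓢'(Rd d, Cn n)) (ξ ξ' x' : Rd d) :
    ‖demod g f ξ ξ' x'‖ = ‖stft g f x' ξ'‖ := by
  rw [demod, norm_smul, norm_character, one_mul]

/-- This is the inversion formula tested on the multiplier image of a shifted window. The phase of
the Gabor matrix is absorbed by `demod`, so for each ξ' the integral over x' is a genuine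
convolution. -/
theorem energy_smul_apply_fourierMul {u : Rd d → ℂ} (hu : u.HasTemperateGrowth)
    (g : 𝓢(Rd d, ℂ)) (f : 𝓢'(Rd d, Cn n)) (x ξ : Rd d) :
    (energy g : ℂ) • f (fourierMul u (shiftConj g (x, ξ))) =
      ∫ ξ', convOp (𝓕⁻ (gaborSymb u g ξ (ξ' - ξ))) (demod g f ξ ξ') x := by
  obtain ⟨h1, h2⟩ := stft_inversion g (fourierMul u (shiftConj g (x, ξ))) f
  rw [h2]
  rw [Measure.volume_eq_prod] at h1 ⊢
  rw [integral_prod_symm _ h1]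
  refine integral_congr_ae (Filter.Eventually.of_forall fun ξ' => ?_)
  refine integral_congr_ae (Filter.Eventually.of_forall fun x' => ?_)
  simp only [demod]
  rw [shiftCoeff_fourierMul hu, smul_smul, mul_comm]

theorem enorm_apply_fourierMul_le {u : Rd d → ℂ} (hu : u.HasTemperateGrowth)
    {g : 𝓢(Rd d, ℂ)} (hg : g ≠ 0) (f : 𝓢'(Rd d, Cn n)) (x ξ : Rd d) :
    ‖f (fourierMul u (shiftConj g (x, ξ)))‖ₑ ≤ ENNReal.ofReal (energy g)⁻¹ *
      ∫⁻ ξ', ‖convOp (𝓕⁻ (gaborSymb u g ξ (ξ' - ξ))) (demod g f ξ ξ') x‖ₑ := by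
  have he := energy_pos hg
  have h1 : f (fourierMul u (shiftConj g (x, ξ))) = (((energy g)⁻¹ : ℝ) : ℂ) •
      ∫ ξ', convOp (𝓕⁻ (gaborSymb u g ξ (ξ' - ξ))) (demod g f ξ ξ') x := by
    rw [← energy_smul_apply_fourierMul hu, smul_smul, ← Complex.ofReal_mul,
      inv_mul_cancel₀ he.ne', Complex.ofReal_one, one_smul]
  rw [h1, enorm_smul]
  have h2 : ‖(((energy g)⁻¹ : ℝ) : ℂ)‖ₑ = ENNReal.ofReal (energy g)⁻¹ := by
    rw [← ofReal_norm, Complex.norm_real, Real.norm_of_nonneg (by positivity)]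
  rw [h2]
  exact mul_le_mul_right (enorm_integral_le_lintegral_enorm _) _

theorem measurable_enorm_convOp_gabor {u : Rd d → ℂ} (hu : u.HasTemperateGrowth)
    (g : 𝓢(Rd d, ℂ)) (f : 𝓢'(Rd d, Cn n)) (ξ : Rd d) :
    Measurable fun z : Rd d × Rd d =>
      ‖convOp (𝓕⁻ (gaborSymb u g ξ (z.1 - ξ))) (demod g f ξ z.1) z.2‖ₑ := by
  have h1 : StronglyMeasurable fun p : (Rd d × Rd d) × Rd d =>
      𝓕⁻ (gaborSymb u g ξ (p.1.1 - ξ)) (p.1.2 - p.2) :=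
    (stronglyMeasurable_fourierInv_gaborSymb hu g ξ).comp_measurable
      (g := fun p : (Rd d × Rd d) × Rd d => (p.1.1, p.1.2 - p.2)) (by fun_prop)
  have h2 : StronglyMeasurable fun p : (Rd d × Rd d) × Rd d => demod g f ξ p.1.1 p.2 :=
    ((continuous_demod g f ξ).comp (by fun_prop :
      Continuous fun p : (Rd d × Rd d) × Rd d => (p.1.1, p.2))).stronglyMeasurable
  exact (StronglyMeasurable.integral_prod_right' (h1.smul h2)).enorm

theorem enorm_convOp_gabor_le {u : Rd d → ℂ} {g : 𝓢(Rd d, ℂ)} {N : ℕ} {C : ℝ} (hC : 0 ≤ C)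
    (h : ∀ ξ ζ x, ‖𝓕⁻ (gaborSymb u g ξ ζ) x‖ ≤ C * (((1 + ‖x‖) ^ N)⁻¹ * ((1 + ‖ζ‖) ^ N)⁻¹))
    (f : 𝓢'(Rd d, Cn n)) (ξ ξ' x : Rd d) :
    ‖convOp (𝓕⁻ (gaborSymb u g ξ (ξ' - ξ))) (demod g f ξ ξ') x‖ₑ ≤
      ∫⁻ x', ENNReal.ofReal (C * ((1 + ‖ξ - ξ'‖) ^ N)⁻¹) *
        (ENNReal.ofReal (((1 + ‖x - x'‖) ^ N)⁻¹) * ‖stft g f x' ξ'‖ₑ) := by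
  refine (enorm_convOp_le _ _ _).trans (lintegral_mono fun x' => ?_)
  rw [← mul_assoc, ← ENNReal.ofReal_mul (by positivity)]
  have h1 : ‖demod g f ξ ξ' x'‖ₑ = ‖stft g f x' ξ'‖ₑ := by
    rw [← ofReal_norm, norm_demod, ofReal_norm]
  rw [h1, ← ofReal_norm (𝓕⁻ (gaborSymb u g ξ (ξ' - ξ)) (x - x'))]
  refine mul_le_mul_left (ENNReal.ofReal_le_ofReal ((h ξ (ξ' - ξ) (x - x')).trans (le_of_eq ?_))) _
  rw [norm_sub_rev ξ' ξ]
  ring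

end KernelEstimates


/-! ### Norms and weights -/

section NormForms

variable {d n : ℕ}

theorem eLpNorm_weight_smul {α : Type*} [MeasurableSpace α] (μ : Measure α) (w : α → Rd d) (r : ℝ)
    (F : α → Cn n) (p : ℝ≥0∞) :
    eLpNorm (fun a => weight r (w a) • F a) p μ = eLpNorm (fun a => eweight r (w a) * ‖F a‖ₑ) p μ := by
  rw [← eLpNorm_enorm]
  congr 1
  funext a
  rw [enorm_smul, Real.enorm_eq_ofReal (weight_pos _ _).le, eweight]

theorem modulationNorm_eq (g : 𝓢(Rd d, ℂ)) (p q : ℝ≥0∞) (r s : ℝ) (f : 𝓢'(Rd d, Cn n)) :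
    modulationNorm g p q r s f = eLpNorm (fun ξ : Rd d => eweight s ξ *
      eLpNorm (fun x : Rd d => eweight r x * ‖stft g f x ξ‖ₑ) p volume) q volume := by
  rw [modulationNorm]
  congr 1
  funext ξ
  rw [eLpNorm_weight_smul volume (fun x => x) r (fun x => stft g f x ξ), eweight]

theorem amalgamNorm_eq (g : 𝓢(Rd d, ℂ)) (p q : ℝ≥0∞) (r s : ℝ) (f : 𝓢'(Rd d, Cn n)) :
    amalgamNorm g p q r s f = eLpNorm (fun x : Rd d => eweight s x *
      eLpNorm (fun ξ : Rd d => eweight r ξ * ‖stft g f x ξ‖ₑ) p volume) q volume := by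
  rw [amalgamNorm]
  congr 1
  funext x
  rw [eLpNorm_weight_smul volume (fun ξ => ξ) r (fun ξ => stft g f x ξ), eweight]

theorem eweight_zero (x : Rd d) : eweight 0 x = 1 := by
  simp [eweight, weight]

/-- Polynomial decay of order `N`. -/
def polyDecay (N : ℕ) (x : Rd d) : ℝ≥0∞ := ENNReal.ofReal ((1 + ‖x‖) ^ N)⁻¹

theorem measurable_polyDecay (N : ℕ) : Measurable (polyDecay N : Rd d → ℝ≥0∞) := by
  unfold polyDecay
  fun_prop

/-- The weight costs at most ρ powers of 1 + |x|, and d + 1 further powers ensure integrability. -/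
theorem lintegral_eweight_mul_polyDecay_lt_top {ρ : ℝ} (hρ : 0 ≤ ρ) {N : ℕ}
    (hN : ρ + (d + 1) ≤ N) : ∫⁻ x : Rd d, eweight ρ x * polyDecay N x < ∞ := by
  refine lt_of_le_of_lt (lintegral_mono fun x => ?_)
    (integrable_inv_pow (d := d) (N := d + 1) (by omega)).lintegral_lt_top
  rw [eweight, polyDecay, ← ENNReal.ofReal_mul (weight_pos _ _).le]
  refine ENNReal.ofReal_le_ofReal ?_
  have h0 : 0 < 1 + ‖x‖ := by positivity
  have h1 : weight ρ x ≤ (1 + ‖x‖) ^ ρ := by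
    rw [weight]
    calc (1 + ‖x‖ ^ 2) ^ (ρ / 2) ≤ ((1 + ‖x‖) ^ (2 : ℝ)) ^ (ρ / 2) := by
          refine Real.rpow_le_rpow (by positivity) ?_ (by positivity)
          rw [Real.rpow_two]
          nlinarith [norm_nonneg x]
      _ = (1 + ‖x‖) ^ ρ := by rw [← Real.rpow_mul h0.le]; congr 1; ring
  rw [← div_eq_mul_inv, div_le_iff₀ (by positivity), ← div_eq_inv_mul,
    le_div_iff₀ (by positivity)]
  calc weight ρ x * (1 + ‖x‖) ^ (d + 1) ≤ (1 + ‖x‖) ^ ρ * (1 + ‖x‖) ^ (d + 1) := by gcongr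
    _ = (1 + ‖x‖) ^ (ρ + (d + 1)) := by
      rw [Real.rpow_add h0, ← Nat.cast_succ, Real.rpow_natCast]
    _ ≤ (1 + ‖x‖) ^ (N : ℝ) :=
      Real.rpow_le_rpow_of_exponent_le (by linarith [norm_nonneg x]) hN
    _ = _ := Real.rpow_natCast _ _

end NormForms

/-! ### Boundedness of Fourier multipliers -/

section Estimates

variable {d n : ℕ} {ι : Type*} [Fintype ι]

theorem measurable_enorm_stft_swap (g : 𝓢(Rd d, ℂ)) (f : 𝓢'(Rd d, Cn n)) :
    Measurable fun z : Rd d × Rd d => ‖stft g f z.2 z.1‖ₑ := by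
  have h : Continuous fun z : Rd d × Rd d => stft g f z.2 z.1 :=
    Continuous.comp (g := fun z : Rd d × Rd d => stft g f z.1 z.2)
      (f := fun z : Rd d × Rd d => (z.2, z.1)) (continuous_stft g f) (by fun_prop)
  exact h.measurable.enorm

/-- The short-time Fourier transform of `f'` is controlled by the images of `f` under the Fourier
multipliers with symbols `U i`. -/
def DominatedBy (U : ι → Rd d → ℂ) (g : 𝓢(Rd d, ℂ)) (f f' : 𝓢'(Rd d, Cn n)) : Prop :=
  ∀ x ξ, ‖stft g f' x ξ‖ₑ ≤ ∑ i, ‖f (fourierMul (U i) (shiftConj g (x, ξ)))‖ₑ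

variable (ι) in
-- Pointwise decay of the Gabor matrix turns domination into convolution with a product kernel; the
-- sum over i only contributes the number of symbols.
theorem exists_enorm_stft_le {g : 𝓢(Rd d, ℂ)} (hg : g ≠ 0) (N : ℕ) {R : ℝ} (hR : 1 ≤ R) :
    ∃ C : ℝ, 0 ≤ C ∧ ∀ (U : ι → Rd d → ℂ), (∀ i, SymbolBound R (U i)) →
      ∀ f f' : 𝓢'(Rd d, Cn n), DominatedBy U g f f' → ∀ x ξ, ‖stft g f' x ξ‖ₑ ≤
        ∫⁻ ξ', ∫⁻ x', (ENNReal.ofReal C * polyDecay N (ξ - ξ')) *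
          (polyDecay N (x - x') * ‖stft g f x' ξ'‖ₑ) := by
  obtain ⟨C₀, hC₀, h₀⟩ := exists_norm_fourierInv_gaborSymb_le g N hR
  have he := energy_pos hg
  refine ⟨Fintype.card ι * ((energy g)⁻¹ * C₀), by positivity, fun U hU f f' hf x ξ => ?_⟩
  set Q := ∫⁻ ξ', ∫⁻ x', polyDecay N (ξ - ξ') * (polyDecay N (x - x') * ‖stft g f x' ξ'‖ₑ) with hQ
  have hpull : ∀ c : ℝ, ∫⁻ ξ', ∫⁻ x', (ENNReal.ofReal c * polyDecay N (ξ - ξ')) *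
      (polyDecay N (x - x') * ‖stft g f x' ξ'‖ₑ) = ENNReal.ofReal c * Q := by
    intro c
    rw [hQ, ← lintegral_const_mul' _ _ ENNReal.ofReal_ne_top]
    refine lintegral_congr fun ξ' => ?_
    rw [← lintegral_const_mul' _ _ ENNReal.ofReal_ne_top]
    refine lintegral_congr fun x' => ?_
    rw [mul_assoc]
  have hterm : ∀ i, ‖f (fourierMul (U i) (shiftConj g (x, ξ)))‖ₑ ≤
      ENNReal.ofReal ((energy g)⁻¹ * C₀) * Q := by
    intro i
    refine (enorm_apply_fourierMul_le (hU i).temperate hg f x ξ).trans ?_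
    rw [ENNReal.ofReal_mul (by positivity), mul_assoc, ← hpull]
    refine mul_le_mul_right (lintegral_mono fun ξ' => ?_) _
    refine (enorm_convOp_gabor_le hC₀ (h₀ (U i) (hU i)) f ξ ξ' x).trans (le_of_eq ?_)
    simp only [polyDecay, ENNReal.ofReal_mul hC₀]
  rw [hpull]
  calc ‖stft g f' x ξ‖ₑ ≤ ∑ i, ‖f (fourierMul (U i) (shiftConj g (x, ξ)))‖ₑ := hf x ξ
    _ ≤ ∑ _i : ι, ENNReal.ofReal ((energy g)⁻¹ * C₀) * Q := Finset.sum_le_sum fun i _ => hterm i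
    _ = _ := by
      rw [Finset.sum_const, Finset.card_univ, nsmul_eq_mul,
        ENNReal.ofReal_mul (p := (Fintype.card ι : ℝ)) (by positivity), ENNReal.ofReal_natCast,
        mul_assoc]

/-- A finite extended non-negative constant is dominated by a positive real one. -/
theorem exists_pos_le_ofReal {c : ℝ≥0∞} (hc : c ≠ ∞) : ∃ C : ℝ, 0 < C ∧ c ≤ ENNReal.ofReal C :=
  ⟨c.toReal + 1, by positivity, by
    rw [← ENNReal.ofReal_toReal hc]
    exact ENNReal.ofReal_le_ofReal (by simp)⟩

theorem mixed_const_ne_top (r s : ℝ) (C : ℝ) {N : ℕ} (hr : |r| + (d + 1) ≤ N)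
    (hs : |s| + (d + 1) ≤ N) :
    ENNReal.ofReal (2 ^ (|s| / 2)) * (ENNReal.ofReal (2 ^ (|r| / 2)) *
        (∫⁻ a : Rd d, eweight |r| a * (ENNReal.ofReal C * polyDecay N a)) *
        (∫⁻ b : Rd d, eweight |s| b * polyDecay N b)) ≠ ∞ := by
  have h1 := (lintegral_eweight_mul_polyDecay_lt_top (abs_nonneg r) hr).ne
  have h2 := (lintegral_eweight_mul_polyDecay_lt_top (abs_nonneg s) hs).ne
  simp_rw [mul_left_comm _ (ENNReal.ofReal C)]
  rw [lintegral_const_mul' _ _ ENNReal.ofReal_ne_top]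
  finiteness

variable (ι) in
theorem exists_modulationNorm_le {p q : ℝ≥0∞} (hp : 1 ≤ p) (hq : 1 ≤ q) (r s : ℝ)
    {g : 𝓢(Rd d, ℂ)} (hg : g ≠ 0) {R : ℝ} (hR : 1 ≤ R) :
    ∃ C : ℝ, 0 < C ∧ ∀ (U : ι → Rd d → ℂ), (∀ i, SymbolBound R (U i)) →
      ∀ f f' : 𝓢'(Rd d, Cn n), DominatedBy U g f f' →
        modulationNorm g p q r s f' ≤ ENNReal.ofReal C * modulationNorm g p q r s f := by
  obtain ⟨N, hN⟩ := exists_nat_ge (|r| + |s| + (d + 1))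
  have hr : |r| + (d + 1) ≤ (N : ℝ) := by linarith [abs_nonneg s]
  have hs : |s| + (d + 1) ≤ (N : ℝ) := by linarith [abs_nonneg r]
  obtain ⟨C₀, -, h₀⟩ := exists_enorm_stft_le (n := n) ι hg N hR
  obtain ⟨C, hC, hle⟩ := exists_pos_le_ofReal (mixed_const_ne_top (d := d) s r C₀ hs hr)
  refine ⟨C, hC, fun U hU f f' hf => ?_⟩
  have hF : Measurable (Function.uncurry fun ξ x : Rd d => ‖stft g f x ξ‖ₑ) :=
    measurable_enorm_stft_swap g f
  have h := eLpNorm_mixed_conv_le hp hq r s (G := fun ξ x : Rd d => ‖stft g f' x ξ‖ₑ)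
    (F := fun ξ x : Rd d => ‖stft g f x ξ‖ₑ) (h₁ := polyDecay N)
    (h₂ := fun ξ => ENNReal.ofReal C₀ * polyDecay N ξ) hF (measurable_polyDecay N)
    ((measurable_polyDecay N).const_mul _) (fun ξ x => h₀ U hU f f' hf x ξ)
  rw [modulationNorm_eq, modulationNorm_eq]
  refine h.trans (mul_le_mul_left (le_trans (le_of_eq ?_) hle) _)
  ring

variable (ι) in
-- The product kernel is insensitive to the order of the variables, so after Tonelli the argument
-- for modulation spaces applies with space and frequency exchanged.
theorem exists_amalgamNorm_le {p q : ℝ≥0∞} (hp : 1 ≤ p) (hq : 1 ≤ q) (r s : ℝ)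
    {g : 𝓢(Rd d, ℂ)} (hg : g ≠ 0) {R : ℝ} (hR : 1 ≤ R) :
    ∃ C : ℝ, 0 < C ∧ ∀ (U : ι → Rd d → ℂ), (∀ i, SymbolBound R (U i)) →
      ∀ f f' : 𝓢'(Rd d, Cn n), DominatedBy U g f f' →
        amalgamNorm g p q r s f' ≤ ENNReal.ofReal C * amalgamNorm g p q r s f := by
  obtain ⟨N, hN⟩ := exists_nat_ge (|r| + |s| + (d + 1))
  have hr : |r| + (d + 1) ≤ (N : ℝ) := by linarith [abs_nonneg s]
  have hs : |s| + (d + 1) ≤ (N : ℝ) := by linarith [abs_nonneg r]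
  obtain ⟨C₀, -, h₀⟩ := exists_enorm_stft_le (n := n) ι hg N hR
  obtain ⟨C, hC, hle⟩ := exists_pos_le_ofReal (mixed_const_ne_top (d := d) r s C₀ hr hs)
  refine ⟨C, hC, fun U hU f f' hf => ?_⟩
  have hF : Measurable (Function.uncurry fun x ξ : Rd d => ‖stft g f x ξ‖ₑ) :=
    (continuous_stft g f).measurable.enorm
  have h := eLpNorm_mixed_conv_le hp hq r s (G := fun x ξ : Rd d => ‖stft g f' x ξ‖ₑ)
    (F := fun x ξ : Rd d => ‖stft g f x ξ‖ₑ) (h₂ := polyDecay N)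
    (h₁ := fun ξ => ENNReal.ofReal C₀ * polyDecay N ξ) hF ((measurable_polyDecay N).const_mul _)
    (measurable_polyDecay N) (fun x ξ => by
      refine (h₀ U hU f f' hf x ξ).trans (le_of_eq ?_)
      rw [lintegral_lintegral_swap]
      · refine lintegral_congr fun x' => lintegral_congr fun ξ' => ?_
        ring
      · have h1 : Measurable fun z : Rd d × Rd d => polyDecay N (ξ - z.1) :=
          (measurable_polyDecay N).comp (by fun_prop)
        have h2 : Measurable fun z : Rd d × Rd d => polyDecay N (x - z.2) :=
          (measurable_polyDecay N).comp (by fun_prop)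
        exact ((h1.const_mul _).mul (h2.mul (measurable_enorm_stft_swap g f))).aemeasurable)
  rw [amalgamNorm_eq, amalgamNorm_eq]
  exact h.trans (mul_le_mul_left hle _)

end Estimates


/-! ### Dependence of the bound on the symbol -/

section SharpEstimate

variable {d n : ℕ} {ι : Type*} [Fintype ι]

/-- Interpolating the L² bound of order w = (1 + |ξ' - ξ|)^{-N} with the L¹ bound of order w R^{d/2}
raises R^{d/2} to the power 2|1/2 - 1/p| and keeps the decay w. -/
theorem exists_eLpNorm_convOp_gabor_le {p : ℝ≥0∞} (hp : 1 ≤ p) (g : 𝓢(Rd d, ℂ)) (N : ℕ) :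
    ∃ C : ℝ, 0 ≤ C ∧ ∀ (R : ℝ) (u : Rd d → ℂ), 1 ≤ R → SymbolBound R u →
      ∀ (f : 𝓢'(Rd d, Cn n)) (ξ ξ' : Rd d),
        eLpNorm (convOp (𝓕⁻ (gaborSymb u g ξ (ξ' - ξ))) (demod g f ξ ξ')) p volume ≤
          ENNReal.ofReal (C * R ^ ((d : ℝ) * |1 / 2 - (p⁻¹).toReal|)) * polyDecay N (ξ - ξ') *
            eLpNorm (fun x => stft g f x ξ') p volume := by
  obtain ⟨C₀, hC₀, h₀⟩ := exists_eLpNorm_convOp_le (H := Cn n) hp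
  obtain ⟨C₁, hC₁, h₁⟩ := exists_norm_gaborSymb_le g N
  obtain ⟨C₂, hC₂, h₂⟩ := exists_lintegral_fourierInv_gaborSymb_le g N
  set θ := |1 / 2 - (p⁻¹).toReal| with hθ
  refine ⟨C₀ * (C₁ + 1) * (C₂ / (C₁ + 1)) ^ (2 * θ), by positivity, fun R u hR hu f ξ ξ' => ?_⟩
  have hR0 : 0 < R := by linarith
  set w := ((1 + ‖ξ' - ξ‖) ^ N)⁻¹ with hw
  have hw0 : 0 < w := by positivity
  obtain ⟨C₃, a, hC₃, h₃⟩ := exists_norm_stft_le g f ξ'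
  have hcont : Continuous (demod g f ξ ξ') :=
    Continuous.comp (g := fun z : Rd d × Rd d => demod g f ξ z.1 z.2)
      (f := fun x : Rd d => (ξ', x)) (continuous_demod g f ξ) (by fun_prop)
  -- The multiplier bound is b = (C₁ + 1)w, and A is the ratio of the kernel's L¹ bound to b; w
  -- cancels from A. The shift by 1 avoids dividing by zero.
  have h := h₀ d (𝓕⁻ (gaborSymb u g ξ (ξ' - ξ))) (C₂ / (C₁ + 1) * R ^ ((d : ℝ) / 2))
    ((C₁ + 1) * w) (by positivity) (by positivity)
    ((h₂ R u hR hu ξ (ξ' - ξ)).trans (ENNReal.ofReal_le_ofReal (le_of_eq (by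
      rw [← hw]; field_simp))))
    (fun η => by
      rw [FourierTransform.fourier_fourierInv_eq]
      refine (h₁ R u hR hu ξ (ξ' - ξ) η).trans ?_
      rw [div_eq_mul_inv, ← hw]
      gcongr
      linarith)
    (demod g f ξ ξ') hcont
    (integrable_kernel_smul_of_growth _ hcont hC₃ fun y => by rw [norm_demod]; exact h₃ y)
  refine h.trans (le_of_eq ?_)
  congr 1
  · rw [polyDecay, norm_sub_rev ξ ξ', ← hw, ← ENNReal.ofReal_mul (by positivity)]
    congr 1
    rw [Real.mul_rpow (by positivity) (by positivity), ← Real.rpow_mul hR0.le]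
    have : (d : ℝ) / 2 * (2 * θ) = d * θ := by ring
    rw [this]
    ring
  · exact eLpNorm_congr_norm_ae (Filter.Eventually.of_forall fun x => norm_demod g f ξ ξ' x)

variable (ι) in
-- Absolute values must not enter the x-integral, or the L² cancellation is lost. So the L^p_x norm
-- of each convolution is taken first, for fixed ξ and ξ', and only the frequency variables are
-- treated by a positive kernel.
theorem exists_modulationNorm_zero_le {p q : ℝ≥0∞} (hp : 1 ≤ p) (hq : 1 ≤ q) (s : ℝ)
    {g : 𝓢(Rd d, ℂ)} (hg : g ≠ 0) :
    ∃ C : ℝ, 0 < C ∧ ∀ (R : ℝ), 1 ≤ R → ∀ (U : ι → Rd d → ℂ), (∀ i, SymbolBound R (U i)) →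
      ∀ f f' : 𝓢'(Rd d, Cn n), DominatedBy U g f f' →
        modulationNorm g p q 0 s f' ≤
          ENNReal.ofReal (C * R ^ ((d : ℝ) * |1 / 2 - (p⁻¹).toReal|)) *
            modulationNorm g p q 0 s f := by
  obtain ⟨N, hN⟩ := exists_nat_ge (|s| + (d + 1))
  obtain ⟨C₀, hC₀, h₀⟩ := exists_eLpNorm_convOp_gabor_le (n := n) hp g N
  have he := energy_pos hg
  have hI := (lintegral_eweight_mul_polyDecay_lt_top (abs_nonneg s) hN).ne
  set I := ∫⁻ x : Rd d, eweight |s| x * polyDecay N x with hIdef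
  set e := ENNReal.ofReal (energy g)⁻¹ with hedef
  obtain ⟨C, hC, hle⟩ := exists_pos_le_ofReal (c := ENNReal.ofReal (2 ^ (|s| / 2)) *
    (e * (Fintype.card ι * ENNReal.ofReal C₀) * I)) (by finiteness)
  refine ⟨C, hC, fun R hR U hU f f' hf => ?_⟩
  set D := R ^ ((d : ℝ) * |1 / 2 - (p⁻¹).toReal|) with hD
  have hmeas : ∀ (i : ι) (ξ : Rd d), Measurable fun z : Rd d × Rd d =>
      ‖convOp (𝓕⁻ (gaborSymb (U i) g ξ (z.1 - ξ))) (demod g f ξ z.1) z.2‖ₑ := fun i ξ =>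
    measurable_enorm_convOp_gabor (hU i).temperate g f ξ
  have hmeas1 : ∀ (i : ι) (ξ ξ' : Rd d), Measurable fun x : Rd d =>
      ‖convOp (𝓕⁻ (gaborSymb (U i) g ξ (ξ' - ξ))) (demod g f ξ ξ') x‖ₑ := fun i ξ ξ' =>
    (hmeas i ξ).comp (g := fun z : Rd d × Rd d =>
      ‖convOp (𝓕⁻ (gaborSymb (U i) g ξ (z.1 - ξ))) (demod g f ξ z.1) z.2‖ₑ)
      (f := fun x : Rd d => (ξ', x)) measurable_prodMk_left
  have hmeas2 : ∀ (i : ι) (ξ x : Rd d), Measurable fun ξ' : Rd d =>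
      ‖convOp (𝓕⁻ (gaborSymb (U i) g ξ (ξ' - ξ))) (demod g f ξ ξ') x‖ₑ := fun i ξ x =>
    (hmeas i ξ).comp (g := fun z : Rd d × Rd d =>
      ‖convOp (𝓕⁻ (gaborSymb (U i) g ξ (z.1 - ξ))) (demod g f ξ z.1) z.2‖ₑ)
      (f := fun ξ' : Rd d => (ξ', x)) measurable_prodMk_right
  have hmix := eLpNorm_mixed_le hp hq s (G := fun ξ x : Rd d => ‖stft g f' x ξ‖ₑ)
    (K := fun ξ ξ' x : Rd d => e * ∑ i,
      ‖convOp (𝓕⁻ (gaborSymb (U i) g ξ (ξ' - ξ))) (demod g f ξ ξ') x‖ₑ)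
    (h := fun ξ => e * (Fintype.card ι * ENNReal.ofReal (C₀ * D)) * polyDecay N ξ)
    (N := fun ξ' => eLpNorm (fun x => ‖stft g f x ξ'‖ₑ) p volume)
    (fun ξ => (Finset.measurable_sum Finset.univ fun i _ => hmeas i ξ).const_mul e)
    ((measurable_polyDecay N).const_mul _)
    (measurable_eLpNorm_left (F := fun x ξ : Rd d => ‖stft g f x ξ‖ₑ)
      (continuous_stft g f).measurable.enorm p)
    (fun ξ x => by
      rw [lintegral_const_mul' _ _ ENNReal.ofReal_ne_top, lintegral_finsetSum _ fun i _ =>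
        hmeas2 i ξ x, Finset.mul_sum]
      exact (hf x ξ).trans (Finset.sum_le_sum fun i _ =>
        enorm_apply_fourierMul_le (hU i).temperate hg f x ξ))
    (fun ξ ξ' => by
      rw [eLpNorm_const_mul_ennreal hp (Finset.measurable_sum _ fun i _ => hmeas1 i ξ ξ')]
      have h1 : eLpNorm (fun x => ∑ i,
          ‖convOp (𝓕⁻ (gaborSymb (U i) g ξ (ξ' - ξ))) (demod g f ξ ξ') x‖ₑ) p volume ≤
          ∑ i : ι, ENNReal.ofReal (C₀ * D) * polyDecay N (ξ - ξ') *
            eLpNorm (fun x => ‖stft g f x ξ'‖ₑ) p volume := by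
        have h2 := eLpNorm_sum_le (μ := (volume : Measure (Rd d))) (s := Finset.univ) (p := p)
          (f := fun (i : ι) (x : Rd d) =>
            ‖convOp (𝓕⁻ (gaborSymb (U i) g ξ (ξ' - ξ))) (demod g f ξ ξ') x‖ₑ)
          (fun i _ => (hmeas1 i ξ ξ').aestronglyMeasurable) hp
        have h3 : (∑ i : ι, fun x : Rd d =>
            ‖convOp (𝓕⁻ (gaborSymb (U i) g ξ (ξ' - ξ))) (demod g f ξ ξ') x‖ₑ) = fun x => ∑ i,
            ‖convOp (𝓕⁻ (gaborSymb (U i) g ξ (ξ' - ξ))) (demod g f ξ ξ') x‖ₑ := by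
          funext x
          rw [Finset.sum_apply]
        rw [h3] at h2
        refine h2.trans (Finset.sum_le_sum fun i _ => ?_)
        rw [eLpNorm_enorm, eLpNorm_enorm]
        exact h₀ R (U i) hR (hU i) f ξ ξ'
      rw [Finset.sum_const, Finset.card_univ, nsmul_eq_mul] at h1
      refine (mul_le_mul_right h1 e).trans (le_of_eq ?_)
      ring)
  rw [modulationNorm_eq, modulationNorm_eq]
  simp_rw [eweight_zero, one_mul]
  refine hmix.trans (mul_le_mul_left ?_ _)
  have hpull : ∫⁻ ξ : Rd d, eweight |s| ξ *
      (e * (Fintype.card ι * ENNReal.ofReal (C₀ * D)) * polyDecay N ξ) =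
      e * (Fintype.card ι * ENNReal.ofReal (C₀ * D)) * I := by
    rw [hIdef, ← lintegral_const_mul' _ _ (by finiteness)]
    refine lintegral_congr fun ξ => ?_
    ring
  rw [hpull, ENNReal.ofReal_mul hC₀, ENNReal.ofReal_mul hC.le]
  calc _ = ENNReal.ofReal (2 ^ (|s| / 2)) * (e * (Fintype.card ι * ENNReal.ofReal C₀) * I) *
        ENNReal.ofReal D := by ring
    _ ≤ _ := mul_le_mul_left hle _

end SharpEstimate

/-! ### The symbol of the Dirac propagator -/

section DiracSymbols

variable {d n : ℕ} {m : ℝ} {α : Fin (d + 1) → Matrix (Fin n) (Fin n) ℂ}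

/-- The matrix entry functional `T ↦ (T e_i)_j`. -/
def entryCLM (i j : Fin n) : (Cn n →L[ℂ] Cn n) →L[ℝ] ℂ :=
  ((EuclideanSpace.proj j : Cn n →L[ℂ] ℂ) ∘L
    ContinuousLinearMap.apply ℂ (Cn n) (EuclideanSpace.single i (1 : ℂ))).restrictScalars ℝ

theorem entryCLM_apply (i j : Fin n) (T : Cn n →L[ℂ] Cn n) :
    entryCLM i j T = T (EuclideanSpace.single i (1 : ℂ)) j := rfl

theorem norm_entryCLM_le (i j : Fin n) : ‖entryCLM i j‖ ≤ 1 := by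
  refine ContinuousLinearMap.opNorm_le_bound _ zero_le_one fun T => ?_
  rw [entryCLM_apply, one_mul]
  refine (PiLp.norm_apply_le _ j).trans ((T.le_opNorm _).trans (le_of_eq ?_))
  simp

/-- The entries of the symbol of the Dirac propagator. -/
def entrySymb (m : ℝ) (α : Fin (d + 1) → Matrix (Fin n) (Fin n) ℂ) (t : ℝ) (ij : Fin n × Fin n) :
    Rd d → ℂ :=
  entryCLM ij.1 ij.2 ∘ propag (massSymb m α) (diracSymb α) t

/-- The growth rate in time of the derivatives of the Dirac propagator symbol. -/
def growthRate (α : Fin (d + 1) → Matrix (Fin n) (Fin n) ℂ) : ℝ :=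
  1 + Real.exp 1 * ‖diracSymb α‖

theorem one_le_growthRate (α : Fin (d + 1) → Matrix (Fin n) (Fin n) ℂ) : 1 ≤ growthRate α := by
  rw [growthRate]
  have : 0 ≤ Real.exp 1 * ‖diracSymb α‖ := by positivity
  linarith

theorem one_le_growthRate_mul (α : Fin (d + 1) → Matrix (Fin n) (Fin n) ℂ) (t : ℝ) :
    1 ≤ growthRate α * (1 + |t|) :=
  one_le_mul_of_one_le_of_one_le (one_le_growthRate α) (by linarith [abs_nonneg t])

/-- The propagator bound gives e|t|‖Λ‖ per derivative; the added ones in `growthRate` and in 1 + |t|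
keep R at least 1, as the kernel estimates require. -/
theorem symbolBound_entrySymb (hα : IsDiracMatrices α) (t : ℝ) (ij : Fin n × Fin n) :
    SymbolBound (growthRate α * (1 + |t|)) (entrySymb m α t ij) := by
  have hP := hasTemperateGrowth_propag (isSkew_symb_dirac m hα) t
  have hb : ∀ j y, ‖iteratedFDeriv ℝ j (entrySymb m α t ij) y‖ ≤
      (growthRate α * (1 + |t|)) ^ j := by
    intro j y
    have h1 := (entryCLM ij.1 ij.2).norm_iteratedFDeriv_comp_left (n := j) (x := y)
      (hP.1.contDiffAt (x := y)) (mod_cast le_top)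
    refine h1.trans ((mul_le_of_le_one_left (norm_nonneg _) (norm_entryCLM_le _ _)).trans ?_)
    refine (norm_iteratedFDeriv_propag_le (isSkew_symb_dirac m hα) t j y).trans ?_
    refine pow_le_pow_left₀ (by positivity) ?_ j
    rw [growthRate]
    have h2 : 0 ≤ Real.exp 1 * ‖diracSymb α‖ := by positivity
    nlinarith [abs_nonneg t]
  refine ⟨⟨(entryCLM ij.1 ij.2).contDiff.comp hP.1, fun j => ⟨0, (growthRate α * (1 + |t|)) ^ j,
    fun y => ?_⟩⟩, hb⟩
  simpa using hb j y

/-- The solution formula is tested on a single-component function: the j-th component of e^{tL}(φ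
e_i) is an entry symbol times φ, so ψ(t) is a finite sum of scalar Fourier multipliers of ψ₀. -/
theorem IsDiracSolution.apply_eq {ψ₀ : 𝓢'(Rd d, Cn n)} {ψ : ℝ → 𝓢'(Rd d, Cn n)}
    (hα : IsDiracMatrices α) (h : IsDiracSolution m α ψ₀ ψ) (t : ℝ) (φ : 𝓢(Rd d, ℂ)) (i : Fin n) :
    ψ t φ i = ∑ j, ψ₀ (fourierMul (entrySymb m α t (i, j)) φ) j := by
  have h1 := (isDiracSolution_iff_propag hα ψ₀ ψ).1 h t (singleCLM i (𝓕⁻ φ))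
  rw [extend_singleCLM, extend_apply, TemperedDistribution.fourier_apply,
    FourierTransform.fourier_fourierInv_eq] at h1
  rw [h1]
  refine Finset.sum_congr rfl fun j _ => ?_
  rw [TemperedDistribution.fourier_apply, fourierMul]
  have h2 : coordCLM j (opMul (hasTemperateGrowth_propag (isSkew_symb_dirac m hα) t)
      (singleCLM i (𝓕⁻ φ))) = smulLeftCLM ℂ (entrySymb m α t (i, j)) (𝓕⁻ φ) := by
    ext η
    rw [smulLeftCLM_apply_apply (symbolBound_entrySymb hα t (i, j)).temperate, coordCLM_apply,
      opMul_apply, singleCLM_apply, map_smul]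
    rw [entrySymb, Function.comp_apply, entryCLM_apply, PiLp.smul_apply, smul_eq_mul, smul_eq_mul,
      mul_comm]
  rw [h2]

theorem norm_le_sum_coord (v : Cn n) : ‖v‖ ≤ ∑ i, ‖v i‖ := by
  have h : v = ∑ i, v i • EuclideanSpace.single i (1 : ℂ) := by
    ext j
    simp [Finset.sum_apply, Pi.single_apply]
  conv_lhs => rw [h]
  refine (norm_sum_le _ _).trans (le_of_eq (Finset.sum_congr rfl fun i _ => ?_))
  simp [norm_smul]

theorem IsDiracSolution.dominatedBy {ψ₀ : 𝓢'(Rd d, Cn n)} {ψ : ℝ → 𝓢'(Rd d, Cn n)}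
    (hα : IsDiracMatrices α) (h : IsDiracSolution m α ψ₀ ψ) (t : ℝ) (g : 𝓢(Rd d, ℂ)) :
    DominatedBy (entrySymb m α t) g ψ₀ (ψ t) := by
  intro x ξ
  have h1 : ‖stft g (ψ t) x ξ‖ ≤
      ∑ ij, ‖ψ₀ (fourierMul (entrySymb m α t ij) (shiftConj g (x, ξ)))‖ := by
    refine (norm_le_sum_coord _).trans ?_
    rw [Fintype.sum_prod_type]
    refine Finset.sum_le_sum fun i _ => ?_
    have h2 : stft g (ψ t) x ξ i =
        ∑ j, ψ₀ (fourierMul (entrySymb m α t (i, j)) (shiftConj g (x, ξ))) j :=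
      h.apply_eq hα t (shiftConj g (x, ξ)) i
    rw [h2]
    exact (norm_sum_le _ _).trans (Finset.sum_le_sum fun j _ => PiLp.norm_apply_le _ j)
  rw [← ofReal_norm]
  refine (ENNReal.ofReal_le_ofReal h1).trans (le_of_eq ?_)
  rw [ENNReal.ofReal_sum_of_nonneg fun _ _ => norm_nonneg _]
  simp only [ofReal_norm]

end DiracSymbols

end Dirac

end

/-! ### Well-posedness and the norm estimates -/

theorem theorem1p1 (d n : ℕ) (m : ℝ) (hm : 0 ≤ m)
    (α : Fin (d + 1) → Matrix (Fin n) (Fin n) ℂ) (hα : Dirac.IsDiracMatrices α) :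
    (∀ ψ₀ : 𝓢'(Dirac.Rd d, Dirac.Cn n),
      ∃! ψ : ℝ → 𝓢'(Dirac.Rd d, Dirac.Cn n), Dirac.IsDiracSolution m α ψ₀ ψ) ∧
    ∀ (p q : ℝ≥0∞), 1 ≤ p → 1 ≤ q → ∀ (r s : ℝ) (g : 𝓢(Dirac.Rd d, ℂ)), g ≠ 0 →
      (∃ C : ℝ → ℝ, (∀ t, 0 < C t) ∧
        (∀ ψ₀ ∈ Dirac.modulationSpace d n p q r s,
          ∀ ψ : ℝ → 𝓢'(Dirac.Rd d, Dirac.Cn n), Dirac.IsDiracSolution m α ψ₀ ψ → ∀ t : ℝ,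
            ψ t ∈ Dirac.modulationSpace d n p q r s ∧
            Dirac.modulationNorm g p q r s (ψ t) ≤
              ENNReal.ofReal (C t) * Dirac.modulationNorm g p q r s ψ₀) ∧
        (r = 0 → ∃ C' : ℝ, 0 < C' ∧
          ∀ t, C t ≤ C' * (1 + |t|) ^ ((d : ℝ) * |1 / 2 - (p⁻¹).toReal|))) ∧
      (∃ C : ℝ → ℝ, (∀ t, 0 < C t) ∧
        ∀ ψ₀ ∈ Dirac.amalgamSpace d n p q r s,
          ∀ ψ : ℝ → 𝓢'(Dirac.Rd d, Dirac.Cn n), Dirac.IsDiracSolution m α ψ₀ ψ → ∀ t : ℝ,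
            ψ t ∈ Dirac.amalgamSpace d n p q r s ∧
            Dirac.amalgamNorm g p q r s (ψ t) ≤
              ENNReal.ofReal (C t) * Dirac.amalgamNorm g p q r s ψ₀) := by
  refine ⟨fun ψ₀ => Dirac.existsUnique_isDiracSolution hα ψ₀, fun p q hp hq r s g hg => ⟨?_, ?_⟩⟩
  -- Membership is witnessed by some window γ, possibly different from the window g of the norm.
  -- Applying the estimate with γ on both sides shows membership without comparing windows.
  · have hmem : ∀ ψ₀ ∈ Dirac.modulationSpace d n p q r s,
        ∀ ψ : ℝ → 𝓢'(Dirac.Rd d, Dirac.Cn n), Dirac.IsDiracSolution m α ψ₀ ψ → ∀ t : ℝ,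
          ψ t ∈ Dirac.modulationSpace d n p q r s := by
      rintro ψ₀ ⟨γ, hγ, hfin⟩ ψ hψ t
      obtain ⟨C, -, hC⟩ := Dirac.exists_modulationNorm_le (n := n) (Fin n × Fin n) hp hq r s hγ
        (Dirac.one_le_growthRate_mul α t)
      exact ⟨γ, hγ, (hC _ (Dirac.symbolBound_entrySymb hα t) ψ₀ (ψ t)
        (hψ.dominatedBy hα t γ)).trans_lt (ENNReal.mul_lt_top ENNReal.ofReal_lt_top hfin)⟩
    -- One and the same C must satisfy both the norm bound and the growth bound, so for r = 0 the
    -- sharp constant is used from the start.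
    by_cases hr : r = 0
    · subst hr
      obtain ⟨C, hC0, hC⟩ :=
        Dirac.exists_modulationNorm_zero_le (n := n) (Fin n × Fin n) hp hq s hg
      have hK := Dirac.one_le_growthRate α
      have hK0 : 0 < Dirac.growthRate α := by linarith
      set κ := (d : ℝ) * |1 / 2 - (p⁻¹).toReal|
      refine ⟨fun t => C * (Dirac.growthRate α * (1 + |t|)) ^ κ, fun t => by positivity,
        fun ψ₀ hψ₀ ψ hψ t => ⟨hmem ψ₀ hψ₀ ψ hψ t, hC _ (Dirac.one_le_growthRate_mul α t) _
          (Dirac.symbolBound_entrySymb hα t) ψ₀ (ψ t) (hψ.dominatedBy hα t g)⟩,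
        fun _ => ⟨C * Dirac.growthRate α ^ κ, by positivity, fun t => le_of_eq ?_⟩⟩
      simp only
      rw [Real.mul_rpow hK0.le (by positivity), mul_assoc]
    · choose C hC0 hC using fun t : ℝ => Dirac.exists_modulationNorm_le (n := n) (Fin n × Fin n)
        hp hq r s hg (Dirac.one_le_growthRate_mul α t)
      exact ⟨C, hC0, fun ψ₀ hψ₀ ψ hψ t => ⟨hmem ψ₀ hψ₀ ψ hψ t, hC t _
        (Dirac.symbolBound_entrySymb hα t) ψ₀ (ψ t) (hψ.dominatedBy hα t g)⟩,
        fun h => absurd h hr⟩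
  · choose C hC0 hC using fun t : ℝ => Dirac.exists_amalgamNorm_le (n := n) (Fin n × Fin n)
      hp hq r s hg (Dirac.one_le_growthRate_mul α t)
    refine ⟨C, hC0, ?_⟩
    rintro ψ₀ ⟨γ, hγ, hfin⟩ ψ hψ t
    obtain ⟨C', -, hC'⟩ := Dirac.exists_amalgamNorm_le (n := n) (Fin n × Fin n) hp hq r s hγ
      (Dirac.one_le_growthRate_mul α t)
    exact ⟨⟨γ, hγ, (hC' _ (Dirac.symbolBound_entrySymb hα t) ψ₀ (ψ t)
      (hψ.dominatedBy hα t γ)).trans_lt (ENNReal.mul_lt_top ENNReal.ofReal_lt_top hfin)⟩,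
      hC t _ (Dirac.symbolBound_entrySymb hα t) ψ₀ (ψ t) (hψ.dominatedBy hα t g)⟩
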